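/- Let $n\ge2$, $1<p<n$ and $Q>1$. **Conventions.** $B(x,r)$ and $\overline B(x,r)$ are open and closed Euclidean balls in $\mathbb R^n$. For a compact set $K$ in an open set $\Omega$, $\operatorname{cap}_p(K,\Omega)=\inf\int_\Omega|\nabla\varphi|^p\,dx$ over all $\varphi\in C_0^\infty(\Omega)$ with $\varphi\ge1$ on $K$. A function $u\in W^{1,p}_{\rm loc}(\Omega)$ is a *$Q$-quasiminimizer* in $\Omega$ if $\int_{\{\varphi\ne0\}}|\nabla u|^p\,dx\le Q\int_{\{\varphi\ne0\}}|\nabla(u+\varphi)|^p\,dx$ for all $\varphi\in W^{1,p}_0(\Omega)$. A function $u\in W^{1,p}_0(\Omega)$ is a *$Q$-quasiminimizing potential* in $\Omega$ for a relatively closed set $F\subset\Omega$ if it is a $Q$-quasiminimizer in $\Omega\setminus F$ and $u=1$ on $F$ up to a set of Sobolev $p$-capacity zero; here $u$ is the quasicontinuous representative with $u(x)=\operatorname{ess\,lim\,inf}_{y\to x}u(y)$ for all $x\in\Omega$. For $\delta>0$ we say that: * *Martio's estimate holds with exponent $1/\delta$* if there is $c>0$ such that for all $x_0\in\mathbb R^n$,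 $r>0$, compact $K\subset\overline B(x_0,r)$ and every $Q$-quasiminimizing potential $u$ for $K$ in $B(x_0,3r)$, $$\inf_{B(x_0,2r)}u\ \ge\ c\Bigl(\frac{\operatorname{cap}_p(K,B(x_0,3r))}{r^{n-p}}\Bigr)^{1/\delta};\tag{M}$$ * *the iterated estimate holds at level $k\in\{0,1,2,\dots\}$ with exponent $1/\delta$* if there is $c>0$ such that for all $x_0\in\mathbb R^n$, $r>0$, with $r_j=3^{-j}r$ and $B_j=B(x_0,r_j)$, all compact $K\subset\overline B_1$ and every $Q$-quasiminimizing potential $u$ for $K$ in $B_0$, $$\inf_{B_{k+1}}u\ \ge\ 1-\exp\Bigl(-c\sum_{j=0}^k\Bigl(\frac{\operatorname{cap}_p(K\cap\overline B_{j+1},B_j)}{r_j^{n-p}}\Bigr)^{1/\delta}\Bigr).\tag{I}$$ **Statement.** 1. There are a unique $\bar\alpha\in[1,\infty)$ with $Q=\bar\alpha^p/(1+p(\bar\alpha-1))$ and a unique $p_1\in(P,\infty)$, $P=\frac p{p-1}$, with $(Q^{1/p})^{P}\,\frac{p_1-P}{p_1}\bigl(\frac{p_1}{p_1-1}\bigr)^{P}=1$.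 Put $\gamma=\bar\alpha(n-p)/(p-1)$. Then $\gamma>\frac np-1$ and $\frac{n-p}\gamma=\frac{p-1}{\bar\alpha}=p-\frac{p_1}{p_1-1}$. 2. $|x|^{-\gamma}$ is a quasiminimizer in $B(0,1)\setminus\{0\}$, and its best (least) quasiminimizing constant is $Q$. 3. For $\varepsilon>0$ let $\rho_\varepsilon=\bigl(\frac{\varepsilon}{1+\varepsilon}\bigr)^{1/\gamma}$, $E_\varepsilon=\overline B(0,\rho_\varepsilon)$ and $u_\varepsilon(x)=\min\{\varepsilon(|x|^{-\gamma}-1),1\}$, with $u_\varepsilon(0)=1$. Then $u_\varepsilon$ is a $Q$-quasiminimizing potential for $E_\varepsilon$ in $B(0,1)$, and $\inf_{B(0,\rho)}u_\varepsilon=\varepsilon(\rho^{-\gamma}-1)$ whenever $\rho_\varepsilon\le\rho\le1$. 4. For $0<\rho<r$, $$\operatorname{cap}_p(\overline B(0,\rho),B(0,r))=n\,|B(0,1)|\Bigl(\frac{n-p}{p-1}\Bigr)^{p-1}\Bigl(\rho^{-\frac{n-p}{p-1}}-r^{-\frac{n-p}{p-1}}\Bigr)^{1-p}.$$ In particular $\operatorname{cap}_p(E_\varepsilon,B(0,r))\simeq\rho_\varepsilon^{n-p}\simeq\varepsilon^{(n-p)/\gamma}$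 for $0<\varepsilon\le1$ and $r\ge2\rho_\varepsilon$, with comparison constants independent of $\varepsilon$ and $r$. Moreover, for fixed $\delta>0$, $k\ge0$ and $0<r\le1$, if $x_0=0$ and $K=E_\varepsilon$, then the sum in (I) is $\simeq(\varepsilon^{1/\gamma}/r_k)^{(n-p)/\delta}$ for all $\varepsilon>0$ with $\varepsilon^{1/\gamma}\le r_{k+1}$, with constants independent of $\varepsilon$. 5. Let $\delta>0$, $c>0$ and $\varepsilon_0>0$. If (M) holds with these $c$ and $\delta$ for $x_0=0$, $r=\frac13$, $K=E_\varepsilon$, $u=u_\varepsilon$ and all $0<\varepsilon<\varepsilon_0$, then $\delta\le(n-p)/\gamma$. The same is true, for each $k\ge0$, with (I) for $x_0=0$ and $r=1$ in place of (M). 6. Consequently, if Martio's estimate holds with exponent $1/\delta$, or if the iterated estimate holds with exponent $1/\delta$ at some level $k\ge0$, then $\frac1\delta\ge\frac{\bar\alpha}{p-1}$. In particular, for $\delta=p-\frac s{s-1}$ with $s>\frac p{p-1}$, each of these estimates can only hold if $s\le p_1$. -/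

import Mathlib

open MeasureTheory Filter Topology Set Metric
open scoped ENNReal ContDiff

namespace QuasiMin

/-- Test functions: the class `C_0^∞(Ω)`. -/
def IsTestFunction {n : ℕ} (Ω : Set (EuclideanSpace ℝ (Fin n)))
    (φ : EuclideanSpace ℝ (Fin n) → ℝ) : Prop :=
  ContDiff ℝ ∞ φ ∧ HasCompactSupport φ ∧ tsupport φ ⊆ Ω

/-- `g` is the distributional gradient of `u` in the open set `Ω`. -/
def HasWeakGradient {n : ℕ} (Ω : Set (EuclideanSpace ℝ (Fin n)))
    (u : EuclideanSpace ℝ (Fin n) → ℝ)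
    (g : EuclideanSpace ℝ (Fin n) → EuclideanSpace ℝ (Fin n)) : Prop :=
  LocallyIntegrableOn u Ω ∧ LocallyIntegrableOn g Ω ∧
    ∀ φ, IsTestFunction Ω φ →
      ∫ x in Ω, u x • gradient φ x = -∫ x in Ω, φ x • g x

/-- `u ∈ W^{1,p}_loc(Ω)` with distributional gradient `g`. -/
def MemSobolevLoc {n : ℕ} (p : ℝ) (Ω : Set (EuclideanSpace ℝ (Fin n)))
    (u : EuclideanSpace ℝ (Fin n) → ℝ)
    (g : EuclideanSpace ℝ (Fin n) → EuclideanSpace ℝ (Fin n)) : Prop :=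
  HasWeakGradient Ω u g ∧
    ∀ K, IsCompact K → K ⊆ Ω →
      MemLp u (ENNReal.ofReal p) (volume.restrict K) ∧
      MemLp g (ENNReal.ofReal p) (volume.restrict K)

/-- `u ∈ W^{1,p}_0(Ω)` with distributional gradient `g`: `u` belongs to `W^{1,p}(Ω)` and is
the limit in `W^{1,p}(Ω)` of functions from `C_0^∞(Ω)`. -/
def MemSobolevZero {n : ℕ} (p : ℝ) (Ω : Set (EuclideanSpace ℝ (Fin n)))
    (u : EuclideanSpace ℝ (Fin n) → ℝ)
    (g : EuclideanSpace ℝ (Fin n) → EuclideanSpace ℝ (Fin n)) : Prop :=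
  HasWeakGradient Ω u g ∧
  MemLp u (ENNReal.ofReal p) (volume.restrict Ω) ∧
  MemLp g (ENNReal.ofReal p) (volume.restrict Ω) ∧
  ∃ ψ : ℕ → EuclideanSpace ℝ (Fin n) → ℝ,
    (∀ k, IsTestFunction Ω (ψ k)) ∧
    Tendsto (fun k => eLpNorm (fun x => u x - ψ k x) (ENNReal.ofReal p) (volume.restrict Ω))
      atTop (𝓝 0) ∧
    Tendsto (fun k => eLpNorm (fun x => g x - gradient (ψ k) x) (ENNReal.ofReal p)
      (volume.restrict Ω)) atTop (𝓝 0)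

/-- `u` is a `Q`-quasiminimizer of the `p`-energy in `Ω`: `u ∈ W^{1,p}_loc(Ω)` and
`∫_{φ ≠ 0} |∇u|^p ≤ Q ∫_{φ ≠ 0} |∇(u + φ)|^p` for all `φ ∈ W^{1,p}_0(Ω)`. The distributional
gradient is unique up to null sets. -/
def IsQuasiminimizer {n : ℕ} (p Q : ℝ) (Ω : Set (EuclideanSpace ℝ (Fin n)))
    (u : EuclideanSpace ℝ (Fin n) → ℝ) : Prop :=
  ∃ g, MemSobolevLoc p Ω u g ∧
    ∀ φ h, MemSobolevZero p Ω φ h →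
      ∫⁻ x in {x | x ∈ Ω ∧ φ x ≠ 0}, ‖g x‖ₑ ^ p ≤
        ENNReal.ofReal Q * ∫⁻ x in {x | x ∈ Ω ∧ φ x ≠ 0}, ‖g x + h x‖ₑ ^ p

/-- The Sobolev `p`-capacity of a compact set. -/
noncomputable def sobolevCapCompact {n : ℕ} (p : ℝ) (K : Set (EuclideanSpace ℝ (Fin n))) : ℝ≥0∞ :=
  ⨅ φ : EuclideanSpace ℝ (Fin n) → ℝ, ⨅ _ : IsTestFunction univ φ ∧ ∀ x ∈ K, 1 ≤ φ x,
    ∫⁻ x, (‖φ x‖ₑ ^ p + ‖gradient φ x‖ₑ ^ p)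

/-- The Sobolev `p`-capacity of an arbitrary set: extended from compact sets to open sets from
inside, and from open sets to all sets from outside. -/
noncomputable def sobolevCap {n : ℕ} (p : ℝ) (E : Set (EuclideanSpace ℝ (Fin n))) : ℝ≥0∞ :=
  ⨅ G : Set (EuclideanSpace ℝ (Fin n)), ⨅ _ : IsOpen G ∧ E ⊆ G,
    ⨆ K : Set (EuclideanSpace ℝ (Fin n)), ⨆ _ : IsCompact K ∧ K ⊆ G, sobolevCapCompact p K

/-- The variational `p`-capacity `cap_p(K, Ω)` of a compact set `K ⊆ Ω`. -/
noncomputable def varCap {n : ℕ} (p : ℝ) (K Ω : Set (EuclideanSpace ℝ (Fin n))) : ℝ≥0∞ :=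
  ⨅ φ : EuclideanSpace ℝ (Fin n) → ℝ, ⨅ _ : IsTestFunction Ω φ ∧ ∀ x ∈ K, 1 ≤ φ x,
    ∫⁻ x in Ω, ‖gradient φ x‖ₑ ^ p

/-- `u` is quasicontinuous in `Ω`. -/
def IsQuasicontinuous {n : ℕ} (p : ℝ) (Ω : Set (EuclideanSpace ℝ (Fin n)))
    (u : EuclideanSpace ℝ (Fin n) → ℝ) : Prop :=
  ∀ η : ℝ≥0∞, 0 < η → ∃ G, IsOpen G ∧ sobolevCap p G < η ∧ ContinuousOn u (Ω \ G)

/-- `u` is a `Q`-quasiminimizing potential in `Ω` for the relatively closed set `F ⊆ Ω`: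
`u ∈ W^{1,p}_0(Ω)`, `u` is a `Q`-quasiminimizer in `Ω \ F`, and `u = 1` on `F` up to a set of
capacity zero. The two fields `quasicontinuous` and `lsc_representative` select, among the
functions that agree almost everywhere, the quasicontinuous representative which is
lower semicontinuously regularized, `u(x) = ess lim inf_{y → x} u(y)`; in particular pointwise
infima of `u` over open sets are meaningful. -/
structure IsQuasiminPotential {n : ℕ} (p Q : ℝ) (Ω F : Set (EuclideanSpace ℝ (Fin n)))
    (u : EuclideanSpace ℝ (Fin n) → ℝ) : Prop where
  relClosed : ∃ C, IsClosed C ∧ F = C ∩ Ω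
  mem_zero : ∃ g, MemSobolevZero p Ω u g
  quasimin : IsQuasiminimizer p Q (Ω \ F) u
  eq_one : sobolevCap p {x | x ∈ F ∧ u x ≠ 1} = 0
  quasicontinuous : IsQuasicontinuous p Ω u
  lsc_representative : ∀ x ∈ Ω,
    ((u x : ℝ) : EReal) = liminf (fun y => ((u y : ℝ) : EReal)) (𝓝 x ⊓ ae volume)

/-- With `B = B(x₀, r)`: `inf_{2B} u ≥ c (cap_p(K, 3B) / r^{n-p})^{1/δ}`. -/
def MartioBound {n : ℕ} (p δ c : ℝ) (x₀ : EuclideanSpace ℝ (Fin n)) (r : ℝ)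
    (K : Set (EuclideanSpace ℝ (Fin n))) (u : EuclideanSpace ℝ (Fin n) → ℝ) : Prop :=
  ∀ x ∈ ball x₀ (2 * r),
    c * ((varCap p K (ball x₀ (3 * r))).toReal / r ^ ((n : ℝ) - p)) ^ (1 / δ) ≤ u x

/-- Martio's estimate with exponent `1/δ` holds for `Q`-quasiminimizing potentials in `ℝⁿ`, with
a constant that depends on `n, p, Q, δ` only. -/
def MartioEstimate (n : ℕ) (p Q δ : ℝ) : Prop :=
  ∃ c : ℝ, 0 < c ∧ ∀ (x₀ : EuclideanSpace ℝ (Fin n)) (r : ℝ), 0 < r →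
    ∀ K : Set (EuclideanSpace ℝ (Fin n)), IsCompact K → K ⊆ closedBall x₀ r →
    ∀ u : EuclideanSpace ℝ (Fin n) → ℝ, IsQuasiminPotential p Q (ball x₀ (3 * r)) K u →
      MartioBound p δ c x₀ r K u

/-- The sum `∑_{j=0}^{k} (cap_p(K ∩ closure B_{j+1}, B_j) / r_j^{n-p})^{1/δ}`, where
`B_j = B(x₀, r_j)` and `r_j = 3^{-j} r`. -/
noncomputable def wienerSum {n : ℕ} (p δ : ℝ) (x₀ : EuclideanSpace ℝ (Fin n)) (r : ℝ) (k : ℕ)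
    (K : Set (EuclideanSpace ℝ (Fin n))) : ℝ :=
  ∑ j ∈ Finset.range (k + 1),
    ((varCap p (K ∩ closedBall x₀ (r / 3 ^ (j + 1))) (ball x₀ (r / 3 ^ j))).toReal /
      (r / 3 ^ j) ^ ((n : ℝ) - p)) ^ (1 / δ)

/-- `inf_{B_{k+1}} u ≥ 1 - exp(-c ∑_{j=0}^{k} (cap_p(K ∩ closure B_{j+1}, B_j)/r_j^{n-p})^{1/δ})`. -/
def IteratedBound {n : ℕ} (p δ c : ℝ) (x₀ : EuclideanSpace ℝ (Fin n)) (r : ℝ) (k : ℕ)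
    (K : Set (EuclideanSpace ℝ (Fin n))) (u : EuclideanSpace ℝ (Fin n) → ℝ) : Prop :=
  ∀ x ∈ ball x₀ (r / 3 ^ (k + 1)), 1 - Real.exp (-(c * wienerSum p δ x₀ r k K)) ≤ u x

/-- The iterated estimate with exponent `1/δ` holds at level `k` for `Q`-quasiminimizing
potentials in `ℝⁿ`. (The full iterated estimate is this for all `k`, with `c` independent
of `k`.) -/
def IteratedEstimateAt (n : ℕ) (p Q δ : ℝ) (k : ℕ) : Prop :=
  ∃ c : ℝ, 0 < c ∧ ∀ (x₀ : EuclideanSpace ℝ (Fin n)) (r : ℝ), 0 < r →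
    ∀ K : Set (EuclideanSpace ℝ (Fin n)), IsCompact K → K ⊆ closedBall x₀ (r / 3) →
    ∀ u : EuclideanSpace ℝ (Fin n) → ℝ, IsQuasiminPotential p Q (ball x₀ r) K u →
      IteratedBound p δ c x₀ r k K u

/-- `a ∈ [1, ∞)` solves `Q = a^p / (1 + p (a - 1))`. -/
def IsAlphaBar (p Q a : ℝ) : Prop :=
  1 ≤ a ∧ Q = a ^ p / (1 + p * (a - 1))

/-- `x ∈ (P, ∞)` solves `t^P ((x - P) / x) (x / (x - 1))^P = 1`; the solution is `p_1(P, t)`. -/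
def IsPOne (P t x : ℝ) : Prop :=
  P < x ∧ t ^ P * ((x - P) / x) * (x / (x - 1)) ^ P = 1

/-- The truncated power `u_ε(x) = min {ε (|x|^{-γ} - 1), 1}`, where `|0|^{-γ} = ∞`, so that
`u_ε(0) = 1`. -/
noncomputable def truncPower {n : ℕ} (γ ε : ℝ) (x : EuclideanSpace ℝ (Fin n)) : ℝ :=
  open Classical in if x = 0 then 1 else min (ε * (‖x‖ ^ (-γ) - 1)) 1

/-- `ρ_ε = (ε / (1 + ε))^{1/γ}`. -/
noncomputable def truncRadius (γ ε : ℝ) : ℝ := (ε / (1 + ε)) ^ (1 / γ)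

end QuasiMin

/-!
The radial variable `t = |x| ^ (-β)` with `β = (n - p) / (p - 1)` turns the `p`-energy of radial
functions into a one-dimensional energy with constant weight: for `u = H (|x| ^ (-β))` the energy is
a constant times `∫ |H' (t)| ^ p dt` (`lintegral_polar_rpow`, `lintegral_enorm_radialGradient`). In
this variable `|x| ^ (-γ)` with `γ = α β` is the power `t ^ α`.

*The power is a quasiminimizer.* On an interval `(s, t)` Hölder's inequality compares the energy of
`t ^ α` with that of any function with the same boundary values, and the loss is at most
`Q = α ^ p / (1 + p (α - 1))` (`rpow_sub_mul_le`). A smooth perturbation supported away from the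
origin is restricted to rays, the open set where it does not vanish is split into intervals, and the
inequality is integrated over the sphere (`setLIntegral_radialGradient_le`). The step from test
functions to `W^{1,p}_0` is not immediate, because the sets `{ψ_k ≠ 0}` need not converge when
`ψ_k → φ`: the perturbation is replaced by `T_j (φ) η_m`, where `T_j` vanishes near `0` and `η_m`
vanishes near the origin and has small energy, and the limits in `k`, `m`, `j` are taken one after
the other (`setLIntegral_le_of_tendsto`).

*The constant is the best one.* On the annulus `2 < |x| ^ (-β) < t` the power is replaced by the
function that is affine in `|x| ^ (-β)` with the same boundary values. The annulus is exactly the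
set where the two functions differ, since `t ^ α` is strictly convex, and the ratio of the energies
tends to `Q` as `t → ∞` (`le_of_isQuasiminimizer`).

*Potentials and capacities.* The truncated powers `u_ε` are radial primitives of bounded functions,
hence belong to `W^{1,p}_0` (`memSobolevZero_truncPower`), and are quasiminimizers outside the small
ball because they are affine functions of the power there. The capacity of concentric balls follows
from Hölder's inequality on rays and from smooth radial competitors (`varCap_closedBall_ball`).

*Sharpness.* At a fixed point `u_ε` is of order `ε`, while the right-hand sides of the estimates are
of order `ε ^ ((n - p) / (γ δ))`. As `ε → 0` this forces `(n - p) / (γ δ) ≥ 1`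
(`le_of_martioBound`, `le_of_iteratedBound`). The equation for `p₁` becomes the equation for `α`
under the substitution `α = (p - 1) / (p - p₁ / (p₁ - 1))` (`isPOne_iff`), which gives the bound in
terms of `s`.
-/

namespace QuasiMin

/-! ### The exponents -/

/-- Bernoulli's inequality makes `a ↦ a ^ p / (1 + p (a - 1))` strictly increasing on `[1, ∞)`. -/
lemma strictMonoOn_rpow_div {p : ℝ} (hp : 1 < p) :
    StrictMonoOn (fun a : ℝ => a ^ p / (1 + p * (a - 1))) (Ici 1) := by
  intro a ha b hb hab
  simp only [mem_Ici] at ha hb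
  have ha0 : 0 < a := by linarith
  have hA : 0 < 1 + p * (a - 1) := by nlinarith
  have hB : 0 < 1 + p * (b - 1) := by nlinarith
  have hbern : 1 + p * (b / a - 1) < (b / a) ^ p := by
    have h1 : 1 < b / a := (one_lt_div ha0).2 hab
    have := one_add_mul_self_lt_rpow_one_add (s := b / a - 1) (by linarith) (by linarith) hp
    simpa using this
  have hdiv : (b / a) ^ p = b ^ p / a ^ p := Real.div_rpow (by linarith) ha0.le p
  have hap : 0 < a ^ p := Real.rpow_pos_of_pos ha0 p
  rw [hdiv, lt_div_iff₀ hap] at hbern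
  show a ^ p / (1 + p * (a - 1)) < b ^ p / (1 + p * (b - 1))
  rw [div_lt_div_iff₀ hA hB]
  have key : 1 + p * (b - 1) ≤ (1 + p * (b / a - 1)) * (1 + p * (a - 1)) := by
    have h2 : (b / a) * a = b := div_mul_cancel₀ b ha0.ne'
    have h3 : 0 ≤ (b / a - 1) := by
      have : 1 < b / a := (one_lt_div ha0).2 hab
      linarith
    have h4 : 0 ≤ (p - 1) * (a - 1) * (p * (b / a - 1)) := by
      apply mul_nonneg (mul_nonneg _ _) (mul_nonneg _ _) <;> linarith
    have h5 : b - 1 = (b / a) * (a - 1) + (b / a - 1) := by linarith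
    nlinarith
  calc a ^ p * (1 + p * (b - 1)) ≤ a ^ p * ((1 + p * (b / a - 1)) * (1 + p * (a - 1))) := by
        gcongr
    _ = (1 + p * (b / a - 1)) * a ^ p * (1 + p * (a - 1)) := by ring
    _ < b ^ p * (1 + p * (a - 1)) := by gcongr

lemma exists_isAlphaBar {p Q : ℝ} (hp : 1 < p) (hQ : 1 < Q) :
    ∃ α, 1 < α ∧ IsAlphaBar p Q α ∧ ∀ a, IsAlphaBar p Q a → a = α := by
  have hpos : ∀ a : ℝ, 1 ≤ a → 0 < 1 + p * (a - 1) := fun a ha => by nlinarith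
  -- at this point the quotient is at least `b ^ (p - 1) / p = Q`
  set b : ℝ := (p * Q) ^ (1 / (p - 1)) with hb
  have hpQ : 1 ≤ p * Q := by nlinarith
  have hb1 : 1 ≤ b := Real.one_le_rpow hpQ (by apply div_nonneg <;> linarith)
  have hcont : ContinuousOn (fun a : ℝ => a ^ p / (1 + p * (a - 1))) (Icc 1 b) := by
    apply ContinuousOn.div
    · exact continuousOn_id.rpow_const (fun x hx => Or.inr (by linarith))
    · fun_prop
    · intro x hx; exact (hpos x hx.1).ne'
  have hbQ : Q ≤ b ^ p / (1 + p * (b - 1)) := by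
    rw [le_div_iff₀ (hpos b hb1)]
    have h1 : b ^ p = b ^ (p - 1) * b := by
      rw [← Real.rpow_add_one (by linarith)]; congr 1; ring
    have h2 : b ^ (p - 1) = p * Q := by
      rw [hb, ← Real.rpow_mul (by linarith), one_div_mul_cancel (by linarith), Real.rpow_one]
    rw [h1, h2]
    nlinarith
  obtain ⟨α, hα, hαQ⟩ := intermediate_value_Icc hb1 hcont
    (show Q ∈ Icc _ _ from ⟨by simpa using hQ.le, hbQ⟩)
  refine ⟨α, ?_, ⟨hα.1, hαQ.symm⟩, ?_⟩
  · rcases hα.1.lt_or_eq with h | h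
    · exact h
    · exfalso; rw [← h] at hαQ; simp at hαQ; linarith
  · intro a ha
    exact (strictMonoOn_rpow_div hp).injOn ha.1 hα.1 (ha.2.symm.trans hαQ.symm)

/-- With `α = (p - 1) / (p - x / (x - 1))` the equation for `p₁` is the one for `α`, raised to the
power `1 / (p - 1)`. -/
lemma isPOne_iff {p Q x : ℝ} (hp : 1 < p) (hQ : 1 < Q) (hx : p / (p - 1) < x) :
    IsPOne (p / (p - 1)) (Q ^ (1 / p)) x ↔ IsAlphaBar p Q ((p - 1) / (p - x / (x - 1))) := by
  have hp1 : 0 < p - 1 := by linarith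
  have hx1 : 1 < x := lt_trans (by rw [lt_div_iff₀ hp1]; linarith) hx
  set s := x / (x - 1) with hs
  have hs1 : 1 < s := by rw [hs, lt_div_iff₀ (by linarith)]; linarith
  have hsp : s < p := by
    rw [hs, div_lt_iff₀ (by linarith)]
    rw [div_lt_iff₀ hp1] at hx
    linarith
  have hps : 0 < p - s := by linarith
  set α := (p - 1) / (p - s) with hα
  have hα1 : 1 ≤ α := by rw [hα, le_div_iff₀ hps]; linarith
  have hα0 : 0 < α := by linarith
  have hA : 0 < 1 + p * (α - 1) := by nlinarith
  have hsα : s * α = 1 + p * (α - 1) := by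
    rw [hα]; field_simp; ring
  have hfrac : (x - p / (p - 1)) / x = 1 / (α * s) := by
    rw [hα, hs]
    have h1 : x - 1 ≠ 0 := by linarith
    have h2 : x ≠ 0 := by linarith
    have h3 : p - x / (x - 1) ≠ 0 := hps.ne'
    field_simp
    ring
  have hE : (Q ^ (1 / p)) ^ (p / (p - 1)) * ((x - p / (p - 1)) / x) * s ^ (p / (p - 1)) =
      (Q * (1 + p * (α - 1)) / α ^ p) ^ (1 / (p - 1)) := by
    rw [hfrac, ← Real.rpow_mul (by linarith), ← hsα]
    have e1 : 1 / p * (p / (p - 1)) = 1 / (p - 1) := by field_simp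
    have e2 : p / (p - 1) = 1 + 1 / (p - 1) := by field_simp; ring
    rw [e1, e2, Real.rpow_add (by linarith), Real.rpow_one,
      Real.div_rpow (x := Q * (s * α)) (by positivity) (by positivity),
      Real.mul_rpow (x := Q) (by linarith) (by positivity),
      Real.mul_rpow (x := s) (by linarith) hα0.le, ← Real.rpow_mul hα0.le]
    have e3 : p * (1 / (p - 1)) = 1 + 1 / (p - 1) := by field_simp; ring
    rw [e3, Real.rpow_add hα0, Real.rpow_one]
    have := Real.rpow_pos_of_pos hα0 (1 / (p - 1))
    field_simp
  constructor
  · rintro ⟨-, h⟩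
    refine ⟨hα1, ?_⟩
    rw [hE] at h
    have hbase : 0 ≤ Q * (1 + p * (α - 1)) / α ^ p := by positivity
    have h' : Q * (1 + p * (α - 1)) / α ^ p = 1 := by
      have h2 := congrArg (· ^ (p - 1)) h
      simp only [Real.one_rpow] at h2
      rwa [← Real.rpow_mul hbase, one_div_mul_cancel hp1.ne', Real.rpow_one] at h2
    have hαp : 0 < α ^ p := Real.rpow_pos_of_pos hα0 p
    field_simp at h' ⊢
    exact h'
  · rintro ⟨-, h⟩
    refine ⟨hx, ?_⟩
    rw [hE]
    have hαp : 0 < α ^ p := Real.rpow_pos_of_pos hα0 p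
    have : Q * (1 + p * (α - 1)) / α ^ p = 1 := by
      rw [h]; field_simp
    rw [this, Real.one_rpow]

lemma exists_isPOne {p Q α : ℝ} (hp : 1 < p) (hQ : 1 < Q) (hα : 1 < α)
    (hαQ : IsAlphaBar p Q α) (huniq : ∀ a, IsAlphaBar p Q a → a = α) :
    ∃ p₁, IsPOne (p / (p - 1)) (Q ^ (1 / p)) p₁ ∧
      (∀ x, IsPOne (p / (p - 1)) (Q ^ (1 / p)) x → x = p₁) ∧ p / (p - 1) < p₁ ∧
      p - p₁ / (p₁ - 1) = (p - 1) / α := by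
  have hp1 : 0 < p - 1 := by linarith
  set s := p - (p - 1) / α with hs
  have hdiv : (p - 1) / α < p - 1 := div_lt_self hp1 hα
  have hdiv0 : 0 < (p - 1) / α := div_pos hp1 (by linarith)
  have hs1 : 1 < s := by rw [hs]; linarith
  have hsp : s < p := by rw [hs]; linarith
  set x := s / (s - 1) with hx
  have hs0 : s - 1 ≠ 0 := by linarith
  have hxs : x / (x - 1) = s := by
    rw [hx]
    have : s / (s - 1) - 1 = 1 / (s - 1) := by field_simp; ring
    rw [this]; field_simp
  have hPx : p / (p - 1) < x := by
    rw [hx, div_lt_div_iff₀ hp1 (by linarith)]; nlinarith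
  have hrel : p - x / (x - 1) = (p - 1) / α := by rw [hxs, hs]; ring
  refine ⟨x, ?_, ?_, hPx, hrel⟩
  · rw [isPOne_iff hp hQ hPx, hrel, div_div_cancel₀ hp1.ne']
    exact hαQ
  · intro y hy
    have h := huniq _ ((isPOne_iff hp hQ hy.1).1 hy)
    have hy1 : 1 < y := lt_trans (by rw [lt_div_iff₀ hp1]; linarith) hy.1
    have h2 : p - y / (y - 1) = (p - 1) / α := by
      rw [← h, div_div_cancel₀ hp1.ne']
    have h3 : y / (y - 1) = s := by rw [hs]; linarith
    have : y = s * (y - 1) := by rw [← h3]; field_simp [show y - 1 ≠ 0 by linarith]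
    rw [hx, eq_div_iff hs0]; linarith

/-- The quasiminimizing inequality of `t ↦ t ^ α` on the interval `(s, t)`: it is Hölder's
inequality for two terms. Equality holds for `s = 0`. -/
lemma rpow_sub_mul_le {p α s t : ℝ} (hp : 1 < p) (hα : 1 ≤ α) (hs : 0 < s) (hst : s ≤ t) :
    (t ^ (p * (α - 1) + 1) - s ^ (p * (α - 1) + 1)) * (t - s) ^ (p - 1) ≤
      (t ^ α - s ^ α) ^ p := by
  set q := p * (α - 1) + 1 with hq
  have hp0 : 0 < p := by linarith
  have hq0 : 0 < q := by nlinarith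
  have ht : 0 < t := by linarith
  have hsq : s ^ q ≤ t ^ q := Real.rpow_le_rpow hs.le hst hq0.le
  set p' := p / (p - 1) with hp'
  have hconj : p.HolderConjugate p' := by
    rw [Real.holderConjugate_iff]; refine ⟨hp, ?_⟩; rw [hp']; field_simp; ring
  have hp'0 : 0 < p' := hconj.symm.pos
  have hinv : p'⁻¹ = 1 - p⁻¹ := by rw [hp']; field_simp
  have H := Real.inner_le_Lp_mul_Lq_of_nonneg (s := (Finset.univ : Finset (Fin 2)))
    (f := ![(t ^ q - s ^ q) ^ p⁻¹, (s ^ q) ^ p⁻¹]) (g := ![(t - s) ^ p'⁻¹, s ^ p'⁻¹]) hconj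
    (by
      intro i _; fin_cases i
      · exact Real.rpow_nonneg (by linarith) _
      · exact Real.rpow_nonneg (by positivity) _)
    (by
      intro i _; fin_cases i
      · exact Real.rpow_nonneg (by linarith) _
      · exact Real.rpow_nonneg (by positivity) _)
  simp only [Fin.sum_univ_two, Matrix.cons_val_zero, Matrix.cons_val_one, one_div] at H
  rw [Real.rpow_inv_rpow (by linarith) hp0.ne', Real.rpow_inv_rpow (by positivity) hp0.ne',
    Real.rpow_inv_rpow (by linarith) hp'0.ne', Real.rpow_inv_rpow hs.le hp'0.ne'] at H
  simp only [sub_add_cancel] at H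
  have hcomb : ∀ y : ℝ, 0 < y → (y ^ q) ^ p⁻¹ * y ^ p'⁻¹ = y ^ α := by
    intro y hy
    rw [← Real.rpow_mul hy.le, ← Real.rpow_add hy, hinv, hq]
    congr 1; field_simp; ring
  rw [hcomb s hs, hcomb t ht] at H
  have H2 : (t ^ q - s ^ q) ^ p⁻¹ * (t - s) ^ p'⁻¹ ≤ t ^ α - s ^ α := by linarith
  have h0 : 0 ≤ (t ^ q - s ^ q) ^ p⁻¹ * (t - s) ^ p'⁻¹ :=
    mul_nonneg (Real.rpow_nonneg (by linarith) _) (Real.rpow_nonneg (by linarith) _)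
  have H3 := Real.rpow_le_rpow h0 H2 hp0.le
  rw [Real.mul_rpow (Real.rpow_nonneg (by linarith) _) (Real.rpow_nonneg (by linarith) _),
    Real.rpow_inv_rpow (by linarith) hp0.ne', ← Real.rpow_mul (by linarith)] at H3
  convert H3 using 3
  rw [hinv]; field_simp

/-- The constant in `rpow_sub_mul_le` is sharp as `s / t → 0`. -/
lemma le_of_forall_rpow_sub_mul_le {p α Q Q' s : ℝ} (hp : 1 < p) (hα : 1 ≤ α) (hs : 0 < s)
    (H : ∀ t, s < t → Q * ((t ^ (p * (α - 1) + 1) - s ^ (p * (α - 1) + 1)) * (t - s) ^ (p - 1)) ≤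
      Q' * (t ^ α - s ^ α) ^ p) : Q ≤ Q' := by
  set q := p * (α - 1) + 1 with hq
  have hq0 : 0 < q := by nlinarith
  have H' : ∀ y ∈ Ioo (0 : ℝ) 1,
      Q * ((1 - y ^ q) * (1 - y) ^ (p - 1)) ≤ Q' * (1 - y ^ α) ^ p := by
    intro y hy
    have ht : s < s / y := by rw [lt_div_iff₀ hy.1]; nlinarith [hy.2]
    have h := H (s / y) ht
    have hsy : 0 < s / y := by linarith
    have e1 : ∀ r : ℝ, (s / y) ^ r - s ^ r = (s / y) ^ r * (1 - y ^ r) := by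
      intro r
      have : s ^ r = (s / y) ^ r * y ^ r := by
        rw [← Real.mul_rpow hsy.le hy.1.le, div_mul_cancel₀ _ hy.1.ne']
      rw [mul_sub, mul_one, ← this]
    have e2 : s / y - s = (s / y) * (1 - y) := by
      have := div_mul_cancel₀ s hy.1.ne'
      rw [mul_sub, this, mul_one]
    have hya : y ^ α ≤ 1 := Real.rpow_le_one hy.1.le hy.2.le (by linarith)
    rw [e1, e1, e2, Real.mul_rpow hsy.le (by linarith [hy.2]),
      Real.mul_rpow (by positivity) (by linarith), ← Real.rpow_mul hsy.le] at h
    have e3 : (s / y) ^ (α * p) = (s / y) ^ q * (s / y) ^ (p - 1) := by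
      rw [← Real.rpow_add hsy, hq]; congr 1; ring
    rw [e3] at h
    have hpos : 0 < (s / y) ^ q * (s / y) ^ (p - 1) := by positivity
    refine le_of_mul_le_mul_left ?_ hpos
    calc _ = Q * ((s / y) ^ q * (1 - y ^ q) * ((s / y) ^ (p - 1) * (1 - y) ^ (p - 1))) := by ring
      _ ≤ _ := h
      _ = _ := by ring
  have hc : ∀ r : ℝ, 0 < r → Tendsto (fun y : ℝ => 1 - y ^ r) (𝓝[>] 0) (𝓝 1) := by
    intro r hr
    have : ContinuousAt (fun y : ℝ => 1 - y ^ r) 0 :=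
      continuousAt_const.sub (Real.continuousAt_rpow_const _ _ (Or.inr hr.le))
    have h := this.tendsto
    simp only [Real.zero_rpow hr.ne', sub_zero] at h
    exact h.mono_left nhdsWithin_le_nhds
  have hc1 : Tendsto (fun y : ℝ => 1 - y) (𝓝[>] 0) (𝓝 1) := by
    simpa using hc 1 one_pos
  have hL : Tendsto (fun y : ℝ => Q * ((1 - y ^ q) * (1 - y) ^ (p - 1))) (𝓝[>] 0)
      (𝓝 (Q * (1 * 1 ^ (p - 1)))) :=
    ((hc q hq0).mul (hc1.rpow_const (Or.inl one_ne_zero))).const_mul Q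
  have hR : Tendsto (fun y : ℝ => Q' * (1 - y ^ α) ^ p) (𝓝[>] 0) (𝓝 (Q' * 1 ^ p)) :=
    ((hc α (by linarith)).rpow_const (Or.inl one_ne_zero)).const_mul Q'
  have := le_of_tendsto_of_tendsto hL hR
    (by filter_upwards [Ioo_mem_nhdsGT (zero_lt_one' ℝ)] with y hy using H' y hy)
  simpa using this

/-! ### Polar coordinates -/

lemma lintegral_polar {n : ℕ} (hn : 0 < n) {F : EuclideanSpace ℝ (Fin n) → ℝ≥0∞}
    (hF : Measurable F) :
    ∫⁻ x, F x = ∫⁻ θ : sphere (0 : EuclideanSpace ℝ (Fin n)) 1,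
      (∫⁻ r in Ioi (0 : ℝ), ENNReal.ofReal (r ^ (n - 1)) * F (r • (θ : EuclideanSpace ℝ (Fin n))))
        ∂(volume : Measure (EuclideanSpace ℝ (Fin n))).toSphere := by
  have : Nonempty (Fin n) := ⟨⟨0, hn⟩⟩
  set μ : Measure (EuclideanSpace ℝ (Fin n)) := volume with hμ
  have h1 : ∫⁻ x, F x ∂μ = ∫⁻ x : ({(0)}ᶜ : Set (EuclideanSpace ℝ (Fin n))), F x
      ∂(μ.comap (↑)) := by
    rw [lintegral_subtype_comap (measurableSet_singleton _).compl F, restrict_compl_singleton]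
  rw [h1]
  have h2 := μ.measurePreserving_homeomorphUnitSphereProd.lintegral_comp_emb
    (Homeomorph.measurableEmbedding _)
    (fun z : sphere (0 : EuclideanSpace ℝ (Fin n)) 1 × Ioi (0 : ℝ) =>
      F ((z.2 : ℝ) • (z.1 : EuclideanSpace ℝ (Fin n))))
  have h3 : ∀ x : ({(0)}ᶜ : Set (EuclideanSpace ℝ (Fin n))),
      (((homeomorphUnitSphereProd (EuclideanSpace ℝ (Fin n)) x).2 : ℝ) •
        ((homeomorphUnitSphereProd (EuclideanSpace ℝ (Fin n)) x).1 :
          EuclideanSpace ℝ (Fin n))) = x := by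
    intro x
    have hx : ‖(x : EuclideanSpace ℝ (Fin n))‖ ≠ 0 := norm_ne_zero_iff.2 x.2
    simp [smul_smul, hx]
  simp only [h3] at h2
  have hmeas : Measurable (fun z : sphere (0 : EuclideanSpace ℝ (Fin n)) 1 × Ioi (0 : ℝ) =>
      F ((z.2 : ℝ) • (z.1 : EuclideanSpace ℝ (Fin n)))) := by
    apply hF.comp
    fun_prop
  rw [h2, lintegral_prod _ hmeas.aemeasurable]
  refine lintegral_congr fun θ => ?_
  rw [Measure.volumeIoiPow, lintegral_withDensity_eq_lintegral_mul _ (by fun_prop)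
    (by exact hmeas.comp measurable_prodMk_left)]
  simp only [Pi.mul_apply, finrank_euclideanSpace, Fintype.card_fin]
  rw [lintegral_subtype_comap measurableSet_Ioi (fun r : ℝ => ENNReal.ofReal (r ^ (n - 1)) *
    F (r • (θ : EuclideanSpace ℝ (Fin n))))]

lemma image_rpow_Ioi {c : ℝ} (hc : c ≠ 0) : (fun t : ℝ => t ^ c) '' Ioi 0 = Ioi 0 := by
  ext r
  constructor
  · rintro ⟨t, ht, rfl⟩; exact Real.rpow_pos_of_pos ht c
  · intro hr
    refine ⟨r ^ c⁻¹, Real.rpow_pos_of_pos hr _, Real.rpow_inv_rpow (le_of_lt hr) hc⟩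

/-- Polar coordinates with the radial variable `t = |x| ^ (-β)`, `β = (n - p) / (p - 1)`, in which
the `p`-energy of a radial function has constant weight. -/
lemma lintegral_polar_rpow {n : ℕ} (hn : 0 < n) {p β : ℝ} (hβ : 0 < β)
    (hβp : n + β = (β + 1) * p) {F : EuclideanSpace ℝ (Fin n) → ℝ≥0∞} (hF : Measurable F) :
    ∫⁻ x, F x = ENNReal.ofReal β⁻¹ * ∫⁻ θ : sphere (0 : EuclideanSpace ℝ (Fin n)) 1,
      (∫⁻ t in Ioi (0 : ℝ), ENNReal.ofReal ((t ^ (-β⁻¹)) ^ (β + 1)) ^ p *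
        F (t ^ (-β⁻¹) • (θ : EuclideanSpace ℝ (Fin n))))
        ∂(volume : Measure (EuclideanSpace ℝ (Fin n))).toSphere := by
  rw [lintegral_polar hn hF, ← lintegral_const_mul' _ _ ENNReal.ofReal_ne_top]
  refine lintegral_congr fun θ => ?_
  rw [← lintegral_const_mul' _ _ ENNReal.ofReal_ne_top]
  have hc : -β⁻¹ ≠ 0 := neg_ne_zero.2 (inv_ne_zero hβ.ne')
  conv_lhs => rw [← image_rpow_Ioi hc]
  rw [lintegral_image_eq_lintegral_abs_deriv_mul measurableSet_Ioi
    (fun t ht => (Real.hasDerivAt_rpow_const (Or.inl (ne_of_gt ht))).hasDerivWithinAt)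
    (fun x hx y hy h => by
      have := congrArg (· ^ (-β⁻¹)⁻¹) h
      rwa [Real.rpow_rpow_inv (le_of_lt hx) hc, Real.rpow_rpow_inv (le_of_lt hy) hc] at this)]
  refine setLIntegral_congr_fun measurableSet_Ioi fun t ht => ?_
  have ht' : 0 < t := ht
  rw [← mul_assoc, ← mul_assoc, ENNReal.ofReal_rpow_of_pos (by positivity),
    ← ENNReal.ofReal_mul (by positivity), ← ENNReal.ofReal_mul (by positivity)]
  congr 2
  rw [abs_mul, abs_neg, abs_of_pos (inv_pos.2 hβ), abs_of_pos (Real.rpow_pos_of_pos ht' _),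
    mul_assoc, ← Real.rpow_natCast, ← Real.rpow_mul ht'.le, ← Real.rpow_mul ht'.le,
    ← Real.rpow_mul ht'.le, ← Real.rpow_add ht', Nat.cast_pred hn]
  congr 2
  field_simp
  linarith

/-! ### One-dimensional inequalities -/

/-- An inequality between integrals over intervals passes to open sets if it holds on each of
their components. -/
lemma setLIntegral_le_of_components {U : Set ℝ} (hU : IsOpen U) {a b : ℝ} (hab : U ⊆ Icc a b)
    {F₁ F₂ : ℝ → ℝ≥0∞} {C : ℝ≥0∞}
    (H : ∀ s t, s < t → Ioo s t ⊆ U → s ∉ U → t ∉ U →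
      ∫⁻ x in Ioo s t, F₁ x ≤ C * ∫⁻ x in Ioo s t, F₂ x) :
    ∫⁻ x in U, F₁ x ≤ C * ∫⁻ x in U, F₂ x := by
  set 𝒞 : Set (Set ℝ) := (fun x => connectedComponentIn U x) '' U with h𝒞
  have hopen : ∀ c ∈ 𝒞, IsOpen c := by
    rintro _ ⟨x, _, rfl⟩; exact hU.connectedComponentIn
  have hne : ∀ c ∈ 𝒞, c.Nonempty := by
    rintro _ ⟨x, hx, rfl⟩; exact ⟨x, mem_connectedComponentIn hx⟩
  have hdisj : 𝒞.PairwiseDisjoint id := by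
    rintro _ ⟨x, hx, rfl⟩ _ ⟨y, hy, rfl⟩ hxy
    rw [Function.onFun, Set.disjoint_iff]
    rintro z ⟨hz1, hz2⟩
    exact hxy ((connectedComponentIn_eq hz1).trans (connectedComponentIn_eq hz2).symm)
  have hcount : 𝒞.Countable := hdisj.countable_of_isOpen hopen hne
  have hUnion : U = ⋃ c ∈ 𝒞, c := by
    ext x
    simp only [mem_iUnion, exists_prop]
    constructor
    · intro hx; exact ⟨_, ⟨x, hx, rfl⟩, mem_connectedComponentIn hx⟩
    · rintro ⟨_, ⟨y, hy, rfl⟩, hxy⟩; exact connectedComponentIn_subset _ _ hxy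
  have hsum : ∀ F : ℝ → ℝ≥0∞, ∫⁻ x in U, F x = ∑' c : 𝒞, ∫⁻ x in (c : Set ℝ), F x := by
    intro F
    conv_lhs => rw [hUnion]
    exact lintegral_biUnion hcount (fun c hc => (hopen c hc).measurableSet) hdisj F
  rw [hsum, hsum, ← ENNReal.tsum_mul_left]
  refine ENNReal.tsum_le_tsum ?_
  rintro ⟨_, ⟨x, hx, rfl⟩⟩
  set c := connectedComponentIn U x with hc
  have hcU : c ⊆ U := connectedComponentIn_subset _ _
  have hcne : c.Nonempty := ⟨x, mem_connectedComponentIn hx⟩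
  have hco : IsOpen c := hU.connectedComponentIn
  have hcc : IsPreconnected c := isPreconnected_connectedComponentIn
  have hbb : BddBelow c := ⟨a, fun y hy => (hab (hcU hy)).1⟩
  have hba : BddAbove c := ⟨b, fun y hy => (hab (hcU hy)).2⟩
  have hlim : ∀ z ∈ closure c, z ∈ U → z ∈ c := by
    intro z hz hzU
    have h1 : IsPreconnected (insert z c) :=
      hcc.subset_closure (subset_insert z c) (insert_subset hz subset_closure)
    have h2 := h1.subset_connectedComponentIn (mem_insert_of_mem z (mem_connectedComponentIn hx))
      (insert_subset hzU hcU)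
    exact h2 (mem_insert z c)
  have hinf : sInf c ∉ c := fun h => by
    obtain ⟨l, hl, hl2⟩ := mem_nhdsLE_iff_exists_Ioc_subset.1
      (mem_nhdsWithin_of_mem_nhds (hco.mem_nhds h) : c ∈ 𝓝[≤] (sInf c))
    have hl' : l < sInf c := hl
    have := csInf_le hbb (hl2 (⟨by linarith, by linarith⟩ : (l + sInf c) / 2 ∈ Ioc l (sInf c)))
    linarith
  have hsup : sSup c ∉ c := fun h => by
    obtain ⟨l, hl, hl2⟩ := mem_nhdsGE_iff_exists_Ico_subset.1
      (mem_nhdsWithin_of_mem_nhds (hco.mem_nhds h) : c ∈ 𝓝[≥] (sSup c))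
    have hl' : sSup c < l := hl
    have := le_csSup hba (hl2 (⟨by linarith, by linarith⟩ : (l + sSup c) / 2 ∈ Ico (sSup c) l))
    linarith
  have heq : c = Ioo (sInf c) (sSup c) := by
    apply Subset.antisymm
    · intro y hy
      refine ⟨lt_of_le_of_ne (csInf_le hbb hy) ?_, lt_of_le_of_ne (le_csSup hba hy) ?_⟩
      · rintro h; exact hinf (h ▸ hy)
      · rintro h; exact hsup (h ▸ hy)
    · exact (IsConnected.Ioo_csInf_csSup_subset ⟨hcne, hcc⟩ hbb hba)
  have hx' : x ∈ Ioo (sInf c) (sSup c) := heq ▸ mem_connectedComponentIn hx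
  have := H (sInf c) (sSup c) (hx'.1.trans hx'.2) (heq ▸ hcU)
    (fun h => hinf (hlim _ (csInf_mem_closure hcne hbb) h))
    (fun h => hsup (hlim _ (csSup_mem_closure hcne hba) h))
  simpa only [← heq] using this

/-- Hölder's inequality for the increment of a function over an interval. -/
lemma enorm_sub_rpow_le {p : ℝ} (hp : 1 < p) {v : ℝ → ℝ} {s t : ℝ} (hst : s < t)
    (hv : ContDiffOn ℝ 1 v (Icc s t)) :
    ‖v t - v s‖ₑ ^ p ≤ ENNReal.ofReal (t - s) ^ (p - 1) * ∫⁻ x in Ioo s t, ‖deriv v x‖ₑ ^ p := by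
  have hp0 : 0 < p := by linarith
  have h1 := enorm_sub_le_lintegral_deriv_of_contDiffOn_Icc hv hst.le
  rw [← restrict_Ioo_eq_restrict_Icc] at h1
  have hconj : p.HolderConjugate (p / (p - 1)) := by
    rw [Real.holderConjugate_iff]; refine ⟨hp, ?_⟩
    have : p - 1 ≠ 0 := by linarith
    field_simp; ring
  have h2 := ENNReal.lintegral_mul_le_Lp_mul_Lq (volume.restrict (Ioo s t)) hconj
    (f := fun x => ‖deriv v x‖ₑ) (g := fun _ => 1) (by fun_prop) (by fun_prop)
  simp only [Pi.mul_apply, mul_one, ENNReal.one_rpow, lintegral_const, one_mul,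
    Measure.restrict_apply_univ, Real.volume_Ioo] at h2
  calc ‖v t - v s‖ₑ ^ p ≤ ((∫⁻ x in Ioo s t, ‖deriv v x‖ₑ ^ p) ^ (1 / p) *
        ENNReal.ofReal (t - s) ^ (1 / (p / (p - 1)))) ^ p :=
        ENNReal.rpow_le_rpow (h1.trans h2) hp0.le
    _ = _ := by
      rw [ENNReal.mul_rpow_of_nonneg _ _ hp0.le, ← ENNReal.rpow_mul, ← ENNReal.rpow_mul, mul_comm]
      have e : 1 / (p / (p - 1)) * p = p - 1 := by field_simp
      rw [e, one_div_mul_cancel hp0.ne', ENNReal.rpow_one]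

lemma setLIntegral_rpow_deriv {p α s t : ℝ} (hp : 1 < p) (hα : 1 ≤ α) (hs : 0 < s) (hst : s < t) :
    ∫⁻ x in Ioo s t, ‖α * x ^ (α - 1)‖ₑ ^ p =
      ENNReal.ofReal (α ^ p / (1 + p * (α - 1)) *
        (t ^ (p * (α - 1) + 1) - s ^ (p * (α - 1) + 1))) := by
  have hq : 0 < p * (α - 1) + 1 := by nlinarith
  have hα0 : 0 < α := by linarith
  have h1 : ∫⁻ x in Ioo s t, ‖α * x ^ (α - 1)‖ₑ ^ p =
      ∫⁻ x in Ioo s t, ENNReal.ofReal (α ^ p * x ^ (p * (α - 1))) := by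
    refine setLIntegral_congr_fun measurableSet_Ioo fun x hx => ?_
    have hx0 : 0 < x := hs.trans hx.1
    rw [Real.enorm_eq_ofReal (by positivity), ENNReal.ofReal_rpow_of_pos (by positivity),
      Real.mul_rpow hα0.le (by positivity), ← Real.rpow_mul hx0.le, mul_comm p]
  have hcont : ContinuousOn (fun x : ℝ => α ^ p * x ^ (p * (α - 1))) (uIcc s t) := by
    rw [uIcc_of_le hst.le]
    exact continuousOn_const.mul
      (continuousOn_id.rpow_const fun x hx => Or.inl (hs.trans_le hx.1).ne')
  have hint : IntervalIntegrable (fun x : ℝ => α ^ p * x ^ (p * (α - 1))) volume s t :=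
    hcont.intervalIntegrable
  rw [h1, restrict_Ioo_eq_restrict_Ioc, ← ofReal_integral_eq_lintegral_ofReal
    (hint.1) (by
      filter_upwards [ae_restrict_mem measurableSet_Ioc] with x hx
      have : 0 < x := hs.trans hx.1
      positivity), ← intervalIntegral.integral_of_le hst.le, intervalIntegral.integral_const_mul,
    integral_rpow (Or.inl (by nlinarith))]
  congr 1
  rw [add_comm 1]
  ring

/-- The power `t ^ α` is a quasiminimizer on `(0, ∞)`: the one-dimensional inequality, for a
perturbation `f` that is supported in a compact interval. -/
lemma setLIntegral_rpow_deriv_le {p α Q a b : ℝ} (hp : 1 < p) (hα : 1 ≤ α)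
    (hQ : Q = α ^ p / (1 + p * (α - 1))) (ha : 0 < a) {f : ℝ → ℝ}
    (hf : ContDiffOn ℝ 1 f (Ioi 0)) (hfab : ∀ t, 0 < t → f t ≠ 0 → t ∈ Icc a b) :
    ∫⁻ t in {t | 0 < t ∧ f t ≠ 0}, ‖α * t ^ (α - 1)‖ₑ ^ p ≤
      ENNReal.ofReal Q * ∫⁻ t in {t | 0 < t ∧ f t ≠ 0}, ‖α * t ^ (α - 1) + deriv f t‖ₑ ^ p := by
  have hα0 : 0 < α := by linarith
  have hq : 0 < 1 + p * (α - 1) := by nlinarith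
  have hQ0 : 0 ≤ Q := by rw [hQ]; positivity
  have hU : IsOpen {t | 0 < t ∧ f t ≠ 0} :=
    hf.continuousOn.isOpen_inter_preimage isOpen_Ioi isOpen_ne
  refine setLIntegral_le_of_components hU (a := a) (b := b) (fun t ht => hfab t ht.1 ht.2) ?_
  intro s t hst hsub hs ht
  -- the end points of a component are positive zeros of `f`
  have hsa : a ≤ s := by
    by_contra h
    push Not at h
    obtain ⟨x, hx1, hx2⟩ := exists_between (lt_min h hst)
    have hmem := hsub ⟨hx1, hx2.trans_le (min_le_right _ _)⟩
    have := (hfab x hmem.1 hmem.2).1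
    have := hx2.trans_le (min_le_left _ _)
    linarith
  have hs0 : 0 < s := ha.trans_le hsa
  have ht0 : 0 < t := hs0.trans hst
  have hfs : f s = 0 := by by_contra h; exact hs ⟨hs0, h⟩
  have hft : f t = 0 := by by_contra h; exact ht ⟨ht0, h⟩
  have hIcc : Icc s t ⊆ Ioi 0 := fun x hx => hs0.trans_le hx.1
  have hpow : ContDiffOn ℝ 1 (fun x : ℝ => x ^ α) (Icc s t) := fun x hx =>
    (Real.contDiffAt_rpow_const_of_ne (ne_of_gt (hIcc hx))).contDiffWithinAt
  have hH := enorm_sub_rpow_le hp hst (v := fun x => x ^ α + f x) (hpow.add (hf.mono hIcc))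
  have hder : ∫⁻ x in Ioo s t, ‖deriv (fun x => x ^ α + f x) x‖ₑ ^ p =
      ∫⁻ x in Ioo s t, ‖α * x ^ (α - 1) + deriv f x‖ₑ ^ p := by
    refine setLIntegral_congr_fun measurableSet_Ioo fun x hx => ?_
    have hx0 : 0 < x := hs0.trans hx.1
    have hfd : DifferentiableAt ℝ f x :=
      (hf.contDiffAt (Ioi_mem_nhds hx0)).differentiableAt one_ne_zero
    have := (Real.hasDerivAt_rpow_const (p := α) (Or.inl hx0.ne')).add hfd.hasDerivAt
    rw [show (fun x => x ^ α + f x) = (fun x : ℝ => x ^ α) + f from rfl, this.deriv]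
  simp only [hfs, hft, add_zero] at hH
  rw [hder] at hH
  have hmono : s ^ α ≤ t ^ α := Real.rpow_le_rpow hs0.le hst.le hα0.le
  rw [setLIntegral_rpow_deriv hp hα hs0 hst, ← hQ, ENNReal.ofReal_mul hQ0]
  refine mul_le_mul_right ?_ _
  have hts : 0 < t - s := by linarith
  have hpos : 0 < (t - s) ^ (p - 1) := Real.rpow_pos_of_pos hts _
  rw [Real.enorm_eq_ofReal (by linarith), ENNReal.ofReal_rpow_of_nonneg (by linarith) (by linarith),
    ENNReal.ofReal_rpow_of_pos hts] at hH
  have h2 := ENNReal.ofReal_le_ofReal (rpow_sub_mul_le hp hα hs0 hst.le)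
  rw [ENNReal.ofReal_mul' hpos.le, mul_comm] at h2
  have h3 := h2.trans hH
  rwa [ENNReal.mul_le_mul_iff_right (by simpa using hpos) ENNReal.ofReal_ne_top] at h3

/-! ### Radial functions -/

/-- The gradient of `x ↦ H (|x| ^ (-β))`, where `w` is the derivative of `H`. -/
noncomputable def radialGradient {n : ℕ} (β : ℝ) (w : ℝ → ℝ) (x : EuclideanSpace ℝ (Fin n)) :
    EuclideanSpace ℝ (Fin n) :=
  (-(β * w (‖x‖ ^ (-β)) * ‖x‖ ^ (-β - 2))) • x

lemma measurable_radialGradient {n : ℕ} {β : ℝ} {w : ℝ → ℝ} (hw : Measurable w) :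
    Measurable (radialGradient β w : EuclideanSpace ℝ (Fin n) → _) := by
  unfold radialGradient
  fun_prop

@[simp]
lemma radialGradient_zero {n : ℕ} (β : ℝ) (w : ℝ → ℝ) :
    radialGradient β w (0 : EuclideanSpace ℝ (Fin n)) = 0 := by
  simp [radialGradient]

lemma hasGradientAt_norm_rpow {n : ℕ} {β : ℝ} {x : EuclideanSpace ℝ (Fin n)} (hx : x ≠ 0) :
    HasGradientAt (fun y : EuclideanSpace ℝ (Fin n) => ‖y‖ ^ (-β))
      (radialGradient β (fun _ => 1) x) x := by
  have hx0 : 0 < ‖x‖ := norm_pos_iff.2 hx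
  have h1 : HasFDerivAt (fun y : EuclideanSpace ℝ (Fin n) => ‖y‖ ^ 2) (2 • innerSL ℝ x) x :=
    (hasStrictFDerivAt_norm_sq x).hasFDerivAt
  have h2 := (Real.hasDerivAt_rpow_const (x := ‖x‖ ^ 2) (p := -β / 2)
    (Or.inl (by positivity))).comp_hasFDerivAt x h1
  have h3 : ∀ y : EuclideanSpace ℝ (Fin n), (‖y‖ ^ 2) ^ (-β / 2) = ‖y‖ ^ (-β) := by
    intro y
    rw [← Real.rpow_natCast, ← Real.rpow_mul (norm_nonneg y)]
    congr 1; push_cast; ring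
  rw [hasGradientAt_iff_hasFDerivAt]
  have h4 : (fun y : EuclideanSpace ℝ (Fin n) => ‖y‖ ^ (-β)) =
      (fun t : ℝ => t ^ (-β / 2)) ∘ (fun y : EuclideanSpace ℝ (Fin n) => ‖y‖ ^ 2) := by
    funext y; simp [h3]
  rw [h4]
  refine h2.congr_fderiv ?_
  ext y
  have h5 : (‖x‖ ^ 2) ^ (-β / 2 - 1) = ‖x‖ ^ (-β - 2) := by
    rw [← Real.rpow_natCast, ← Real.rpow_mul (norm_nonneg x)]
    congr 1; push_cast; ring
  rw [h5]
  simp [radialGradient]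
  ring

lemma hasGradientAt_comp_norm_rpow {n : ℕ} {β : ℝ} {H w : ℝ → ℝ} {x : EuclideanSpace ℝ (Fin n)}
    (hx : x ≠ 0) (hH : HasDerivAt H (w (‖x‖ ^ (-β))) (‖x‖ ^ (-β))) :
    HasGradientAt (fun y : EuclideanSpace ℝ (Fin n) => H (‖y‖ ^ (-β)))
      (radialGradient β w x) x := by
  have h1 := (hasGradientAt_norm_rpow (β := β) hx)
  rw [hasGradientAt_iff_hasFDerivAt] at h1 ⊢
  have h2 := hH.comp_hasFDerivAt x h1
  refine h2.congr_fderiv ?_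
  ext y
  simp [radialGradient]
  ring

lemma norm_rpow_smul_sphere {n : ℕ} {β t : ℝ} (ht : 0 < t)
    (θ : sphere (0 : EuclideanSpace ℝ (Fin n)) 1) :
    ‖t ^ (-β⁻¹) • (θ : EuclideanSpace ℝ (Fin n))‖ = t ^ (-β⁻¹) := by
  rw [norm_smul, norm_eq_of_mem_sphere, mul_one, Real.norm_of_nonneg (by positivity)]

lemma rpow_neg_inv_rpow_neg {β t : ℝ} (hβ : β ≠ 0) (ht : 0 < t) : (t ^ (-β⁻¹)) ^ (-β) = t := by
  rw [← Real.rpow_mul ht.le]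
  simp [hβ]

lemma rpow_mul_enorm_radialGradient {n : ℕ} {β t : ℝ} (hβ : 0 < β) (ht : 0 < t) (w : ℝ → ℝ)
    (θ : sphere (0 : EuclideanSpace ℝ (Fin n)) 1) :
    ENNReal.ofReal ((t ^ (-β⁻¹)) ^ (β + 1)) *
      ‖radialGradient β w (t ^ (-β⁻¹) • (θ : EuclideanSpace ℝ (Fin n)))‖ₑ =
    ENNReal.ofReal β * ‖w t‖ₑ := by
  have hr : 0 < t ^ (-β⁻¹) := Real.rpow_pos_of_pos ht _
  rw [radialGradient, norm_rpow_smul_sphere ht, rpow_neg_inv_rpow_neg hβ.ne' ht, enorm_smul,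
    ← ofReal_norm (t ^ (-β⁻¹) • (θ : EuclideanSpace ℝ (Fin n))), norm_rpow_smul_sphere ht,
    ← Real.enorm_of_nonneg hr.le, ← Real.enorm_of_nonneg hβ.le,
    ← Real.enorm_of_nonneg (Real.rpow_nonneg hr.le _), ← enorm_mul, ← enorm_mul, ← enorm_mul]
  have key : (t ^ (-β⁻¹)) ^ (β + 1) * ((t ^ (-β⁻¹)) ^ (-β - 2) * t ^ (-β⁻¹)) = 1 := by
    rw [← Real.rpow_add_one hr.ne', ← Real.rpow_add hr]
    ring_nf
    simp
  rw [show (t ^ (-β⁻¹)) ^ (β + 1) * (-(β * w t * (t ^ (-β⁻¹)) ^ (-β - 2)) * t ^ (-β⁻¹)) =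
    -(β * w t) * ((t ^ (-β⁻¹)) ^ (β + 1) * ((t ^ (-β⁻¹)) ^ (-β - 2) * t ^ (-β⁻¹))) by ring, key,
    mul_one, enorm_neg]

/-- On the ray through `θ`, the radial part of `∇φ` is, up to a factor, the derivative of
`t ↦ φ (t ^ (-1 / β) θ)`. -/
lemma hasDerivAt_ray {n : ℕ} {β t : ℝ} (ht : 0 < t) {φ : EuclideanSpace ℝ (Fin n) → ℝ}
    (hφ : Differentiable ℝ φ) (θ : sphere (0 : EuclideanSpace ℝ (Fin n)) 1) :
    HasDerivAt (fun s : ℝ => φ (s ^ (-β⁻¹) • (θ : EuclideanSpace ℝ (Fin n))))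
      (-β⁻¹ * t ^ (-β⁻¹ - 1) * inner ℝ (gradient φ (t ^ (-β⁻¹) • (θ : EuclideanSpace ℝ (Fin n)))) θ)
      t := by
  have h1 : HasDerivAt (fun s : ℝ => s ^ (-β⁻¹) • (θ : EuclideanSpace ℝ (Fin n)))
      ((-β⁻¹ * t ^ (-β⁻¹ - 1)) • (θ : EuclideanSpace ℝ (Fin n))) t :=
    (Real.hasDerivAt_rpow_const (Or.inl ht.ne')).smul_const _
  have h2 := (hφ (t ^ (-β⁻¹) • (θ : EuclideanSpace ℝ (Fin n)))).hasFDerivAt.comp_hasDerivAt t h1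
  rw [map_smul, smul_eq_mul, ← inner_gradient_left] at h2
  exact h2

lemma ofReal_mul_enorm_add_deriv_le {n : ℕ} {β t : ℝ} (hβ : 0 < β) (ht : 0 < t) (w : ℝ → ℝ)
    {φ : EuclideanSpace ℝ (Fin n) → ℝ} (hφ : Differentiable ℝ φ)
    (θ : sphere (0 : EuclideanSpace ℝ (Fin n)) 1) :
    ENNReal.ofReal β *
      ‖w t + deriv (fun s : ℝ => φ (s ^ (-β⁻¹) • (θ : EuclideanSpace ℝ (Fin n)))) t‖ₑ ≤
    ENNReal.ofReal ((t ^ (-β⁻¹)) ^ (β + 1)) *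
      ‖radialGradient β w (t ^ (-β⁻¹) • (θ : EuclideanSpace ℝ (Fin n))) +
        gradient φ (t ^ (-β⁻¹) • (θ : EuclideanSpace ℝ (Fin n)))‖ₑ := by
  have hr : 0 < t ^ (-β⁻¹) := Real.rpow_pos_of_pos ht _
  rw [(hasDerivAt_ray ht hφ θ).deriv]
  set x := t ^ (-β⁻¹) • (θ : EuclideanSpace ℝ (Fin n)) with hx
  set G := gradient φ x with hG
  have hθ : ‖(θ : EuclideanSpace ℝ (Fin n))‖ = 1 := norm_eq_of_mem_sphere θ
  have hcs : |inner ℝ (radialGradient β w x + G) (θ : EuclideanSpace ℝ (Fin n))| ≤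
      ‖radialGradient β w x + G‖ := by
    simpa [hθ] using abs_real_inner_le_norm (radialGradient β w x + G) θ
  have key : (t ^ (-β⁻¹)) ^ (β + 1) * ((t ^ (-β⁻¹)) ^ (-β - 2) * t ^ (-β⁻¹)) = 1 := by
    rw [← Real.rpow_add_one hr.ne', ← Real.rpow_add hr]
    ring_nf
    simp
  have key2 : (t ^ (-β⁻¹)) ^ (β + 1) = t ^ (-β⁻¹ - 1) := by
    rw [← Real.rpow_mul ht.le]; congr 1; field_simp; ring
  have hin : (t ^ (-β⁻¹)) ^ (β + 1) *
      inner ℝ (radialGradient β w x + G) (θ : EuclideanSpace ℝ (Fin n)) =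
      -(β * (w t + -β⁻¹ * t ^ (-β⁻¹ - 1) * inner ℝ G (θ : EuclideanSpace ℝ (Fin n)))) := by
    rw [inner_add_left, radialGradient, hx, norm_rpow_smul_sphere ht,
      rpow_neg_inv_rpow_neg hβ.ne' ht, inner_smul_left, inner_smul_left, real_inner_self_eq_norm_sq,
      hθ]
    simp only [conj_trivial, one_pow, mul_one]
    rw [mul_add, show (t ^ (-β⁻¹)) ^ (β + 1) *
      (-(β * w t * (t ^ (-β⁻¹)) ^ (-β - 2)) * t ^ (-β⁻¹)) =
      -(β * w t) * ((t ^ (-β⁻¹)) ^ (β + 1) * ((t ^ (-β⁻¹)) ^ (-β - 2) * t ^ (-β⁻¹))) by ring, key,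
      key2]
    field_simp
    ring
  rw [← Real.enorm_of_nonneg hβ.le, ← Real.enorm_of_nonneg (Real.rpow_nonneg hr.le _), ← enorm_mul,
    ← enorm_norm (radialGradient β w x + G), ← enorm_mul, Real.enorm_eq_ofReal_abs,
    Real.enorm_eq_ofReal_abs]
  apply ENNReal.ofReal_le_ofReal
  rw [← abs_neg (β * _), ← hin, abs_mul, abs_mul, abs_norm]
  gcongr

/-- The energy of a radial function. -/
lemma lintegral_enorm_radialGradient {n : ℕ} (hn : 0 < n) {p β : ℝ} (hp : 0 < p) (hβ : 0 < β)
    (hβp : n + β = (β + 1) * p) {w : ℝ → ℝ} (hw : Measurable w) :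
    ∫⁻ x : EuclideanSpace ℝ (Fin n), ‖radialGradient β w x‖ₑ ^ p =
      ENNReal.ofReal (n * (volume (ball (0 : EuclideanSpace ℝ (Fin n)) 1)).toReal * β ^ (p - 1)) *
        ∫⁻ t in Ioi (0 : ℝ), ‖w t‖ₑ ^ p := by
  rw [lintegral_polar_rpow hn hβ hβp ((measurable_radialGradient hw).enorm.pow_const p)]
  have h1 : ∀ θ : sphere (0 : EuclideanSpace ℝ (Fin n)) 1,
      (∫⁻ t in Ioi (0 : ℝ), ENNReal.ofReal ((t ^ (-β⁻¹)) ^ (β + 1)) ^ p *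
        ‖radialGradient β w (t ^ (-β⁻¹) • (θ : EuclideanSpace ℝ (Fin n)))‖ₑ ^ p) =
      ENNReal.ofReal β ^ p * ∫⁻ t in Ioi (0 : ℝ), ‖w t‖ₑ ^ p := by
    intro θ
    rw [← lintegral_const_mul _ (by fun_prop)]
    refine setLIntegral_congr_fun measurableSet_Ioi fun t ht => ?_
    rw [← ENNReal.mul_rpow_of_nonneg _ _ hp.le, rpow_mul_enorm_radialGradient hβ ht,
      ENNReal.mul_rpow_of_nonneg _ _ hp.le]
  simp only [h1, lintegral_const, Measure.toSphere_apply_univ, finrank_euclideanSpace,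
    Fintype.card_fin]
  have hfin : volume (ball (0 : EuclideanSpace ℝ (Fin n)) 1) ≠ ⊤ := measure_ball_lt_top.ne
  rw [ENNReal.ofReal_mul (by positivity), ENNReal.ofReal_mul (by positivity),
    ENNReal.ofReal_toReal hfin, ENNReal.ofReal_natCast]
  have h2 : ENNReal.ofReal β⁻¹ * ENNReal.ofReal β ^ p = ENNReal.ofReal (β ^ (p - 1)) := by
    rw [ENNReal.ofReal_rpow_of_pos hβ, ← ENNReal.ofReal_mul (by positivity),
      Real.rpow_sub_one hβ.ne']
    congr 1; field_simp
  rw [← h2]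
  ring

/-- The quasiminimizing inequality of `|x| ^ (-αβ)` for smooth perturbations, integrated from the
one-dimensional inequality on the rays from the origin. -/
lemma setLIntegral_radialGradient_le {n : ℕ} (hn : 0 < n) {p α β Q : ℝ} (hp : 1 < p) (hα : 1 ≤ α)
    (hβ : 0 < β) (hβp : n + β = (β + 1) * p) (hQ : Q = α ^ p / (1 + p * (α - 1)))
    {φ : EuclideanSpace ℝ (Fin n) → ℝ} (hφ : IsTestFunction {0}ᶜ φ) :
    ∫⁻ x in {x | φ x ≠ 0}, ‖radialGradient β (fun t => α * t ^ (α - 1)) x‖ₑ ^ p ≤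
      ENNReal.ofReal Q * ∫⁻ x in {x | φ x ≠ 0},
        ‖radialGradient β (fun t => α * t ^ (α - 1)) x + gradient φ x‖ₑ ^ p := by
  obtain ⟨hsm, hcs, hsupp⟩ := hφ
  have hp0 : 0 < p := by linarith
  set w : ℝ → ℝ := fun t => α * t ^ (α - 1) with hw
  have hwm : Measurable w := by fun_prop
  have hdiff : Differentiable ℝ φ := hsm.differentiable (by simp)
  have hgm : Measurable (gradient φ) := by
    have : Continuous (gradient φ) :=
      (InnerProductSpace.toDual ℝ (EuclideanSpace ℝ (Fin n))).symm.continuous.comp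
        (hsm.continuous_fderiv (by simp))
    exact this.measurable
  have hVm : MeasurableSet {x | φ x ≠ 0} := (isOpen_ne.preimage hsm.continuous).measurableSet
  have hgw := measurable_radialGradient (n := n) (β := β) hwm
  rw [← lintegral_indicator hVm, ← lintegral_indicator hVm,
    lintegral_polar_rpow hn hβ hβp (((hgw.enorm.pow_const p)).indicator hVm),
    lintegral_polar_rpow hn hβ hβp (F := {x | φ x ≠ 0}.indicator fun x =>
      ‖radialGradient β w x + gradient φ x‖ₑ ^ p)
      ((((hgw.add hgm).enorm.pow_const p)).indicator hVm),
    mul_left_comm]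
  refine mul_le_mul_right ?_ _
  rw [← lintegral_const_mul' _ _ ENNReal.ofReal_ne_top]
  refine lintegral_mono fun θ => ?_
  set f : ℝ → ℝ := fun t => φ (t ^ (-β⁻¹) • (θ : EuclideanSpace ℝ (Fin n))) with hf
  have hfsm : ContDiffOn ℝ 1 f (Ioi 0) := by
    intro t ht
    have h1 : ContDiffAt ℝ 1 (fun t : ℝ => t ^ (-β⁻¹) • (θ : EuclideanSpace ℝ (Fin n))) t :=
      (Real.contDiffAt_rpow_const_of_ne (ne_of_gt ht)).smul contDiffAt_const
    exact (((hsm.of_le (by exact_mod_cast le_top)).contDiffAt).comp t h1).contDiffWithinAt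
  have hUm : MeasurableSet {t | 0 < t ∧ f t ≠ 0} :=
    (hfsm.continuousOn.isOpen_inter_preimage isOpen_Ioi isOpen_ne).measurableSet
  -- the support of `φ` is compact and does not contain the origin
  obtain ⟨a, b, ha, hab⟩ : ∃ a b : ℝ, 0 < a ∧ ∀ t, 0 < t → f t ≠ 0 → t ∈ Icc a b := by
    obtain ⟨δ, hδ, hδφ⟩ : ∃ δ > 0, ∀ x, φ x ≠ 0 → δ ≤ ‖x‖ := by
      have : (tsupport φ)ᶜ ∈ 𝓝 (0 : EuclideanSpace ℝ (Fin n)) :=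
        (isClosed_tsupport φ).isOpen_compl.mem_nhds fun h => hsupp h rfl
      obtain ⟨δ, hδ, hsub⟩ := Metric.mem_nhds_iff.1 this
      refine ⟨δ, hδ, fun x hx => ?_⟩
      by_contra h
      push Not at h
      exact hsub (by simpa using h) (subset_tsupport _ hx)
    obtain ⟨R, hR, hRφ⟩ : ∃ R > 0, ∀ x, φ x ≠ 0 → ‖x‖ ≤ R := by
      obtain ⟨R, hR, hsub⟩ := hcs.isCompact.isBounded.exists_pos_norm_le
      exact ⟨R, hR, fun x hx => hsub x (subset_tsupport _ hx)⟩
    refine ⟨R ^ (-β), δ ^ (-β), by positivity, fun t ht hft => ?_⟩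
    have h1 := hδφ _ hft
    have h2 := hRφ _ hft
    rw [norm_rpow_smul_sphere ht] at h1 h2
    rw [← rpow_neg_inv_rpow_neg hβ.ne' ht]
    exact ⟨Real.rpow_le_rpow_of_nonpos (by positivity) h2 (by linarith),
      Real.rpow_le_rpow_of_nonpos (by positivity) h1 (by linarith)⟩
  have key := setLIntegral_rpow_deriv_le hp hα hQ ha hfsm hab
  have hL : ∀ F : EuclideanSpace ℝ (Fin n) → ℝ≥0∞,
      ∫⁻ t in Ioi (0 : ℝ), ENNReal.ofReal ((t ^ (-β⁻¹)) ^ (β + 1)) ^ p *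
        ({x | φ x ≠ 0}.indicator (fun x => F x ^ p)) (t ^ (-β⁻¹) • (θ : EuclideanSpace ℝ (Fin n))) =
      ∫⁻ t in {t | 0 < t ∧ f t ≠ 0}, (ENNReal.ofReal ((t ^ (-β⁻¹)) ^ (β + 1)) *
        F (t ^ (-β⁻¹) • (θ : EuclideanSpace ℝ (Fin n)))) ^ p := by
    intro F
    rw [← lintegral_indicator measurableSet_Ioi, ← lintegral_indicator hUm]
    refine lintegral_congr fun t => ?_
    by_cases ht : 0 < t
    · by_cases hft : f t = 0
      · have : φ (t ^ (-β⁻¹) • (θ : EuclideanSpace ℝ (Fin n))) = 0 := hft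
        simp [indicator, ht, hft, this]
      · have : φ (t ^ (-β⁻¹) • (θ : EuclideanSpace ℝ (Fin n))) ≠ 0 := hft
        simp [indicator, ht, hft, this, ENNReal.mul_rpow_of_nonneg _ _ hp0.le]
    · simp [indicator, ht]
  rw [hL (fun x => ‖radialGradient β w x‖ₑ),
    hL (fun x => ‖radialGradient β w x + gradient φ x‖ₑ)]
  have e1 : ∫⁻ t in {t | 0 < t ∧ f t ≠ 0}, (ENNReal.ofReal ((t ^ (-β⁻¹)) ^ (β + 1)) *
      ‖radialGradient β w (t ^ (-β⁻¹) • (θ : EuclideanSpace ℝ (Fin n)))‖ₑ) ^ p =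
      ENNReal.ofReal β ^ p * ∫⁻ t in {t | 0 < t ∧ f t ≠ 0}, ‖w t‖ₑ ^ p := by
    rw [← lintegral_const_mul _ (by fun_prop)]
    refine setLIntegral_congr_fun hUm fun t ht => ?_
    rw [rpow_mul_enorm_radialGradient hβ ht.1, ENNReal.mul_rpow_of_nonneg _ _ hp0.le]
  have e2 : ENNReal.ofReal β ^ p * ∫⁻ t in {t | 0 < t ∧ f t ≠ 0}, ‖w t + deriv f t‖ₑ ^ p ≤
      ∫⁻ t in {t | 0 < t ∧ f t ≠ 0}, (ENNReal.ofReal ((t ^ (-β⁻¹)) ^ (β + 1)) *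
        ‖radialGradient β w (t ^ (-β⁻¹) • (θ : EuclideanSpace ℝ (Fin n))) +
          gradient φ (t ^ (-β⁻¹) • (θ : EuclideanSpace ℝ (Fin n)))‖ₑ) ^ p := by
    rw [← lintegral_const_mul' _ _ (by finiteness)]
    refine setLIntegral_mono' hUm fun t ht => ?_
    rw [← ENNReal.mul_rpow_of_nonneg _ _ hp0.le]
    exact ENNReal.rpow_le_rpow (ofReal_mul_enorm_add_deriv_le hβ ht.1 w hdiff θ) hp0.le
  rw [e1]
  calc _ ≤ ENNReal.ofReal β ^ p * (ENNReal.ofReal Q *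
        ∫⁻ t in {t | 0 < t ∧ f t ≠ 0}, ‖w t + deriv f t‖ₑ ^ p) := mul_le_mul_right key _
    _ = ENNReal.ofReal Q * (ENNReal.ofReal β ^ p *
        ∫⁻ t in {t | 0 < t ∧ f t ≠ 0}, ‖w t + deriv f t‖ₑ ^ p) := by ring
    _ ≤ _ := mul_le_mul_right e2 _

/-- The radial function `x ↦ ∫ w` over `(0, |x| ^ (-β))`, with the value `∫ w` at the origin, where
`|x| ^ (-β) = ∞`. -/
noncomputable def radialPrimitive {n : ℕ} (β : ℝ) (w : ℝ → ℝ) (x : EuclideanSpace ℝ (Fin n)) : ℝ :=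
  open Classical in if x = 0 then ∫ t, w t else ∫ t in (0 : ℝ)..‖x‖ ^ (-β), w t

section radialPrimitive

variable {n : ℕ} {β : ℝ} {w : ℝ → ℝ} {a b : ℝ}

lemma radialPrimitive_zero : radialPrimitive β w (0 : EuclideanSpace ℝ (Fin n)) = ∫ t, w t := by
  simp [radialPrimitive]

lemma radialPrimitive_of_ne {x : EuclideanSpace ℝ (Fin n)} (hx : x ≠ 0) :
    radialPrimitive β w x = ∫ t in (0 : ℝ)..‖x‖ ^ (-β), w t := by
  simp [radialPrimitive, hx]

lemma norm_rpow_le_iff {x : EuclideanSpace ℝ (Fin n)} (hx : x ≠ 0) (hβ : 0 < β) {r : ℝ}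
    (hr : 0 < r) : ‖x‖ ^ (-β) ≤ r ^ (-β) ↔ r ≤ ‖x‖ :=
  Real.rpow_le_rpow_iff_of_neg (norm_pos_iff.2 hx) hr (by linarith)

lemma radialPrimitive_eq_zero (hsupp : Function.support w ⊆ Ioo a b)
    {x : EuclideanSpace ℝ (Fin n)} (hx : x ≠ 0) (hxa : ‖x‖ ^ (-β) ≤ a) :
    radialPrimitive β w x = 0 := by
  rw [radialPrimitive_of_ne hx]
  apply intervalIntegral.integral_zero_ae
  filter_upwards with t ht
  rw [uIoc_of_le (Real.rpow_nonneg (norm_nonneg x) _)] at ht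
  by_contra h
  have := (hsupp h).1
  linarith [ht.2]

lemma radialPrimitive_eq_integral (hsupp : Function.support w ⊆ Ioo a b) (ha : 0 ≤ a)
    {x : EuclideanSpace ℝ (Fin n)} (hx : x ≠ 0 → b ≤ ‖x‖ ^ (-β)) :
    radialPrimitive β w x = ∫ t, w t := by
  by_cases h : x = 0
  · rw [h, radialPrimitive_zero]
  · rw [radialPrimitive_of_ne h]
    apply intervalIntegral.integral_eq_integral_of_support_subset
    intro t ht
    have := hsupp ht
    exact ⟨ha.trans_lt this.1, this.2.le.trans (hx h)⟩

lemma eventually_le_norm_rpow (hβ : 0 < β) (b : ℝ) :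
    ∀ᶠ x : EuclideanSpace ℝ (Fin n) in 𝓝 0, x ≠ 0 → b ≤ ‖x‖ ^ (-β) := by
  have h1 : Tendsto (fun r : ℝ => r ^ (-β)) (𝓝[>] 0) atTop :=
    tendsto_rpow_neg_nhdsGT_zero (by linarith)
  have h2 : Tendsto (fun x : EuclideanSpace ℝ (Fin n) => ‖x‖) (𝓝[≠] 0) (𝓝[>] 0) :=
    tendsto_norm_nhdsNE_zero
  have := (h1.comp h2).eventually_ge_atTop b
  rw [eventually_nhdsWithin_iff] at this
  exact this

lemma radialPrimitive_eventuallyEq (hβ : 0 < β) (hsupp : Function.support w ⊆ Ioo a b)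
    (ha : 0 ≤ a) :
    (radialPrimitive β w : EuclideanSpace ℝ (Fin n) → ℝ) =ᶠ[𝓝 0] fun _ => ∫ t, w t := by
  filter_upwards [eventually_le_norm_rpow hβ b] with x hx
  exact radialPrimitive_eq_integral hsupp ha hx

lemma radialPrimitive_eventuallyEq_of_ne {x : EuclideanSpace ℝ (Fin n)} (hx : x ≠ 0) :
    (radialPrimitive β w : EuclideanSpace ℝ (Fin n) → ℝ) =ᶠ[𝓝 x]
      fun y => ∫ t in (0 : ℝ)..‖y‖ ^ (-β), w t := by
  filter_upwards [isOpen_ne.mem_nhds hx] with y hy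
  exact radialPrimitive_of_ne hy

lemma hasGradientAt_radialPrimitive (hβ : 0 < β) (hw : Continuous w)
    (hsupp : Function.support w ⊆ Ioo a b) (ha : 0 ≤ a) (x : EuclideanSpace ℝ (Fin n)) :
    HasGradientAt (radialPrimitive β w) (radialGradient β w x) x := by
  by_cases hx : x = 0
  · rw [hx, radialGradient_zero]
    exact (hasGradientAt_const _ _).congr_of_eventuallyEq (radialPrimitive_eventuallyEq hβ hsupp ha)
  · exact (hasGradientAt_comp_norm_rpow (H := fun τ => ∫ t in (0 : ℝ)..τ, w t) hx
      (hw.integral_hasStrictDerivAt 0 _).hasDerivAt).congr_of_eventuallyEq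
      (radialPrimitive_eventuallyEq_of_ne hx)

lemma contDiff_radialPrimitive (hβ : 0 < β) (hw : ContDiff ℝ ∞ w)
    (hsupp : Function.support w ⊆ Ioo a b) (ha : 0 ≤ a) :
    ContDiff ℝ ∞ (radialPrimitive β w : EuclideanSpace ℝ (Fin n) → ℝ) := by
  rw [contDiff_iff_contDiffAt]
  intro x
  by_cases hx : x = 0
  · rw [hx]
    exact contDiffAt_const.congr_of_eventuallyEq (radialPrimitive_eventuallyEq hβ hsupp ha)
  · refine ContDiffAt.congr_of_eventuallyEq ?_ (radialPrimitive_eventuallyEq_of_ne hx)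
    have hF : ContDiff ℝ ∞ (fun τ => ∫ t in (0 : ℝ)..τ, w t) := by
      rw [contDiff_infty_iff_deriv]
      have hd : ∀ τ, HasDerivAt (fun τ => ∫ t in (0 : ℝ)..τ, w t) (w τ) τ := fun τ =>
        (hw.continuous.integral_hasStrictDerivAt 0 τ).hasDerivAt
      refine ⟨fun τ => (hd τ).differentiableAt, ?_⟩
      rwa [show deriv (fun τ => ∫ t in (0 : ℝ)..τ, w t) = w from funext fun τ => (hd τ).deriv]
    have hN : ContDiffAt ℝ ∞ (fun y : EuclideanSpace ℝ (Fin n) => ‖y‖ ^ (-β)) x :=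
      (contDiffAt_norm ℝ hx).rpow_const_of_ne (norm_ne_zero_iff.2 hx)
    exact hF.contDiffAt.comp x hN

lemma tsupport_radialPrimitive_subset (hβ : 0 < β) (ha : 0 < a)
    (hsupp : Function.support w ⊆ Ioo a b) :
    tsupport (radialPrimitive β w : EuclideanSpace ℝ (Fin n) → ℝ) ⊆
      closedBall 0 (a ^ (-β⁻¹)) := by
  refine closure_minimal (fun x hx => ?_) isClosed_closedBall
  rw [mem_closedBall_zero_iff]
  by_cases h0 : x = 0
  · rw [h0, norm_zero]; positivity
  by_contra h
  push Not at h
  refine hx (radialPrimitive_eq_zero hsupp h0 ?_)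
  have h1 := Real.rpow_le_rpow_of_nonpos (by positivity) h.le (show -β ≤ 0 by linarith)
  rwa [rpow_neg_inv_rpow_neg hβ.ne' ha] at h1

lemma isTestFunction_radialPrimitive (hβ : 0 < β) (hw : ContDiff ℝ ∞ w) {r : ℝ} (hr : 0 < r)
    (hra : r ^ (-β) < a) (hsupp : Function.support w ⊆ Ioo a b) :
    IsTestFunction (ball 0 r) (radialPrimitive β w : EuclideanSpace ℝ (Fin n) → ℝ) := by
  have ha : 0 < a := (Real.rpow_pos_of_pos hr _).trans hra
  have hts := tsupport_radialPrimitive_subset (n := n) hβ ha hsupp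
  refine ⟨contDiff_radialPrimitive hβ hw hsupp ha.le,
    (isCompact_closedBall _ _).of_isClosed_subset (isClosed_tsupport _) hts,
    hts.trans (closedBall_subset_ball ?_)⟩
  have h1 := Real.rpow_lt_rpow_of_neg (Real.rpow_pos_of_pos hr (-β)) hra
    (show -β⁻¹ < 0 by simpa using hβ)
  rwa [← Real.rpow_mul hr.le, neg_mul_neg, mul_inv_cancel₀ hβ.ne', Real.rpow_one] at h1

lemma isTestFunction_radialPrimitive_punctured (hβ : 0 < β) (hw : ContDiff ℝ ∞ w) {r : ℝ}
    (hr : 0 < r) (hra : r ^ (-β) < a) (hsupp : Function.support w ⊆ Ioo a b)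
    (hw0 : ∫ t, w t = 0) :
    IsTestFunction (ball 0 r \ {0})
      (radialPrimitive β w : EuclideanSpace ℝ (Fin n) → ℝ) := by
  have ha : 0 < a := (Real.rpow_pos_of_pos hr _).trans hra
  obtain ⟨h1, h2, h3⟩ := isTestFunction_radialPrimitive (n := n) hβ hw hr hra hsupp
  refine ⟨h1, h2, fun x hx => ⟨h3 hx, ?_⟩⟩
  rintro rfl
  have := radialPrimitive_eventuallyEq (n := n) hβ hsupp ha.le
  rw [hw0] at this
  exact notMem_tsupport_iff_eventuallyEq.2 this hx

end radialPrimitive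

/-! ### The capacity of concentric balls -/

lemma norm_smul_sphere {n : ℕ} {r : ℝ} (hr : 0 ≤ r)
    (θ : sphere (0 : EuclideanSpace ℝ (Fin n)) 1) :
    ‖r • (θ : EuclideanSpace ℝ (Fin n))‖ = r := by
  rw [norm_smul, norm_eq_of_mem_sphere, mul_one, Real.norm_of_nonneg hr]

lemma continuous_gradient {n : ℕ} {φ : EuclideanSpace ℝ (Fin n) → ℝ} (hφ : ContDiff ℝ ∞ φ) :
    Continuous (gradient φ) :=
  (InnerProductSpace.toDual ℝ (EuclideanSpace ℝ (Fin n))).symm.continuous.comp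
    (hφ.continuous_fderiv (by simp))

/-- On each ray from the origin, Hölder's inequality bounds the energy of an admissible function
from below. -/
lemma ofReal_le_varCap {n : ℕ} (hn : 0 < n) {p β : ℝ} (hp : 1 < p) (hβ : 0 < β)
    (hβp : n + β = (β + 1) * p) {ρ r : ℝ} (hρ : 0 < ρ) (hρr : ρ < r) :
    ENNReal.ofReal (n * (volume (ball (0 : EuclideanSpace ℝ (Fin n)) 1)).toReal * β ^ (p - 1) *
      (ρ ^ (-β) - r ^ (-β)) ^ (1 - p)) ≤
      varCap p (closedBall (0 : EuclideanSpace ℝ (Fin n)) ρ) (ball 0 r) := by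
  have hp0 : 0 < p := by linarith
  have hr : 0 < r := hρ.trans hρr
  refine le_iInf₂ fun φ hφ => ?_
  obtain ⟨⟨hsm, hcs, hsupp⟩, hφ1⟩ := hφ
  have hdiff : Differentiable ℝ φ := hsm.differentiable (by simp)
  set s := r ^ (-β) with hs
  set t := ρ ^ (-β) with ht
  have hs0 : 0 < s := Real.rpow_pos_of_pos hr _
  have hst : s < t := Real.rpow_lt_rpow_of_neg hρ hρr (by linarith)
  have hts : 0 < t - s := by linarith
  have hsr : s ^ (-β⁻¹) = r := by
    rw [hs, ← Real.rpow_mul hr.le, neg_mul_neg, mul_inv_cancel₀ hβ.ne', Real.rpow_one]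
  have htρ : t ^ (-β⁻¹) = ρ := by
    rw [ht, ← Real.rpow_mul hρ.le, neg_mul_neg, mul_inv_cancel₀ hβ.ne', Real.rpow_one]
  have hray : ∀ θ : sphere (0 : EuclideanSpace ℝ (Fin n)) 1,
      ENNReal.ofReal β ^ p * ENNReal.ofReal ((t - s) ^ (1 - p)) ≤
        ∫⁻ τ in Ioi (0 : ℝ), ENNReal.ofReal ((τ ^ (-β⁻¹)) ^ (β + 1)) ^ p *
          ((ball (0 : EuclideanSpace ℝ (Fin n)) r).indicator (fun x => ‖gradient φ x‖ₑ ^ p)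
            (τ ^ (-β⁻¹) • (θ : EuclideanSpace ℝ (Fin n)))) := by
    intro θ
    set f : ℝ → ℝ := fun τ => φ (τ ^ (-β⁻¹) • (θ : EuclideanSpace ℝ (Fin n))) with hf
    have hfsm : ContDiffOn ℝ 1 f (Icc s t) := by
      intro τ hτ
      have h1 : ContDiffAt ℝ 1 (fun t : ℝ => t ^ (-β⁻¹) • (θ : EuclideanSpace ℝ (Fin n))) τ :=
        (Real.contDiffAt_rpow_const_of_ne (hs0.trans_le hτ.1).ne').smul contDiffAt_const
      exact (((hsm.of_le (by exact_mod_cast le_top)).contDiffAt).comp τ h1).contDiffWithinAt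
    have hH := enorm_sub_rpow_le hp hst hfsm
    have hfs : f s = 0 := by
      refine image_eq_zero_of_notMem_tsupport (f := φ) fun h => ?_
      have := hsupp h
      rw [hsr, mem_ball_zero_iff, norm_smul_sphere hr.le] at this
      exact lt_irrefl _ this
    have hft : 1 ≤ f t := by
      apply hφ1
      rw [htρ, mem_closedBall_zero_iff, norm_smul_sphere hρ.le]
    have h1 : 1 ≤ ENNReal.ofReal (t - s) ^ (p - 1) * ∫⁻ x in Ioo s t, ‖deriv f x‖ₑ ^ p := by
      refine le_trans ?_ hH
      apply ENNReal.one_le_rpow _ hp0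
      rw [hfs, sub_zero, Real.enorm_eq_ofReal (by linarith)]
      simpa using hft
    have h2 : ENNReal.ofReal ((t - s) ^ (1 - p)) ≤ ∫⁻ x in Ioo s t, ‖deriv f x‖ₑ ^ p := by
      have e : ENNReal.ofReal ((t - s) ^ (1 - p)) * ENNReal.ofReal (t - s) ^ (p - 1) = 1 := by
        rw [ENNReal.ofReal_rpow_of_pos hts, ← ENNReal.ofReal_mul (by positivity),
          ← Real.rpow_add hts]
        simp
      calc _ ≤ ENNReal.ofReal ((t - s) ^ (1 - p)) * (ENNReal.ofReal (t - s) ^ (p - 1) *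
            ∫⁻ x in Ioo s t, ‖deriv f x‖ₑ ^ p) := le_mul_of_one_le_right' h1
        _ = _ := by rw [← mul_assoc, e, one_mul]
    calc _ ≤ ENNReal.ofReal β ^ p * ∫⁻ x in Ioo s t, ‖deriv f x‖ₑ ^ p := mul_le_mul_right h2 _
      _ = ∫⁻ x in Ioo s t, ENNReal.ofReal β ^ p * ‖deriv f x‖ₑ ^ p := by
        rw [lintegral_const_mul' _ _ (by finiteness)]
      _ ≤ ∫⁻ τ in Ioo s t, ENNReal.ofReal ((τ ^ (-β⁻¹)) ^ (β + 1)) ^ p *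
          ((ball (0 : EuclideanSpace ℝ (Fin n)) r).indicator (fun x => ‖gradient φ x‖ₑ ^ p)
            (τ ^ (-β⁻¹) • (θ : EuclideanSpace ℝ (Fin n)))) := by
        refine setLIntegral_mono' measurableSet_Ioo fun τ hτ => ?_
        have hτ0 : 0 < τ := hs0.trans hτ.1
        have hmem : τ ^ (-β⁻¹) • (θ : EuclideanSpace ℝ (Fin n)) ∈ ball 0 r := by
          rw [mem_ball_zero_iff, norm_smul_sphere (by positivity), ← hsr]
          exact Real.rpow_lt_rpow_of_neg hs0 hτ.1 (by simpa using hβ)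
        rw [indicator_of_mem hmem, ← ENNReal.mul_rpow_of_nonneg _ _ hp0.le,
          ← ENNReal.mul_rpow_of_nonneg _ _ hp0.le]
        refine ENNReal.rpow_le_rpow ?_ hp0.le
        simpa [radialGradient] using ofReal_mul_enorm_add_deriv_le hβ hτ0 (fun _ => 0) hdiff θ
      _ ≤ _ := lintegral_mono_set fun τ hτ => hs0.trans hτ.1
  have hgm : Measurable (gradient φ) := (continuous_gradient hsm).measurable
  rw [← lintegral_indicator measurableSet_ball, lintegral_polar_rpow hn hβ hβp
    ((hgm.enorm.pow_const p).indicator measurableSet_ball)]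
  have hfin : volume (ball (0 : EuclideanSpace ℝ (Fin n)) 1) ≠ ⊤ := measure_ball_lt_top.ne
  have h2 : ENNReal.ofReal β⁻¹ * ENNReal.ofReal β ^ p = ENNReal.ofReal (β ^ (p - 1)) := by
    rw [ENNReal.ofReal_rpow_of_pos hβ, ← ENNReal.ofReal_mul (by positivity),
      Real.rpow_sub_one hβ.ne']
    congr 1; field_simp
  calc _ = ENNReal.ofReal β⁻¹ * ∫⁻ _ : sphere (0 : EuclideanSpace ℝ (Fin n)) 1,
        (ENNReal.ofReal β ^ p * ENNReal.ofReal ((t - s) ^ (1 - p)))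
        ∂(volume : Measure (EuclideanSpace ℝ (Fin n))).toSphere := by
        simp only [lintegral_const, Measure.toSphere_apply_univ, finrank_euclideanSpace,
          Fintype.card_fin]
        rw [ENNReal.ofReal_mul (by positivity), ENNReal.ofReal_mul (by positivity),
          ENNReal.ofReal_mul (by positivity), ENNReal.ofReal_toReal hfin, ENNReal.ofReal_natCast,
          ← h2]
        ring
    _ ≤ _ := mul_le_mul_right (lintegral_mono hray) _

/-- Since `∫ w = 1` for the normed bump `w`, one has `∫ w ^ p ≤ (sup w) ^ (p - 1)`. -/
lemma lintegral_enorm_normed_rpow_le {p c : ℝ} (hp : 1 < p) (f : ContDiffBump c) :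
    ∫⁻ t, ‖f.normed volume t‖ₑ ^ p ≤ ENNReal.ofReal ((2 * f.rIn) ^ (1 - p)) := by
  have hp0 : 0 < p := by linarith
  have hδ0 := f.rIn_pos
  set w : ℝ → ℝ := f.normed volume with hw
  have hwle : ∀ t, ‖w t‖ₑ ^ p ≤
      ENNReal.ofReal ((2 * f.rIn) ^ (1 - p)) * ENNReal.ofReal (w t) := by
    intro t
    have hw0 : 0 ≤ w t := f.nonneg_normed t
    have hwle : w t ≤ (2 * f.rIn)⁻¹ := by
      have := f.normed_le_div_measure_closedBall_rIn volume t
      simpa [measureReal_def, Real.volume_closedBall, hδ0.le] using this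
    rw [Real.enorm_eq_ofReal hw0, ENNReal.ofReal_rpow_of_nonneg hw0 hp0.le,
      ← ENNReal.ofReal_mul (by positivity)]
    apply ENNReal.ofReal_le_ofReal
    rcases hw0.eq_or_lt with h | h
    · rw [← h, Real.zero_rpow hp0.ne', mul_zero]
    · calc w t ^ p = w t ^ (p - 1) * w t := by
            rw [← Real.rpow_add_one h.ne']; congr 1; ring
        _ ≤ ((2 * f.rIn)⁻¹) ^ (p - 1) * w t := by gcongr
        _ = (2 * f.rIn) ^ (1 - p) * w t := by
            rw [Real.inv_rpow (by positivity), ← Real.rpow_neg (by positivity), neg_sub]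
  calc ∫⁻ t, ‖w t‖ₑ ^ p
      ≤ ∫⁻ t, ENNReal.ofReal ((2 * f.rIn) ^ (1 - p)) * ENNReal.ofReal (w t) := lintegral_mono hwle
    _ = ENNReal.ofReal ((2 * f.rIn) ^ (1 - p)) * ENNReal.ofReal (∫ t, w t) := by
      rw [lintegral_const_mul' _ _ ENNReal.ofReal_ne_top,
        ofReal_integral_eq_lintegral_ofReal f.integrable_normed
          (Eventually.of_forall f.nonneg_normed)]
    _ = _ := by rw [hw, f.integral_normed]; simp

/-- Admissible functions are radial primitives of smooth bumps that approximate the normalized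
indicator function of `(r ^ (-β), ρ ^ (-β))`. -/
lemma varCap_le_ofReal {n : ℕ} (hn : 0 < n) {p β : ℝ} (hp : 1 < p) (hβ : 0 < β)
    (hβp : n + β = (β + 1) * p) {ρ r : ℝ} (hρ : 0 < ρ) (hρr : ρ < r) :
    varCap p (closedBall (0 : EuclideanSpace ℝ (Fin n)) ρ) (ball 0 r) ≤
      ENNReal.ofReal (n * (volume (ball (0 : EuclideanSpace ℝ (Fin n)) 1)).toReal * β ^ (p - 1) *
      (ρ ^ (-β) - r ^ (-β)) ^ (1 - p)) := by
  have hp0 : 0 < p := by linarith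
  have hr : 0 < r := hρ.trans hρr
  set s := r ^ (-β) with hs
  set t := ρ ^ (-β) with ht
  have hs0 : 0 < s := Real.rpow_pos_of_pos hr _
  have hst : s < t := Real.rpow_lt_rpow_of_neg hρ hρr (by linarith)
  set c := (s + t) / 2 with hc
  set l := (t - s) / 2 with hl
  have hl0 : 0 < l := by rw [hl]; linarith
  have key : ∀ δ ∈ Ioo 0 l, varCap p (closedBall (0 : EuclideanSpace ℝ (Fin n)) ρ) (ball 0 r) ≤
      ENNReal.ofReal (n * (volume (ball (0 : EuclideanSpace ℝ (Fin n)) 1)).toReal * β ^ (p - 1) *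
      (2 * δ) ^ (1 - p)) := by
    rintro δ ⟨hδ0, hδl⟩
    let f : ContDiffBump c := ⟨δ, (δ + l) / 2, hδ0, by linarith⟩
    set w : ℝ → ℝ := f.normed volume with hw
    have hwsupp : Function.support w ⊆ Ioo (c - (δ + l) / 2) (c + (δ + l) / 2) := by
      rw [hw, f.support_normed_eq, Real.ball_eq_Ioo]
    have hwsm : ContDiff ℝ ∞ w := f.contDiff_normed
    have hwint : ∫ t, w t = 1 := f.integral_normed
    have hsa : s < c - (δ + l) / 2 := by rw [hc]; linarith
    have htest := isTestFunction_radialPrimitive (n := n) hβ hwsm hr hsa hwsupp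
    have hone : ∀ x ∈ closedBall (0 : EuclideanSpace ℝ (Fin n)) ρ,
        1 ≤ radialPrimitive β w x := by
      intro x hx
      rw [radialPrimitive_eq_integral hwsupp (by linarith), hwint]
      intro hx0
      have h1 : t ≤ ‖x‖ ^ (-β) := Real.rpow_le_rpow_of_nonpos (norm_pos_iff.2 hx0)
        (mem_closedBall_zero_iff.1 hx) (by linarith)
      have : c + (δ + l) / 2 < t := by rw [hc]; linarith
      linarith
    have hgrad : ∀ x : EuclideanSpace ℝ (Fin n),
        gradient (radialPrimitive β w) x = radialGradient β w x := fun x =>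
      (hasGradientAt_radialPrimitive hβ hwsm.continuous hwsupp (by linarith) x).gradient
    calc varCap p (closedBall (0 : EuclideanSpace ℝ (Fin n)) ρ) (ball 0 r)
        ≤ ∫⁻ x in ball (0 : EuclideanSpace ℝ (Fin n)) r,
          ‖gradient (radialPrimitive β w) x‖ₑ ^ p := iInf₂_le _ ⟨htest, hone⟩
      _ ≤ ∫⁻ x : EuclideanSpace ℝ (Fin n), ‖radialGradient β w x‖ₑ ^ p := by
        simp only [hgrad]; exact setLIntegral_le_lintegral _ _
      _ = _ * ∫⁻ t in Ioi (0 : ℝ), ‖w t‖ₑ ^ p :=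
        lintegral_enorm_radialGradient hn hp0 hβ hβp hwsm.continuous.measurable
      _ ≤ _ * ENNReal.ofReal ((2 * δ) ^ (1 - p)) := by
        refine mul_le_mul_right ?_ _
        exact (setLIntegral_le_lintegral _ _).trans (lintegral_enorm_normed_rpow_le hp f)
      _ = _ := by rw [← ENNReal.ofReal_mul (by positivity)]
  have hlim : Tendsto (fun δ : ℝ => ENNReal.ofReal
      (n * (volume (ball (0 : EuclideanSpace ℝ (Fin n)) 1)).toReal * β ^ (p - 1) *
      (2 * δ) ^ (1 - p))) (𝓝[<] l) (𝓝 (ENNReal.ofReal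
      (n * (volume (ball (0 : EuclideanSpace ℝ (Fin n)) 1)).toReal * β ^ (p - 1) *
      (t - s) ^ (1 - p)))) := by
    have h2l : t - s = 2 * l := by rw [hl]; ring
    rw [h2l]
    apply ENNReal.tendsto_ofReal
    apply Tendsto.const_mul
    have : ContinuousAt (fun δ : ℝ => (2 * δ) ^ (1 - p)) l :=
      (continuousAt_const.mul continuousAt_id).rpow_const (Or.inl (by simp [hl0.ne']))
    exact this.tendsto.mono_left nhdsWithin_le_nhds
  exact ge_of_tendsto hlim (by filter_upwards [Ioo_mem_nhdsLT hl0] with δ hδ using key δ hδ)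

lemma varCap_closedBall_ball {n : ℕ} (hn : 0 < n) {p β : ℝ} (hp : 1 < p) (hβ : 0 < β)
    (hβp : n + β = (β + 1) * p) {ρ r : ℝ} (hρ : 0 < ρ) (hρr : ρ < r) :
    varCap p (closedBall (0 : EuclideanSpace ℝ (Fin n)) ρ) (ball 0 r) =
      ENNReal.ofReal (n * (volume (ball (0 : EuclideanSpace ℝ (Fin n)) 1)).toReal * β ^ (p - 1) *
      (ρ ^ (-β) - r ^ (-β)) ^ (1 - p)) :=
  le_antisymm (varCap_le_ofReal hn hp hβ hβp hρ hρr) (ofReal_le_varCap hn hp hβ hβp hρ hρr)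

/-! ### From smooth perturbations to perturbations in the Sobolev space -/

/-- Passage to the limit in a quasiminimizing inequality. The sets of integration need only be
controlled from one side each: on the left the points of `S'` eventually lie in `Sk' k`, which
suffices for Fatou's lemma, and on the right the points outside `S` eventually leave `Sk k`, which
suffices for the reverse Fatou lemma. -/
lemma setLIntegral_rpow_le_of_tendsto {X E : Type*} [MeasurableSpace X] [NormedAddCommGroup E]
    [MeasurableSpace E] [BorelSpace E] [SecondCountableTopology E]
    {μ : Measure X} {p : ℝ} (hp : 1 ≤ p) {C : ℝ≥0∞} (hC : C ≠ ⊤) (hC0 : C ≠ 0)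
    {g h : X → E} {hk : ℕ → X → E} (hg : Measurable g) (hh : Measurable h)
    (hhk : ∀ k, Measurable (hk k)) {S' S : Set X} {Sk' Sk : ℕ → Set X}
    (hS' : MeasurableSet S') (hS : MeasurableSet S) (hSk' : ∀ k, MeasurableSet (Sk' k))
    (hSk : ∀ k, MeasurableSet (Sk k))
    (H : ∀ k, ∫⁻ x in Sk' k, ‖g x‖ₑ ^ p ∂μ ≤ C * ∫⁻ x in Sk k, ‖g x + hk k x‖ₑ ^ p ∂μ)
    (hlim' : ∀ᵐ x ∂μ, x ∈ S' → ∀ᶠ k in atTop, x ∈ Sk' k)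
    (hlim : ∀ᵐ x ∂μ, x ∉ S → ∀ᶠ k in atTop, x ∉ Sk k)
    (hconv : Tendsto (fun k => ∫⁻ x, ‖hk k x - h x‖ₑ ^ p ∂μ) atTop (𝓝 0))
    {G : X → ℝ≥0∞} (hG : ∫⁻ x, G x ∂μ ≠ ⊤)
    (hGle : ∀ k, ∀ᵐ x ∂μ, x ∈ Sk k → ‖g x + h x‖ₑ ^ p ≤ G x) :
    ∫⁻ x in S', ‖g x‖ₑ ^ p ∂μ ≤ C * ∫⁻ x in S, ‖g x + h x‖ₑ ^ p ∂μ := by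
  have hp0 : 0 < p := by linarith
  set J := ∫⁻ x in S, ‖g x + h x‖ₑ ^ p ∂μ with hJ
  set I : ℕ → ℝ≥0∞ := fun k => ∫⁻ x in Sk k, ‖g x + h x‖ₑ ^ p ∂μ with hI
  set d : ℕ → ℝ≥0∞ := fun k => ∫⁻ x, ‖hk k x - h x‖ₑ ^ p ∂μ with hd
  by_cases hJt : J = ⊤
  · rw [hJt, ENNReal.mul_top hC0]; exact le_top
  have hlimsup : limsup I atTop ≤ J := by
    have h1 := limsup_lintegral_le (μ := μ)
      (f := fun k => (Sk k).indicator (fun x => ‖g x + h x‖ₑ ^ p)) G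
      (fun k => (((hg.add hh).enorm.pow_const p)).indicator (hSk k))
      (fun k => by
        filter_upwards [hGle k] with x hx
        by_cases hxS : x ∈ Sk k
        · simpa [hxS] using hx hxS
        · simp [hxS]) hG
    simp only [lintegral_indicator (hSk _)] at h1
    refine h1.trans ?_
    rw [hJ, ← lintegral_indicator hS]
    refine lintegral_mono_ae ?_
    filter_upwards [hlim] with x hx
    by_cases hxS : x ∈ S
    · rw [indicator_of_mem hxS]
      refine limsup_le_of_le (by isBoundedDefault) (Eventually.of_forall fun k => ?_)
      exact indicator_le_self _ _ _
    · rw [indicator_of_notMem hxS]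
      refine limsup_le_of_le (by isBoundedDefault) ?_
      filter_upwards [hx hxS] with k hk
      simp [hk]
  have hMink : ∀ k, ∫⁻ x in Sk k, ‖g x + hk k x‖ₑ ^ p ∂μ ≤
      (I k ^ (1 / p) + d k ^ (1 / p)) ^ p := by
    intro k
    have h1 := ENNReal.lintegral_Lp_add_le (μ := μ.restrict (Sk k)) (p := p)
      (f := fun x => ‖g x + h x‖ₑ) (g := fun x => ‖hk k x - h x‖ₑ)
      ((hg.add hh).enorm.aemeasurable) (((hhk k).sub hh).enorm.aemeasurable) hp
    have h2 : ∫⁻ x in Sk k, ‖g x + hk k x‖ₑ ^ p ∂μ ≤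
        ∫⁻ x in Sk k, ((fun x => ‖g x + h x‖ₑ) + fun x => ‖hk k x - h x‖ₑ) x ^ p ∂μ := by
      refine lintegral_mono fun x => ENNReal.rpow_le_rpow ?_ hp0.le
      calc ‖g x + hk k x‖ₑ = ‖(g x + h x) + (hk k x - h x)‖ₑ := by congr 1; abel
        _ ≤ _ := enorm_add_le _ _
    refine h2.trans ?_
    rw [← ENNReal.rpow_le_rpow_iff (z := 1 / p) (by positivity), ← ENNReal.rpow_mul,
      mul_one_div_cancel hp0.ne', ENNReal.rpow_one]
    refine h1.trans (add_le_add le_rfl ?_)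
    exact ENNReal.rpow_le_rpow (setLIntegral_le_lintegral _ _) (by positivity)
  have hFatou : ∫⁻ x in S', ‖g x‖ₑ ^ p ∂μ ≤
      liminf (fun k => ∫⁻ x in Sk' k, ‖g x‖ₑ ^ p ∂μ) atTop := by
    have h1 := lintegral_liminf_le (μ := μ) (u := atTop)
      (f := fun k => (Sk' k).indicator (fun x => ‖g x‖ₑ ^ p))
      (fun k => (hg.enorm.pow_const p).indicator (hSk' k))
    simp only [lintegral_indicator (hSk' _)] at h1
    refine le_trans ?_ h1
    rw [← lintegral_indicator hS']
    refine lintegral_mono_ae ?_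
    filter_upwards [hlim'] with x hx
    by_cases hxS : x ∈ S'
    · rw [indicator_of_mem hxS]
      refine le_liminf_of_le (by isBoundedDefault) ?_
      filter_upwards [hx hxS] with k hk
      simp [hk]
    · simp [hxS]
  have hc : ∀ c, J < c → ∫⁻ x in S', ‖g x‖ₑ ^ p ∂μ ≤ C * c := by
    intro c hJc
    by_cases hct : c = ⊤
    · rw [hct, ENNReal.mul_top hC0]; exact le_top
    have h1 : ∀ᶠ k in atTop, I k < c := eventually_lt_of_limsup_lt (hlimsup.trans_lt hJc)
    have h2 : ∀ᶠ k in atTop, ∫⁻ x in Sk' k, ‖g x‖ₑ ^ p ∂μ ≤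
        C * (c ^ (1 / p) + d k ^ (1 / p)) ^ p := by
      filter_upwards [h1] with k hk
      refine (H k).trans (mul_le_mul_right ((hMink k).trans ?_) _)
      gcongr
    have h3 : Tendsto (fun k => C * (c ^ (1 / p) + d k ^ (1 / p)) ^ p) atTop (𝓝 (C * c)) := by
      refine ENNReal.Tendsto.const_mul ?_ (Or.inr hC)
      have h4 : Tendsto (fun k => d k ^ (1 / p)) atTop (𝓝 0) := by
        have := (ENNReal.continuous_rpow_const (y := 1 / p)).tendsto 0 |>.comp hconv
        rwa [ENNReal.zero_rpow_of_pos (by positivity)] at this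
      have h5 := (ENNReal.continuous_rpow_const (y := p)).tendsto (c ^ (1 / p) + 0) |>.comp
        (h4.const_add (c ^ (1 / p)))
      rwa [add_zero, ← ENNReal.rpow_mul, one_div_mul_cancel hp0.ne', ENNReal.rpow_one] at h5
    calc _ ≤ liminf (fun k => ∫⁻ x in Sk' k, ‖g x‖ₑ ^ p ∂μ) atTop := hFatou
      _ ≤ liminf (fun k => C * (c ^ (1 / p) + d k ^ (1 / p)) ^ p) atTop := liminf_le_liminf h2
      _ = C * c := h3.liminf_eq
  have h6 : Tendsto (fun ε : ℝ≥0∞ => C * (J + ε)) (𝓝[>] 0) (𝓝 (C * (J + 0))) :=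
    (ENNReal.Tendsto.const_mul (tendsto_const_nhds.add tendsto_id) (Or.inr hC)).mono_left
      nhdsWithin_le_nhds
  rw [add_zero] at h6
  refine ge_of_tendsto h6 ?_
  filter_upwards [self_mem_nhdsWithin] with ε hε
  exact hc _ (ENNReal.lt_add_right hJt (ne_of_gt hε))

/-- Smooth compactly supported functions `T j` that vanish near `0`, with uniformly bounded
derivatives, and that converge to the identity. -/
lemma exists_truncation : ∃ (T : ℕ → ℝ → ℝ) (C : ℝ), (∀ j, ContDiff ℝ ∞ (T j)) ∧
    (∀ j t, |deriv (T j) t| ≤ C) ∧ (∀ j, ∃ M, ∀ t, |T j t| ≤ M) ∧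
    (∀ j, ∃ ε > 0, ∀ t, |t| < ε → T j t = 0) ∧ (∀ t, t ≠ 0 → ∀ᶠ j in atTop, T j t ≠ 0) ∧
    (∀ t, t ≠ 0 → ∀ᶠ j in atTop, deriv (T j) t = 1) := by
  let b : ContDiffBump (0 : ℝ) := ⟨1, 2, one_pos, by norm_num⟩
  have hbs : ContDiff ℝ ∞ b := b.contDiff
  have hb1 : ∀ t : ℝ, |t| ≤ 1 → b t = 1 := fun t ht =>
    b.one_of_mem_closedBall (by simpa [b] using ht)
  have hb0 : ∀ t : ℝ, 2 ≤ |t| → b t = 0 := fun t ht =>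
    b.zero_of_le_dist (by simpa [b] using ht)
  have hb01 : ∀ t : ℝ, |b t| ≤ 1 := fun t => by
    rw [abs_of_nonneg b.nonneg]; exact b.le_one
  have hb01' : ∀ t : ℝ, |1 - b t| ≤ 1 := fun t => by
    rw [abs_of_nonneg (by linarith [b.le_one (x := t)])]; linarith [b.nonneg (x := t)]
  have hbd : ∀ t, HasDerivAt b (deriv b t) t := fun t =>
    (hbs.differentiable (by simp) t).hasDerivAt
  obtain ⟨K, hK⟩ : ∃ K, ∀ t, |t * deriv b t| ≤ K := by
    have hc : Continuous (fun t => t * deriv b t) :=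
      continuous_id.mul (hbs.continuous_deriv (by simp))
    have hs : HasCompactSupport (fun t => t * deriv b t) := (b.hasCompactSupport.deriv).mul_left
    obtain ⟨K, hK⟩ := hc.bounded_above_of_compact_support hs
    exact ⟨K, hK⟩
  have hK0 : 0 ≤ K := (abs_nonneg _).trans (hK 0)
  set T : ℕ → ℝ → ℝ := fun j t => t * (1 - b ((j + 1) * t)) * b (t / (j + 1)) with hT
  have hj0 : ∀ j : ℕ, (0 : ℝ) < j + 1 := fun j => by positivity
  have hTd : ∀ j t, deriv (T j) t = (1 - b ((j + 1) * t)) * b (t / (j + 1)) -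
      (((j + 1) * t) * deriv b ((j + 1) * t)) * b (t / (j + 1)) +
      (1 - b ((j + 1) * t)) * ((t / (j + 1)) * deriv b (t / (j + 1))) := by
    intro j t
    have h1 : HasDerivAt (fun t : ℝ => b ((j + 1) * t))
        (deriv b ((j + 1) * t) * ((j + 1) * 1)) t :=
      (hbd _).comp t ((hasDerivAt_id t).const_mul ((j : ℝ) + 1))
    have h2 : HasDerivAt (fun t : ℝ => b (t / (j + 1))) (deriv b (t / (j + 1)) * (1 / (j + 1))) t :=
      (hbd _).comp t ((hasDerivAt_id t).div_const ((j : ℝ) + 1))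
    have h3 := (((hasDerivAt_id t).mul (h1.const_sub 1)).mul h2).deriv
    calc deriv (T j) t = _ := h3
      _ = _ := by simp only [id, Pi.mul_apply]; ring
  refine ⟨T, 1 + K + K, ?_, ?_, ?_, ?_, ?_, ?_⟩
  · intro j
    exact (contDiff_id.mul (contDiff_const.sub (hbs.comp (contDiff_const.mul contDiff_id)))).mul
      (hbs.comp (contDiff_id.div_const _))
  · intro j t
    rw [hTd]
    have e1 : |(1 - b ((j + 1) * t)) * b (t / (j + 1))| ≤ 1 := by
      rw [abs_mul]; exact mul_le_one₀ (hb01' _) (abs_nonneg _) (hb01 _)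
    have e2 : |(((j + 1) * t) * deriv b ((j + 1) * t)) * b (t / (j + 1))| ≤ K := by
      rw [abs_mul]
      calc _ ≤ K * 1 := mul_le_mul (hK _) (hb01 _) (abs_nonneg _) hK0
        _ = K := mul_one K
    have e3 : |(1 - b ((j + 1) * t)) * ((t / (j + 1)) * deriv b (t / (j + 1)))| ≤ K := by
      rw [abs_mul]
      calc _ ≤ 1 * K := mul_le_mul (hb01' _) (hK _) (abs_nonneg _) zero_le_one
        _ = K := one_mul K
    exact (abs_add_le _ _).trans (add_le_add ((abs_sub _ _).trans (add_le_add e1 e2)) e3)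
  · intro j
    refine ⟨2 * (j + 1), fun t => ?_⟩
    by_cases h : 2 ≤ |t / (j + 1)|
    · simp only [hT, hb0 _ h, mul_zero, abs_zero]; positivity
    · push Not at h
      rw [abs_div, abs_of_pos (hj0 j), div_lt_iff₀ (hj0 j)] at h
      simp only [hT, abs_mul]
      calc |t| * |1 - b ((j + 1) * t)| * |b (t / (j + 1))| ≤ |t| * 1 * 1 := by
            gcongr
            · exact hb01' _
            · exact hb01 _
        _ ≤ _ := by linarith
  · intro j
    refine ⟨1 / (j + 1), by positivity, fun t ht => ?_⟩
    have : |(j + 1) * t| ≤ 1 := by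
      rw [abs_mul, abs_of_pos (hj0 j)]
      rw [lt_div_iff₀ (hj0 j)] at ht
      linarith
    simp only [hT, hb1 _ this, sub_self, mul_zero, zero_mul]
  · intro t ht
    have ht' : 0 < |t| := abs_pos.2 ht
    filter_upwards [tendsto_natCast_atTop_atTop.eventually_ge_atTop (2 / |t|),
      tendsto_natCast_atTop_atTop.eventually_ge_atTop |t|] with j hj1 hj2
    have h1 : 2 ≤ |(j + 1) * t| := by
      rw [abs_mul, abs_of_pos (hj0 j)]
      rw [div_le_iff₀ ht'] at hj1
      linarith
    have h2 : |t / (j + 1)| ≤ 1 := by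
      rw [abs_div, abs_of_pos (hj0 j), div_le_one (hj0 j)]; linarith
    simpa [hT, hb0 _ h1, hb1 _ h2] using ht
  · intro t ht
    have ht' : 0 < |t| := abs_pos.2 ht
    filter_upwards [tendsto_natCast_atTop_atTop.eventually_ge_atTop (2 / |t|),
      tendsto_natCast_atTop_atTop.eventually_ge_atTop |t|] with j hj1 hj2
    have h1 : 2 < |(j + 1) * t| := by
      rw [abs_mul, abs_of_pos (hj0 j)]
      rw [div_le_iff₀ ht'] at hj1
      linarith
    have h2 : |t / (j + 1)| < 1 := by
      rw [abs_div, abs_of_pos (hj0 j), div_lt_one (hj0 j)]; linarith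
    have d1 : deriv b ((j + 1) * t) = 0 := by
      have : (b : ℝ → ℝ) =ᶠ[𝓝 ((j + 1) * t)] fun _ => 0 := by
        filter_upwards [(isOpen_lt continuous_const continuous_abs).mem_nhds h1] with s hs
        exact hb0 s (le_of_lt hs)
      rw [this.deriv_eq, deriv_const]
    have d2 : deriv b (t / (j + 1)) = 0 := by
      have : (b : ℝ → ℝ) =ᶠ[𝓝 (t / (j + 1))] fun _ => 1 := by
        filter_upwards [(isOpen_lt continuous_abs continuous_const).mem_nhds h2] with s hs
        exact hb1 s (le_of_lt hs)
      rw [this.deriv_eq, deriv_const]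
    rw [hTd, d1, d2, hb0 _ h1.le, hb1 _ h2.le]
    simp

/-- A point has capacity zero: smooth functions that vanish near the origin and converge to `1`
elsewhere, with energies tending to `0`. -/
lemma exists_cutoff {n : ℕ} (hn : 0 < n) {p β : ℝ} (hp : 1 < p) (hβ : 0 < β)
    (hβp : n + β = (β + 1) * p) : ∃ η : ℕ → EuclideanSpace ℝ (Fin n) → ℝ,
    (∀ m, ContDiff ℝ ∞ (η m)) ∧ (∀ m x, |η m x| ≤ 1) ∧
    (∀ m, ∃ δ > 0, ∀ x, η m x ≠ 0 → δ ≤ ‖x‖) ∧ (∀ x, x ≠ 0 → ∀ᶠ m in atTop, η m x = 1) ∧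
    (∀ m, ∃ M, ∀ x, ‖gradient (η m) x‖ ≤ M) ∧
    Tendsto (fun m => ∫⁻ x, ‖gradient (η m) x‖ₑ ^ p) atTop (𝓝 0) := by
  have hp0 : 0 < p := by linarith
  have hm0 : ∀ m : ℕ, (0 : ℝ) < m + 1 := fun m => by positivity
  let f : ∀ m : ℕ, ContDiffBump (3 * (m + 1) : ℝ) := fun m =>
    ⟨m + 1, 2 * (m + 1), hm0 m, by linarith [hm0 m]⟩
  set w : ℕ → ℝ → ℝ := fun m => (f m).normed volume with hw
  have hws : ∀ m, Function.support (w m) ⊆ Ioo ((m : ℝ) + 1) (5 * (m + 1)) := by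
    intro m
    rw [hw, (f m).support_normed_eq, Real.ball_eq_Ioo]
    apply Ioo_subset_Ioo <;> simp only [f] <;> linarith
  have hwsm : ∀ m, ContDiff ℝ ∞ (w m) := fun m => (f m).contDiff_normed
  have hwint : ∀ m, ∫ t, w m t = 1 := fun m => (f m).integral_normed
  have hw0 : ∀ m t, 0 ≤ w m t := fun m t => (f m).nonneg_normed t
  have hwi : ∀ m, Integrable (w m) := fun m => (f m).integrable_normed
  set P : ℕ → EuclideanSpace ℝ (Fin n) → ℝ := fun m => radialPrimitive β (w m) with hP
  have hPs : ∀ m, ContDiff ℝ ∞ (P m) := fun m =>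
    contDiff_radialPrimitive hβ (hwsm m) (hws m) (hm0 m).le
  have hPc : ∀ m, HasCompactSupport (P m) := fun m =>
    (isCompact_closedBall _ _).of_isClosed_subset (isClosed_tsupport _)
      (tsupport_radialPrimitive_subset hβ (hm0 m) (hws m))
  have hgrad : ∀ m x, gradient (fun y => 1 - P m y) x = -radialGradient β (w m) x := by
    intro m x
    have h1 := hasGradientAt_radialPrimitive (n := n) hβ (hwsm m).continuous (hws m) (hm0 m).le x
    refine HasGradientAt.gradient ?_
    rw [hasGradientAt_iff_hasFDerivAt] at h1 ⊢
    rw [map_neg]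
    exact h1.const_sub 1
  have hgradP : ∀ m x, gradient (P m) x = radialGradient β (w m) x := fun m x =>
    (hasGradientAt_radialPrimitive (n := n) hβ (hwsm m).continuous (hws m) (hm0 m).le x).gradient
  refine ⟨fun m x => 1 - P m x, fun m => contDiff_const.sub (hPs m), ?_, ?_, ?_, ?_, ?_⟩
  · intro m x
    have h01 : 0 ≤ P m x ∧ P m x ≤ 1 := by
      by_cases hx : x = 0
      · rw [hx, hP]; simp only [radialPrimitive_zero, hwint]; norm_num
      · simp only [hP, radialPrimitive_of_ne hx]
        have hx0 : (0 : ℝ) ≤ ‖x‖ ^ (-β) := Real.rpow_nonneg (norm_nonneg _) _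
        refine ⟨intervalIntegral.integral_nonneg hx0 fun t _ => hw0 m t, ?_⟩
        rw [intervalIntegral.integral_of_le hx0, ← hwint m]
        exact setIntegral_le_integral (hwi m) (Eventually.of_forall (hw0 m))
    rw [abs_of_nonneg] <;> linarith [h01.1, h01.2]
  · intro m
    refine ⟨(5 * (m + 1)) ^ (-β⁻¹), Real.rpow_pos_of_pos (by linarith [hm0 m]) _, fun x hx => ?_⟩
    by_contra h
    push Not at h
    apply hx
    have : P m x = 1 := by
      rw [hP, ← hwint m]
      refine radialPrimitive_eq_integral (hws m) (hm0 m).le fun hx0 => ?_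
      have h1 := Real.rpow_le_rpow_of_nonpos (norm_pos_iff.2 hx0) h.le (show -β ≤ 0 by linarith)
      rwa [rpow_neg_inv_rpow_neg hβ.ne' (by linarith [hm0 m])] at h1
    simp only [this, sub_self]
  · intro x hx
    filter_upwards [tendsto_natCast_atTop_atTop.eventually_ge_atTop (‖x‖ ^ (-β))] with m hm
    rw [hP]
    simp only
    rw [radialPrimitive_eq_zero (hws m) hx (by linarith), sub_zero]
  · intro m
    have hc : Continuous (gradient (P m)) := continuous_gradient (hPs m)
    obtain ⟨M, hM⟩ := hc.bounded_above_of_compact_support (by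
      refine (hPc m).mono' fun x hx => ?_
      by_contra h
      have h1 : P m =ᶠ[𝓝 x] fun _ => 0 := notMem_tsupport_iff_eventuallyEq.1 h
      exact hx (by rw [h1.gradient_eq, gradient_fun_const]))
    refine ⟨M, fun x => ?_⟩
    rw [hgrad, norm_neg, ← hgradP]
    exact hM x
  · simp only [hgrad, enorm_neg]
    set c := ENNReal.ofReal
      (n * (volume (ball (0 : EuclideanSpace ℝ (Fin n)) 1)).toReal * β ^ (p - 1)) with hc
    have hbound : ∀ m : ℕ, ∫⁻ x : EuclideanSpace ℝ (Fin n), ‖radialGradient β (w m) x‖ₑ ^ p ≤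
        c * ENNReal.ofReal ((2 * ((m : ℝ) + 1)) ^ (1 - p)) := by
      intro m
      rw [lintegral_enorm_radialGradient hn hp0 hβ hβp (hwsm m).continuous.measurable]
      exact mul_le_mul_right ((setLIntegral_le_lintegral _ _).trans
        (lintegral_enorm_normed_rpow_le hp (f m))) _
    have hlim : Tendsto (fun m : ℕ => c * ENNReal.ofReal ((2 * ((m : ℝ) + 1)) ^ (1 - p))) atTop
        (𝓝 (c * ENNReal.ofReal 0)) := by
      refine ENNReal.Tendsto.const_mul (ENNReal.tendsto_ofReal ?_) (Or.inr ENNReal.ofReal_ne_top)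
      have h1 : Tendsto (fun x : ℝ => x ^ (1 - p)) atTop (𝓝 0) := by
        have := tendsto_rpow_neg_atTop (y := p - 1) (by linarith)
        simpa using this
      refine h1.comp (Tendsto.const_mul_atTop two_pos ?_)
      exact tendsto_atTop_add_const_right _ _ tendsto_natCast_atTop_atTop
    rw [ENNReal.ofReal_zero, mul_zero] at hlim
    exact tendsto_of_tendsto_of_tendsto_of_le_of_le tendsto_const_nhds hlim
      (fun _ => zero_le) hbound

lemma enorm_le_ofReal {E : Type*} [SeminormedAddCommGroup E] {x : E} {M : ℝ} (h : ‖x‖ ≤ M) :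
    ‖x‖ₑ ≤ ENNReal.ofReal M := by
  rw [← ofReal_norm]; exact ENNReal.ofReal_le_ofReal h

lemma tendsto_lintegral_rpow_of_le_add {X : Type*} [MeasurableSpace X] {μ : Measure X} {p : ℝ}
    (hp : 1 ≤ p) {f a b : ℕ → X → ℝ≥0∞} (ha : ∀ k, Measurable (a k))
    (hle : ∀ k x, f k x ≤ a k x + b k x)
    (ha0 : Tendsto (fun k => ∫⁻ x, a k x ^ p ∂μ) atTop (𝓝 0))
    (hb0 : Tendsto (fun k => ∫⁻ x, b k x ^ p ∂μ) atTop (𝓝 0)) :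
    Tendsto (fun k => ∫⁻ x, f k x ^ p ∂μ) atTop (𝓝 0) := by
  have hp0 : 0 ≤ p := by linarith
  have h2 : (2 : ℝ≥0∞) ^ (p - 1) ≠ ⊤ := by finiteness
  have hlim := ENNReal.Tendsto.const_mul (a := (2 : ℝ≥0∞) ^ (p - 1)) (ha0.add hb0) (Or.inr h2)
  rw [add_zero, mul_zero] at hlim
  refine tendsto_of_tendsto_of_tendsto_of_le_of_le tendsto_const_nhds hlim (fun _ => zero_le)
    fun k => ?_
  calc ∫⁻ x, f k x ^ p ∂μ ≤ ∫⁻ x, 2 ^ (p - 1) * (a k x ^ p + b k x ^ p) ∂μ :=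
        lintegral_mono fun x => (ENNReal.rpow_le_rpow (hle k x) hp0).trans
          (ENNReal.rpow_add_le_mul_rpow_add_rpow _ _ hp)
    _ = _ := by rw [lintegral_const_mul' _ _ h2, lintegral_add_left ((ha k).pow_const p)]

lemma lintegral_mul_add_const_rpow_ne_top {X : Type*} [MeasurableSpace X] {μ : Measure X}
    [IsFiniteMeasure μ] {p : ℝ} (hp : 1 ≤ p) {f : X → ℝ≥0∞} (hf : Measurable f)
    (hfp : ∫⁻ x, f x ^ p ∂μ ≠ ⊤) {c d : ℝ≥0∞} (hc : c ≠ ⊤) (hd : d ≠ ⊤) :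
    ∫⁻ x, (c * f x + d) ^ p ∂μ ≠ ⊤ := by
  have hp0 : 0 ≤ p := by linarith
  have h2 : (2 : ℝ≥0∞) ^ (p - 1) ≠ ⊤ := by finiteness
  refine ne_top_of_le_ne_top (b := ∫⁻ x, 2 ^ (p - 1) * (c ^ p * f x ^ p + d ^ p) ∂μ) ?_ ?_
  · rw [lintegral_const_mul' _ _ h2, lintegral_add_left (by fun_prop), lintegral_const,
      lintegral_const_mul' _ _ (by finiteness)]
    have := measure_ne_top μ univ
    finiteness
  · refine lintegral_mono fun x => ?_
    rw [← ENNReal.mul_rpow_of_nonneg _ _ hp0]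
    exact ENNReal.rpow_add_le_mul_rpow_add_rpow _ _ hp

lemma gradient_comp_mul {n : ℕ} {T : ℝ → ℝ} {ψ η : EuclideanSpace ℝ (Fin n) → ℝ}
    (hT : Differentiable ℝ T) (hψ : Differentiable ℝ ψ) (hη : Differentiable ℝ η)
    (x : EuclideanSpace ℝ (Fin n)) :
    gradient (fun y => T (ψ y) * η y) x =
      (η x * deriv T (ψ x)) • gradient ψ x + T (ψ x) • gradient η x := by
  refine HasGradientAt.gradient ?_
  rw [hasGradientAt_iff_hasFDerivAt]
  have h1 := (((hT (ψ x)).hasDerivAt.comp_hasFDerivAt x (hψ x).hasFDerivAt).mul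
    (hη x).hasFDerivAt)
  refine h1.congr_fderiv ?_
  simp only [map_add, map_smul, toDual_gradient, Function.comp]
  rw [add_comm, smul_smul]

section Closure

variable {n : ℕ} {p : ℝ} {Ω : Set (EuclideanSpace ℝ (Fin n))}
  {g h : EuclideanSpace ℝ (Fin n) → EuclideanSpace ℝ (Fin n)} {C : ℝ≥0∞}
  {φ : EuclideanSpace ℝ (Fin n) → ℝ} {ψ : ℕ → EuclideanSpace ℝ (Fin n) → ℝ}

/-- The quasiminimizing inequality for a truncated perturbation that vanishes near the origin. -/
lemma setLIntegral_le_truncated (hp : 1 < p) (hΩ : Ω ⊆ ball 0 1)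
    (hg : Measurable g) (hgb : ∀ δ > 0, ∃ M, ∀ x, δ ≤ ‖x‖ → ‖g x‖ ≤ M) (hC : C ≠ ⊤) (hC0 : C ≠ 0)
    (H : ∀ ψ, IsTestFunction Ω ψ → ∫⁻ x in {x | ψ x ≠ 0}, ‖g x‖ₑ ^ p ≤
      C * ∫⁻ x in {x | ψ x ≠ 0}, ‖g x + gradient ψ x‖ₑ ^ p)
    (hφ : Measurable φ) (hh : Measurable h) (hhp : ∫⁻ x in Ω, ‖h x‖ₑ ^ p ≠ ⊤)
    (hψ : ∀ k, IsTestFunction Ω (ψ k))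
    (hψφ : ∀ᵐ x ∂volume.restrict Ω, Tendsto (fun k => ψ k x) atTop (𝓝 (φ x)))
    (hψh : Tendsto (fun k => ∫⁻ x in Ω, ‖gradient (ψ k) x - h x‖ₑ ^ p) atTop (𝓝 0))
    {T : ℝ → ℝ} {L M : ℝ} (hT : ContDiff ℝ ∞ T) (hTL : ∀ t, |deriv T t| ≤ L)
    (hTM : ∀ t, |T t| ≤ M) (hT0 : ∃ ε > 0, ∀ t, |t| < ε → T t = 0)
    {η : EuclideanSpace ℝ (Fin n) → ℝ} {N : ℝ} (hη : ContDiff ℝ ∞ η) (hη1 : ∀ x, |η x| ≤ 1)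
    (hη0 : ∃ δ > 0, ∀ x, η x ≠ 0 → δ ≤ ‖x‖) (hηN : ∀ x, ‖gradient η x‖ ≤ N) :
    ∫⁻ x in {x | T (φ x) ≠ 0 ∧ η x ≠ 0}, ‖g x‖ₑ ^ p ∂volume.restrict Ω ≤
      C * ∫⁻ x in {x | φ x ≠ 0 ∧ η x ≠ 0}, ‖g x +
        ((η x * deriv T (φ x)) • h x + T (φ x) • gradient η x)‖ₑ ^ p ∂volume.restrict Ω := by
  set μ := (volume : Measure (EuclideanSpace ℝ (Fin n))).restrict Ω with hμ
  have : IsFiniteMeasure μ :=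
    ⟨by rw [hμ, Measure.restrict_apply_univ]; exact (measure_mono hΩ).trans_lt measure_ball_lt_top⟩
  have hp0 : 0 < p := by linarith
  have hM0 : 0 ≤ M := (abs_nonneg _).trans (hTM 0)
  obtain ⟨ε, hε, hTε⟩ := hT0
  obtain ⟨δ, hδ, hηδ⟩ := hη0
  obtain ⟨Mg, hMg⟩ := hgb δ hδ
  have hTc : Continuous T := hT.continuous
  have hT'c : Continuous (deriv T) := hT.continuous_deriv (by simp)
  have hηc : Continuous η := hη.continuous
  have hη'c : Continuous (gradient η) := continuous_gradient hη
  have hψs : ∀ k, ContDiff ℝ ∞ (ψ k) := fun k => (hψ k).1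
  have hψc : ∀ k, Continuous (ψ k) := fun k => (hψs k).continuous
  have hψ'c : ∀ k, Continuous (gradient (ψ k)) := fun k => continuous_gradient (hψs k)
  set F : EuclideanSpace ℝ (Fin n) → EuclideanSpace ℝ (Fin n) := fun x =>
    (η x * deriv T (φ x)) • h x + T (φ x) • gradient η x with hF
  set Fk : ℕ → EuclideanSpace ℝ (Fin n) → EuclideanSpace ℝ (Fin n) := fun k x =>
    (η x * deriv T (ψ k x)) • gradient (ψ k) x + T (ψ k x) • gradient η x with hFk
  have hFm : Measurable F := by
    have := hη'c.measurable
    have := hηc.measurable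
    have := hT'c.measurable.comp hφ
    have := hTc.measurable.comp hφ
    fun_prop
  have hFkc : ∀ k, Continuous (Fk k) := fun k => by
    have := hψ'c k
    have := hT'c.comp (hψc k)
    have := hTc.comp (hψc k)
    fun_prop
  have hgrad : ∀ k x, gradient (fun y => T (ψ k y) * η y) x = Fk k x := fun k x =>
    gradient_comp_mul (hT.differentiable (by simp)) ((hψs k).differentiable (by simp))
      (hη.differentiable (by simp)) x
  have htest : ∀ k, IsTestFunction Ω (fun y => T (ψ k y) * η y) := by
    intro k
    have hts : tsupport (fun y => T (ψ k y) * η y) ⊆ tsupport (ψ k) := by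
      refine closure_mono fun x hx => ?_
      rw [Function.mem_support] at hx ⊢
      intro h0
      exact hx (by rw [h0, hTε 0 (by simpa using hε), zero_mul])
    exact ⟨(hT.comp (hψs k)).mul hη, (hψ k).2.1.of_isClosed_subset (isClosed_tsupport _) hts,
      hts.trans (hψ k).2.2⟩
  have hSo : ∀ k, IsOpen {x | T (ψ k x) * η x ≠ 0} := fun k =>
    isOpen_ne.preimage ((hTc.comp (hψc k)).mul hηc)
  have hSΩ : ∀ k, {x | T (ψ k x) * η x ≠ 0} ⊆ Ω := fun k x hx =>
    (htest k).2.2 (subset_tsupport _ hx)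
  have hmTφ : Measurable fun x => T (φ x) := hTc.measurable.comp hφ
  refine setLIntegral_rpow_le_of_tendsto (μ := μ) hp.le hC hC0 hg hFm (hk := Fk)
    (fun k => (hFkc k).measurable)
    (Sk := fun k => {x | T (ψ k x) * η x ≠ 0}) (Sk' := fun k => {x | T (ψ k x) * η x ≠ 0})
    ?_ ?_ (fun k => (hSo k).measurableSet) (fun k => (hSo k).measurableSet) ?_ ?_ ?_ ?_
    (G := fun x => (ENNReal.ofReal L * ‖h x‖ₑ + ENNReal.ofReal (Mg + M * N)) ^ p) ?_ ?_
  · exact (hmTφ (measurableSet_singleton 0).compl).inter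
      (hηc.measurable (measurableSet_singleton 0).compl)
  · exact (hφ (measurableSet_singleton 0).compl).inter
      (hηc.measurable (measurableSet_singleton 0).compl)
  · intro k
    have h1 := H _ (htest k)
    simp only [hgrad] at h1
    rw [hμ, Measure.restrict_restrict (hSo k).measurableSet, inter_eq_left.2 (hSΩ k)]
    exact h1
  · filter_upwards [hψφ] with x hx hxS
    have : Tendsto (fun k => T (ψ k x) * η x) atTop (𝓝 (T (φ x) * η x)) :=
      ((hTc.tendsto _).comp hx).mul_const _
    exact this.eventually_ne (mul_ne_zero hxS.1 hxS.2)
  · filter_upwards [hψφ] with x hx hxS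
    by_cases hηx : η x = 0
    · exact Eventually.of_forall fun k => by simp [hηx]
    · have hφx : φ x = 0 := by
        by_contra h0; exact hxS ⟨h0, hηx⟩
      rw [hφx] at hx
      filter_upwards [(hx.abs).eventually_lt_const (by simpa using hε : |(0 : ℝ)| < ε)] with k hk
      simp [hTε _ hk]
  · refine tendsto_lintegral_rpow_of_le_add hp.le
      (a := fun k x => ENNReal.ofReal L * ‖gradient (ψ k) x - h x‖ₑ)
      (b := fun k x => ‖(η x * (deriv T (ψ k x) - deriv T (φ x))) • h x +
        (T (ψ k x) - T (φ x)) • gradient η x‖ₑ) ?_ ?_ ?_ ?_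
    · intro k
      exact (((hψ'c k).measurable.sub hh).enorm).const_mul _
    · intro k x
      have e : Fk k x - F x = (η x * deriv T (ψ k x)) • (gradient (ψ k) x - h x) +
          ((η x * (deriv T (ψ k x) - deriv T (φ x))) • h x +
            (T (ψ k x) - T (φ x)) • gradient η x) := by
        simp only [hFk, hF]; module
      rw [e]
      refine (enorm_add_le _ _).trans (add_le_add ?_ le_rfl)
      rw [enorm_smul]
      gcongr
      refine enorm_le_ofReal ?_
      rw [Real.norm_eq_abs, abs_mul]
      calc _ ≤ 1 * L := mul_le_mul (hη1 x) (hTL _) (abs_nonneg _) zero_le_one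
        _ = L := one_mul L
    · have h1 := ENNReal.Tendsto.const_mul (a := ENNReal.ofReal L ^ p) hψh
        (Or.inr (by finiteness))
      rw [mul_zero] at h1
      refine h1.congr fun k => ?_
      rw [← lintegral_const_mul' _ _ (by finiteness)]
      simp only [ENNReal.mul_rpow_of_nonneg _ _ hp0.le]
    · have hdom := tendsto_lintegral_of_dominated_convergence (μ := μ)
        (F := fun k x => ‖(η x * (deriv T (ψ k x) - deriv T (φ x))) • h x +
          (T (ψ k x) - T (φ x)) • gradient η x‖ₑ ^ p) (f := fun _ => 0)
        (fun x => (ENNReal.ofReal (2 * L) * ‖h x‖ₑ + ENNReal.ofReal (2 * M * N)) ^ p) ?_ ?_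
        (lintegral_mul_add_const_rpow_ne_top hp.le hh.enorm hhp (by finiteness) (by finiteness)) ?_
      · simpa using hdom
      · intro k
        exact (((hηc.measurable.mul ((hT'c.comp (hψc k)).measurable.sub
          (hT'c.measurable.comp hφ))).smul hh).add
          (((hTc.comp (hψc k)).measurable.sub (hTc.measurable.comp hφ)).smul
            hη'c.measurable)).enorm.pow_const p
      · intro k
        refine Eventually.of_forall fun x => ENNReal.rpow_le_rpow ?_ hp0.le
        refine (enorm_add_le _ _).trans (add_le_add ?_ ?_)
        · rw [enorm_smul]
          gcongr
          refine enorm_le_ofReal ?_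
          rw [Real.norm_eq_abs, abs_mul]
          calc _ ≤ 1 * (2 * L) := mul_le_mul (hη1 x) ((abs_sub _ _).trans
                (by linarith [hTL (ψ k x), hTL (φ x)])) (abs_nonneg _) zero_le_one
            _ = 2 * L := one_mul _
        · refine enorm_le_ofReal ?_
          rw [norm_smul, Real.norm_eq_abs]
          exact mul_le_mul ((abs_sub _ _).trans (by linarith [hTM (ψ k x), hTM (φ x)]))
            (hηN x) (norm_nonneg _) (by linarith)
      · filter_upwards [hψφ] with x hx
        have h1 : Tendsto (fun k => (η x * (deriv T (ψ k x) - deriv T (φ x))) • h x +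
            (T (ψ k x) - T (φ x)) • gradient η x) atTop
            (𝓝 ((η x * (deriv T (φ x) - deriv T (φ x))) • h x +
            (T (φ x) - T (φ x)) • gradient η x)) :=
          (((((hT'c.tendsto _).comp hx).sub_const _).const_mul _).smul_const _).add
            ((((hTc.tendsto _).comp hx).sub_const _).smul_const _)
        have h2 := (ENNReal.continuous_rpow_const (y := p)).tendsto _ |>.comp
          (h1.enorm)
        simpa [ENNReal.zero_rpow_of_pos hp0, Function.comp_def] using h2
  · exact lintegral_mul_add_const_rpow_ne_top hp.le hh.enorm hhp (by finiteness) (by finiteness)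
  · intro k
    refine Eventually.of_forall fun x hxS => ENNReal.rpow_le_rpow ?_ hp0.le
    have hηx : η x ≠ 0 := fun h0 => hxS (by simp [h0])
    have e : g x + F x = (η x * deriv T (φ x)) • h x + (g x + T (φ x) • gradient η x) := by
      simp only [hF]; abel
    rw [e]
    refine (enorm_add_le _ _).trans (add_le_add ?_ ?_)
    · rw [enorm_smul]
      gcongr
      refine enorm_le_ofReal ?_
      rw [Real.norm_eq_abs, abs_mul]
      calc _ ≤ 1 * L := mul_le_mul (hη1 x) (hTL _) (abs_nonneg _) zero_le_one
        _ = L := one_mul L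
    · refine enorm_le_ofReal ((norm_add_le _ _).trans (add_le_add (hMg x (hηδ x hηx)) ?_))
      rw [norm_smul, Real.norm_eq_abs]
      exact mul_le_mul (hTM _) (hηN x) (norm_nonneg _) hM0

/-- The quasiminimizing inequality passes from test functions to their limits. The perturbation is
truncated near the level `0`, so that the sets where the approximating functions do not vanish are
controlled, and near the origin, where `g` is not integrable. -/
lemma setLIntegral_le_of_tendsto (hn : 0 < n) {β : ℝ} (hβ : 0 < β) (hβp : n + β = (β + 1) * p)
    (hp : 1 < p) (hΩ : Ω ⊆ ball 0 1 \ {0}) (hΩo : IsOpen Ω)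
    (hg : Measurable g) (hgb : ∀ δ > 0, ∃ M, ∀ x, δ ≤ ‖x‖ → ‖g x‖ ≤ M) (hC : C ≠ ⊤) (hC0 : C ≠ 0)
    (H : ∀ ψ, IsTestFunction Ω ψ → ∫⁻ x in {x | ψ x ≠ 0}, ‖g x‖ₑ ^ p ≤
      C * ∫⁻ x in {x | ψ x ≠ 0}, ‖g x + gradient ψ x‖ₑ ^ p)
    (hφ : Measurable φ) (hh : Measurable h) (hhp : ∫⁻ x in Ω, ‖h x‖ₑ ^ p ≠ ⊤)
    (hψ : ∀ k, IsTestFunction Ω (ψ k))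
    (hψφ : ∀ᵐ x ∂volume.restrict Ω, Tendsto (fun k => ψ k x) atTop (𝓝 (φ x)))
    (hψh : Tendsto (fun k => ∫⁻ x in Ω, ‖gradient (ψ k) x - h x‖ₑ ^ p) atTop (𝓝 0)) :
    ∫⁻ x in {x | φ x ≠ 0}, ‖g x‖ₑ ^ p ∂volume.restrict Ω ≤
      C * ∫⁻ x in {x | φ x ≠ 0}, ‖g x + h x‖ₑ ^ p ∂volume.restrict Ω := by
  have hΩ1 : Ω ⊆ ball 0 1 := hΩ.trans sdiff_subset
  set μ := (volume : Measure (EuclideanSpace ℝ (Fin n))).restrict Ω with hμ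
  have : IsFiniteMeasure μ :=
    ⟨by rw [hμ, Measure.restrict_apply_univ]; exact (measure_mono hΩ1).trans_lt measure_ball_lt_top⟩
  have hp0 : 0 < p := by linarith
  have hμ0 : ∀ᵐ x ∂μ, x ≠ 0 := by
    filter_upwards [ae_restrict_mem hΩo.measurableSet] with x hx using (hΩ hx).2
  have hφ0 : MeasurableSet {x | φ x ≠ 0} := hφ (measurableSet_singleton 0).compl
  by_cases hfin : ∫⁻ x in {x | φ x ≠ 0}, ‖g x + h x‖ₑ ^ p ∂μ = ⊤
  · rw [hfin, ENNReal.mul_top hC0]; exact le_top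
  obtain ⟨T, L, hT, hTL, hTM, hT0, hTne, hT1⟩ := exists_truncation
  obtain ⟨η, hη, hη1, hη0, hηlim, hηN, hηen⟩ := exists_cutoff hn hp hβ hβp
  have hT'c : ∀ j, Continuous (deriv (T j)) := fun j => (hT j).continuous_deriv (by simp)
  have hTc : ∀ j, Continuous (T j) := fun j => (hT j).continuous
  have hT'm : ∀ j, Measurable fun x => deriv (T j) (φ x) := fun j => (hT'c j).measurable.comp hφ
  have hTm : ∀ j, Measurable fun x => T j (φ x) := fun j => (hTc j).measurable.comp hφ
  have hηm : ∀ m, Measurable (η m) := fun m => (hη m).continuous.measurable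
  have hη'm : ∀ m, Measurable (gradient (η m)) := fun m => (continuous_gradient (hη m)).measurable
  -- an integrable majorant on the set where `φ` does not vanish
  set G : EuclideanSpace ℝ (Fin n) → ℝ≥0∞ := fun x =>
    2 ^ (p - 1) * ({x | φ x ≠ 0}.indicator (fun x => ‖g x + h x‖ₑ ^ p) x +
      (ENNReal.ofReal (L + 1) * ‖h x‖ₑ) ^ p) with hGdef
  have hG : ∫⁻ x, G x ∂μ ≠ ⊤ := by
    have hm : Measurable ({x | φ x ≠ 0}.indicator (fun x => ‖g x + h x‖ₑ ^ p)) :=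
      ((hg.add hh).enorm.pow_const p).indicator hφ0
    rw [hGdef, lintegral_const_mul' _ _ (by finiteness), lintegral_add_left hm,
      lintegral_indicator hφ0]
    simp only [ENNReal.mul_rpow_of_nonneg _ _ hp0.le]
    rw [lintegral_const_mul' _ _ (by finiteness)]
    finiteness
  have hGle : ∀ j x, φ x ≠ 0 → ‖g x + deriv (T j) (φ x) • h x‖ₑ ^ p ≤ G x := by
    intro j x hx
    have e : g x + deriv (T j) (φ x) • h x = (g x + h x) + (deriv (T j) (φ x) - 1) • h x := by
      module
    rw [e, hGdef]
    simp only
    rw [indicator_of_mem (show x ∈ {x | φ x ≠ 0} from hx)]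
    refine le_trans (ENNReal.rpow_le_rpow (enorm_add_le _ _) hp0.le) ?_
    refine (ENNReal.rpow_add_le_mul_rpow_add_rpow _ _ hp.le).trans ?_
    gcongr
    rw [enorm_smul]
    gcongr
    refine enorm_le_ofReal ?_
    rw [Real.norm_eq_abs]
    refine (abs_sub _ _).trans ?_
    rw [abs_one]
    linarith [hTL j (φ x)]
  have hstage : ∀ j, ∫⁻ x in {x | T j (φ x) ≠ 0}, ‖g x‖ₑ ^ p ∂μ ≤
      C * ∫⁻ x in {x | φ x ≠ 0}, ‖g x + deriv (T j) (φ x) • h x‖ₑ ^ p ∂μ := by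
    intro j
    obtain ⟨M, hM⟩ := hTM j
    refine setLIntegral_rpow_le_of_tendsto (μ := μ) hp.le hC hC0 hg
      (h := fun x => deriv (T j) (φ x) • h x) ((hT'm j).smul hh)
      (hk := fun m x => (η m x * deriv (T j) (φ x)) • h x + T j (φ x) • gradient (η m) x)
      (fun m => (((hηm m).mul (hT'm j)).smul hh).add ((hTm j).smul (hη'm m)))
      (Sk' := fun m => {x | T j (φ x) ≠ 0 ∧ η m x ≠ 0})
      (Sk := fun m => {x | φ x ≠ 0 ∧ η m x ≠ 0})
      (hTm j (measurableSet_singleton 0).compl) hφ0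
      (fun m => (hTm j (measurableSet_singleton 0).compl).inter
        (hηm m (measurableSet_singleton 0).compl))
      (fun m => hφ0.inter (hηm m (measurableSet_singleton 0).compl)) ?_ ?_ ?_ ?_ hG ?_
    · intro m
      obtain ⟨N, hN⟩ := hηN m
      exact setLIntegral_le_truncated hp hΩ1 hg hgb hC hC0 H hφ hh hhp hψ hψφ hψh (hT j)
        (hTL j) hM (hT0 j) (hη m) (hη1 m) (hη0 m) hN
    · filter_upwards [hμ0] with x hx hxT
      filter_upwards [hηlim x hx] with m hm
      exact ⟨hxT, by rw [hm]; exact one_ne_zero⟩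
    · exact Eventually.of_forall fun x hx => Eventually.of_forall fun m hm => hx hm.1
    · refine tendsto_lintegral_rpow_of_le_add hp.le
        (a := fun m x => ‖((η m x - 1) * deriv (T j) (φ x)) • h x‖ₑ)
        (b := fun m x => ENNReal.ofReal M * ‖gradient (η m) x‖ₑ) ?_ ?_ ?_ ?_
      · intro m
        exact ((((hηm m).sub_const 1).mul (hT'm j)).smul hh).enorm
      · intro m x
        have e : (η m x * deriv (T j) (φ x)) • h x + T j (φ x) • gradient (η m) x -
            deriv (T j) (φ x) • h x = ((η m x - 1) * deriv (T j) (φ x)) • h x +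
            T j (φ x) • gradient (η m) x := by module
        rw [e]
        refine (enorm_add_le _ _).trans (add_le_add le_rfl ?_)
        rw [enorm_smul]
        gcongr
        exact enorm_le_ofReal (hM _)
      · have hdom := tendsto_lintegral_of_dominated_convergence (μ := μ)
          (F := fun m x => ‖((η m x - 1) * deriv (T j) (φ x)) • h x‖ₑ ^ p) (f := fun _ => 0)
          (fun x => (ENNReal.ofReal (2 * L) * ‖h x‖ₑ + ENNReal.ofReal 0) ^ p)
          (fun m => (((((hηm m).sub_const 1).mul (hT'm j)).smul hh).enorm.pow_const p)) ?_
          (lintegral_mul_add_const_rpow_ne_top hp.le hh.enorm hhp (by finiteness) (by finiteness))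
          ?_
        · simpa using hdom
        · intro m
          refine Eventually.of_forall fun x => ENNReal.rpow_le_rpow ?_ hp0.le
          rw [ENNReal.ofReal_zero, add_zero, enorm_smul]
          gcongr
          refine enorm_le_ofReal ?_
          rw [Real.norm_eq_abs, abs_mul]
          refine mul_le_mul ((abs_sub _ _).trans ?_) (hTL j _) (abs_nonneg _) zero_le_two
          rw [abs_one]
          linarith [hη1 m x]
        · filter_upwards [hμ0] with x hx
          refine tendsto_const_nhds.congr' ?_
          filter_upwards [hηlim x hx] with m hm
          simp [hm, ENNReal.zero_rpow_of_pos hp0]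
      · have h1 := ENNReal.Tendsto.const_mul (a := ENNReal.ofReal M ^ p) hηen
          (Or.inr (by finiteness))
        rw [mul_zero] at h1
        refine tendsto_of_tendsto_of_tendsto_of_le_of_le tendsto_const_nhds h1
          (fun _ => zero_le) fun m => ?_
        simp only [ENNReal.mul_rpow_of_nonneg _ _ hp0.le]
        rw [lintegral_const_mul' _ _ (by finiteness)]
        exact mul_le_mul_right (setLIntegral_le_lintegral _ _) _
    · exact fun m => Eventually.of_forall fun x hx => hGle j x hx.1
  -- on the zero set of `φ` there is no convergence `deriv (T j) (φ x) • h x → h x`; it is discarded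
  have hφae : ∀ᵐ x ∂μ.restrict {x | φ x ≠ 0}, φ x ≠ 0 := ae_restrict_mem hφ0
  have hfinal := setLIntegral_rpow_le_of_tendsto (μ := μ.restrict {x | φ x ≠ 0}) hp.le hC hC0 hg hh
    (fun j => (hT'm j).smul hh) (S' := univ) (S := univ) (Sk := fun _ => univ)
    (Sk' := fun j => {x | T j (φ x) ≠ 0}) .univ .univ
    (fun j => hTm j (measurableSet_singleton 0).compl) (fun _ => .univ)
    (fun j => ?_) ?_ (Eventually.of_forall fun x hx => absurd (mem_univ x) hx) ?_
    (G := fun x => ‖g x + h x‖ₑ ^ p) hfin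
    (fun j => Eventually.of_forall fun x _ => le_rfl)
  · simpa only [setLIntegral_univ] using hfinal
  · rw [setLIntegral_univ]
    exact (lintegral_mono' (Measure.restrict_mono le_rfl Measure.restrict_le_self) le_rfl).trans
      (hstage j)
  · filter_upwards [hφae] with x hx _ using hTne _ hx
  · have hdom := tendsto_lintegral_of_dominated_convergence (μ := μ.restrict {x | φ x ≠ 0})
      (F := fun j x => ‖deriv (T j) (φ x) • h x - h x‖ₑ ^ p) (f := fun _ => 0)
      (fun x => (ENNReal.ofReal (L + 1) * ‖h x‖ₑ + ENNReal.ofReal 0) ^ p)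
      (fun j => ((((hT'm j).smul hh).sub hh).enorm.pow_const p)) ?_
      (ne_top_of_le_ne_top (lintegral_mul_add_const_rpow_ne_top (μ := μ) hp.le hh.enorm hhp
        (by finiteness) (by finiteness)) (setLIntegral_le_lintegral _ _)) ?_
    · simpa using hdom
    · intro j
      refine Eventually.of_forall fun x => ENNReal.rpow_le_rpow ?_ hp0.le
      have e : deriv (T j) (φ x) • h x - h x = (deriv (T j) (φ x) - 1) • h x := by module
      rw [ENNReal.ofReal_zero, add_zero, e, enorm_smul]
      gcongr
      refine enorm_le_ofReal ?_
      rw [Real.norm_eq_abs]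
      refine (abs_sub _ _).trans ?_
      rw [abs_one]
      linarith [hTL j (φ x)]
    · filter_upwards [hφae] with x hx
      refine tendsto_const_nhds.congr' ?_
      filter_upwards [hT1 _ hx] with j hj
      simp [hj, ENNReal.zero_rpow_of_pos hp0]

end Closure

/-- A `C^1` function satisfies the quasiminimizing inequality for all `φ ∈ W^{1,p}_0(Ω)` as soon as
it does for all test functions. -/
lemma setLIntegral_le_of_memSobolevZero {n : ℕ} (hn : 0 < n) {p β : ℝ} (hβ : 0 < β)
    (hβp : n + β = (β + 1) * p) (hp : 1 < p) {Ω : Set (EuclideanSpace ℝ (Fin n))}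
    (hΩ : Ω ⊆ ball 0 1 \ {0}) (hΩo : IsOpen Ω)
    {g h : EuclideanSpace ℝ (Fin n) → EuclideanSpace ℝ (Fin n)}
    {φ : EuclideanSpace ℝ (Fin n) → ℝ} {C : ℝ≥0∞}
    (hg : Measurable g) (hgb : ∀ δ > 0, ∃ M, ∀ x, δ ≤ ‖x‖ → ‖g x‖ ≤ M) (hC : C ≠ ⊤) (hC0 : C ≠ 0)
    (H : ∀ ψ, IsTestFunction Ω ψ → ∫⁻ x in {x | ψ x ≠ 0}, ‖g x‖ₑ ^ p ≤
      C * ∫⁻ x in {x | ψ x ≠ 0}, ‖g x + gradient ψ x‖ₑ ^ p)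
    (hφ : MemSobolevZero p Ω φ h) :
    ∫⁻ x in {x | x ∈ Ω ∧ φ x ≠ 0}, ‖g x‖ₑ ^ p ≤
      C * ∫⁻ x in {x | x ∈ Ω ∧ φ x ≠ 0}, ‖g x + h x‖ₑ ^ p := by
  obtain ⟨-, hφL, hhL, ψ, hψ, hψφ, hψh⟩ := hφ
  have hp0 : 0 < p := by linarith
  have hpne : ENNReal.ofReal p ≠ 0 := by simpa using hp0
  have hpr : (ENNReal.ofReal p).toReal = p := ENNReal.toReal_ofReal hp0.le
  have hΩm := hΩo.measurableSet
  set φ' := hφL.1.mk φ with hφ'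
  set h' := hhL.1.mk h with hh'
  have hφ'm : Measurable φ' := hφL.1.stronglyMeasurable_mk.measurable
  have hh'm : Measurable h' := hhL.1.stronglyMeasurable_mk.measurable
  have hφae : φ =ᵐ[volume.restrict Ω] φ' := hφL.1.ae_eq_mk
  have hhae : h =ᵐ[volume.restrict Ω] h' := hhL.1.ae_eq_mk
  have hh'L : MemLp h' (ENNReal.ofReal p) (volume.restrict Ω) := (memLp_congr_ae hhae).1 hhL
  have hhp : ∫⁻ x in Ω, ‖h' x‖ₑ ^ p ≠ ⊤ := by
    have := lintegral_rpow_enorm_lt_top_of_eLpNorm_lt_top hpne ENNReal.ofReal_ne_top hh'L.2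
    rw [hpr] at this
    exact this.ne
  -- almost everywhere convergence along a subsequence
  have hψm : ∀ k, AEStronglyMeasurable (ψ k) (volume.restrict Ω) := fun k =>
    (hψ k).1.continuous.aestronglyMeasurable
  have hmeas : TendstoInMeasure (volume.restrict Ω) ψ atTop φ := by
    refine tendstoInMeasure_of_tendsto_eLpNorm hpne hψm hφL.1 ?_
    refine hψφ.congr fun k => ?_
    exact eLpNorm_sub_comm φ (ψ k) _ _
  obtain ⟨ns, hns, hae⟩ := hmeas.exists_seq_tendsto_ae
  have hgrad : Tendsto (fun k => ∫⁻ x in Ω, ‖gradient (ψ (ns k)) x - h' x‖ₑ ^ p) atTop (𝓝 0) := by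
    have h1 := (ENNReal.continuous_rpow_const (y := p)).tendsto 0 |>.comp
      (hψh.comp hns.tendsto_atTop)
    rw [ENNReal.zero_rpow_of_pos hp0] at h1
    refine h1.congr fun k => ?_
    simp only [Function.comp]
    rw [eLpNorm_eq_lintegral_rpow_enorm_toReal hpne ENNReal.ofReal_ne_top, hpr, ← ENNReal.rpow_mul,
      one_div_mul_cancel hp0.ne', ENNReal.rpow_one]
    refine lintegral_congr_ae ?_
    filter_upwards [hhae] with x hx
    rw [hx, ← enorm_neg, neg_sub]
  have key := setLIntegral_le_of_tendsto hn hβ hβp hp hΩ hΩo hg hgb hC hC0 H hφ'm hh'm hhp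
    (fun k => hψ (ns k)) (by filter_upwards [hae, hφae] with x hx hx2; rwa [← hx2]) hgrad
  have hSm : MeasurableSet {x | φ' x ≠ 0} := hφ'm (measurableSet_singleton 0).compl
  have hset : ({x | x ∈ Ω ∧ φ x ≠ 0} : Set (EuclideanSpace ℝ (Fin n))) =ᵐ[volume]
      ({x | φ' x ≠ 0} ∩ Ω : Set (EuclideanSpace ℝ (Fin n))) := by
    have h1 := (ae_restrict_iff' hΩm).1 hφae
    filter_upwards [h1] with x hx
    apply propext
    constructor
    · rintro ⟨hxΩ, hx0⟩
      exact ⟨by rwa [mem_ofPred_eq, ← hx hxΩ], hxΩ⟩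
    · rintro ⟨hx0, hxΩ⟩
      exact ⟨hxΩ, by rwa [hx hxΩ]⟩
  have hrestr : (volume : Measure (EuclideanSpace ℝ (Fin n))).restrict {x | x ∈ Ω ∧ φ x ≠ 0} =
      (volume.restrict Ω).restrict {x | φ' x ≠ 0} := by
    rw [Measure.restrict_congr_set hset, Measure.restrict_restrict hSm]
  rw [hrestr]
  refine key.trans_eq ?_
  congr 1
  refine lintegral_congr_ae (ae_restrict_of_ae ?_)
  filter_upwards [hhae] with x hx
  rw [hx]

/-! ### Weak gradients of classical functions -/

/-- Integration by parts, for test functions whose support lies in the set where `u` is `C^1`. -/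
lemma hasWeakGradient_of_hasGradientAt {n : ℕ} {Ω : Set (EuclideanSpace ℝ (Fin n))}
    (hΩo : IsOpen Ω) {u : EuclideanSpace ℝ (Fin n) → ℝ}
    {g : EuclideanSpace ℝ (Fin n) → EuclideanSpace ℝ (Fin n)}
    (hu : ∀ x ∈ Ω, HasGradientAt u (g x) x) (hg : ContinuousOn g Ω) : HasWeakGradient Ω u g := by
  have huc : ContinuousOn u Ω := HasGradientAt.continuousOn hu
  refine ⟨huc.locallyIntegrableOn hΩo.measurableSet, hg.locallyIntegrableOn hΩo.measurableSet, ?_⟩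
  rintro φ ⟨hφs, hφc, hφΩ⟩
  have hφ0 : ∀ x, x ∉ Ω → φ x = 0 := fun x hx =>
    image_eq_zero_of_notMem_tsupport fun h => hx (hφΩ h)
  have hgφ0 : ∀ x, x ∉ tsupport φ → gradient φ x = 0 := fun x hx => by
    have h1 : φ =ᶠ[𝓝 x] fun _ => 0 := notMem_tsupport_iff_eventuallyEq.1 hx
    rw [h1.gradient_eq, gradient_fun_const]
  have hgφc : Continuous (gradient φ) := continuous_gradient hφs
  have hAts : tsupport (fun x => u x • gradient φ x) ⊆ tsupport φ := by
    refine closure_minimal (fun x hx => ?_) (isClosed_tsupport φ)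
    by_contra h
    exact hx (by simp [hgφ0 x h])
  have hBts : tsupport (fun x => φ x • g x) ⊆ tsupport φ :=
    closure_mono fun x hx h0 => hx (by simp [h0])
  have hUts : tsupport (fun x => φ x * u x) ⊆ tsupport φ :=
    closure_mono fun x hx h0 => hx (by simp [h0])
  have hAc : Continuous (fun x => u x • gradient φ x) :=
    ContinuousOn.continuous_of_tsupport_subset (huc.smul hgφc.continuousOn) hΩo (hAts.trans hφΩ)
  have hBc : Continuous (fun x => φ x • g x) :=
    ContinuousOn.continuous_of_tsupport_subset (hφs.continuous.continuousOn.smul hg) hΩo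
      (hBts.trans hφΩ)
  have hUc : Continuous (fun x => φ x * u x) :=
    ContinuousOn.continuous_of_tsupport_subset (hφs.continuous.continuousOn.mul huc) hΩo
      (hUts.trans hφΩ)
  have hAi : Integrable (fun x => u x • gradient φ x) :=
    hAc.integrable_of_hasCompactSupport (hφc.of_isClosed_subset (isClosed_tsupport _) hAts)
  have hBi : Integrable (fun x => φ x • g x) :=
    hBc.integrable_of_hasCompactSupport (hφc.of_isClosed_subset (isClosed_tsupport _) hBts)
  have hUi : Integrable (fun x => φ x * u x) :=
    hUc.integrable_of_hasCompactSupport (hφc.of_isClosed_subset (isClosed_tsupport _) hUts)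
  rw [setIntegral_eq_integral_of_forall_compl_eq_zero (fun x hx => by
      rw [hgφ0 x fun h => hx (hφΩ h), smul_zero]),
    setIntegral_eq_integral_of_forall_compl_eq_zero (fun x hx => by rw [hφ0 x hx, zero_smul])]
  refine ext_inner_left ℝ fun v => ?_
  rw [inner_neg_right, ← integral_inner hAi, ← integral_inner hBi]
  have e1 : ∀ x, inner ℝ v (u x • gradient φ x) = fderiv ℝ φ x v * u x := fun x => by
    rw [inner_smul_right, real_inner_comm, inner_gradient_left, mul_comm]
  have e2 : ∀ x, inner ℝ v (φ x • g x) = φ x * fderiv ℝ u x v := fun x => by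
    by_cases hx : x ∈ Ω
    · rw [inner_smul_right, real_inner_comm, (hu x hx).fderiv_apply]
    · rw [hφ0 x hx, zero_smul, inner_zero_right, zero_mul]
  have hI := integral_mul_fderiv_eq_neg_fderiv_mul_of_integrable (μ := volume) (f := φ) (g := u)
    (v := v) (by simpa only [e1] using hAi.const_inner (𝕜 := ℝ) v)
    (by simpa only [e2] using hBi.const_inner (𝕜 := ℝ) v) hUi
    (fun x _ => hφs.differentiable (by simp) x)
    (fun x hx => (hu x (hφΩ hx)).differentiableAt)
  simp only [e1, e2]
  rw [hI, neg_neg]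

lemma memLp_of_continuousOn_isCompact {n : ℕ} {E : Type*} [NormedAddCommGroup E]
    [SecondCountableTopology E] {K : Set (EuclideanSpace ℝ (Fin n))} (hK : IsCompact K)
    {f : EuclideanSpace ℝ (Fin n) → E} (hf : ContinuousOn f K) (q : ℝ≥0∞) :
    MemLp f q (volume.restrict K) := by
  have : IsFiniteMeasure ((volume : Measure (EuclideanSpace ℝ (Fin n))).restrict K) :=
    ⟨by rw [Measure.restrict_apply_univ]; exact hK.measure_lt_top⟩
  obtain ⟨M, hM⟩ := hK.exists_bound_of_continuousOn hf
  exact MemLp.of_bound (hf.aestronglyMeasurable hK.measurableSet) M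
    ((ae_restrict_mem hK.measurableSet).mono hM)

lemma memSobolevLoc_of_hasGradientAt {n : ℕ} {p : ℝ} {Ω : Set (EuclideanSpace ℝ (Fin n))}
    (hΩo : IsOpen Ω) {u : EuclideanSpace ℝ (Fin n) → ℝ}
    {g : EuclideanSpace ℝ (Fin n) → EuclideanSpace ℝ (Fin n)}
    (hu : ∀ x ∈ Ω, HasGradientAt u (g x) x) (hg : ContinuousOn g Ω) : MemSobolevLoc p Ω u g :=
  ⟨hasWeakGradient_of_hasGradientAt hΩo hu hg, fun _ hK hKΩ =>
    ⟨memLp_of_continuousOn_isCompact hK ((HasGradientAt.continuousOn hu).mono hKΩ) _,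
      memLp_of_continuousOn_isCompact hK (hg.mono hKΩ) _⟩⟩

/-! ### Powers are quasiminimizers -/

lemma norm_rpow_rpow {n : ℕ} {α β γ : ℝ} (hγ : γ = α * β) (x : EuclideanSpace ℝ (Fin n)) :
    (‖x‖ ^ (-β)) ^ α = ‖x‖ ^ (-γ) := by
  rw [← Real.rpow_mul (norm_nonneg x), hγ]; congr 1; ring

lemma hasGradientAt_power {n : ℕ} {α β γ : ℝ} (hγ : γ = α * β)
    {x : EuclideanSpace ℝ (Fin n)} (hx : x ≠ 0) :
    HasGradientAt (fun x => ‖x‖ ^ (-γ)) (radialGradient β (fun t => α * t ^ (α - 1)) x) x := by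
  have hx0 : 0 < ‖x‖ := norm_pos_iff.2 hx
  have h1 := hasGradientAt_comp_norm_rpow (β := β) (H := fun t => t ^ α)
    (w := fun t => α * t ^ (α - 1)) hx
    (Real.hasDerivAt_rpow_const (Or.inl (Real.rpow_pos_of_pos hx0 _).ne'))
  simpa only [norm_rpow_rpow hγ] using h1

lemma continuousOn_radialGradient {n : ℕ} {β : ℝ} {w : ℝ → ℝ} (hw : ContinuousOn w (Ioi 0)) :
    ContinuousOn (radialGradient β w) ({0}ᶜ : Set (EuclideanSpace ℝ (Fin n))) := by
  have hN : ∀ r : ℝ, ContinuousOn (fun x : EuclideanSpace ℝ (Fin n) => ‖x‖ ^ r) {0}ᶜ := fun r =>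
    continuous_norm.continuousOn.rpow_const fun x hx => Or.inl (norm_ne_zero_iff.2 hx)
  have h1 : ContinuousOn (fun x : EuclideanSpace ℝ (Fin n) => w (‖x‖ ^ (-β))) {0}ᶜ :=
    hw.comp (hN _) fun x hx => Real.rpow_pos_of_pos (norm_pos_iff.2 hx) _
  exact (((continuousOn_const.mul h1).mul (hN _)).neg).smul continuousOn_id

lemma continuousOn_rpow_deriv (α : ℝ) : ContinuousOn (fun t : ℝ => α * t ^ (α - 1)) (Ioi 0) :=
  continuousOn_const.mul (continuousOn_id.rpow_const fun _ hx => Or.inl (ne_of_gt hx))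

lemma exists_norm_radialGradient_le {n : ℕ} {α β : ℝ} (hα : 1 ≤ α) (hβ : 0 < β) {δ : ℝ}
    (hδ : 0 < δ) : ∃ M, ∀ x : EuclideanSpace ℝ (Fin n), δ ≤ ‖x‖ →
      ‖radialGradient β (fun t => α * t ^ (α - 1)) x‖ ≤ M := by
  refine ⟨β * α * (δ ^ (-β)) ^ (α - 1) * δ ^ (-β - 1), fun x hx => ?_⟩
  have hx0 : 0 < ‖x‖ := hδ.trans_le hx
  have e : ‖radialGradient β (fun t => α * t ^ (α - 1)) x‖ =
      β * α * (‖x‖ ^ (-β)) ^ (α - 1) * ‖x‖ ^ (-β - 1) := by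
    have h1 : ‖x‖ ^ (-β - 2) * ‖x‖ = ‖x‖ ^ (-β - 1) := by
      rw [← Real.rpow_add_one hx0.ne']; congr 1; ring
    rw [radialGradient, norm_smul, norm_neg, Real.norm_of_nonneg (by positivity), mul_assoc, h1]
    ring
  rw [e]
  have h1 : ‖x‖ ^ (-β) ≤ δ ^ (-β) := Real.rpow_le_rpow_of_nonpos hδ hx (by linarith)
  have h2 : ‖x‖ ^ (-β - 1) ≤ δ ^ (-β - 1) := Real.rpow_le_rpow_of_nonpos hδ hx (by linarith)
  have h3 : (‖x‖ ^ (-β)) ^ (α - 1) ≤ (δ ^ (-β)) ^ (α - 1) :=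
    Real.rpow_le_rpow (by positivity) h1 (by linarith)
  gcongr

/-- Multiples of `|x| ^ (-γ)`, up to constants, are `Q`-quasiminimizers in open subsets of the
punctured ball. -/
lemma isQuasiminimizer_of_hasGradientAt {n : ℕ} (hn : 0 < n) {p α β Q : ℝ} (hp : 1 < p)
    (hα : 1 ≤ α) (hβ : 0 < β) (hβp : n + β = (β + 1) * p) (hQ : Q = α ^ p / (1 + p * (α - 1)))
    {Ω : Set (EuclideanSpace ℝ (Fin n))} (hΩ : Ω ⊆ ball 0 1 \ {0}) (hΩo : IsOpen Ω)
    {ε : ℝ} (hε : 0 < ε) {u : EuclideanSpace ℝ (Fin n) → ℝ}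
    (hu : ∀ x ∈ Ω, HasGradientAt u (ε • radialGradient β (fun t => α * t ^ (α - 1)) x) x) :
    IsQuasiminimizer p Q Ω u := by
  have hp0 : 0 < p := by linarith
  set G : EuclideanSpace ℝ (Fin n) → EuclideanSpace ℝ (Fin n) :=
    radialGradient β (fun t => α * t ^ (α - 1)) with hG
  have hGm : Measurable G := measurable_radialGradient (by fun_prop)
  have hΩ0 : Ω ⊆ {0}ᶜ := fun x hx => (hΩ hx).2
  have hQ0 : 0 < Q := by
    rw [hQ]
    have : 0 < α := by linarith
    have : 0 < 1 + p * (α - 1) := by nlinarith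
    positivity
  refine ⟨fun x => ε • G x, memSobolevLoc_of_hasGradientAt hΩo hu
    (((continuousOn_radialGradient (continuousOn_rpow_deriv α)).mono hΩ0).const_smul ε), ?_⟩
  intro φ h hφ
  refine setLIntegral_le_of_memSobolevZero hn hβ hβp hp hΩ hΩo (hGm.const_smul ε) ?_
    ENNReal.ofReal_ne_top (by simpa using hQ0) ?_ hφ
  · intro δ hδ
    obtain ⟨M, hM⟩ := exists_norm_radialGradient_le (n := n) hα hβ hδ
    refine ⟨ε * M, fun x hx => ?_⟩
    rw [norm_smul, Real.norm_of_nonneg hε.le]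
    exact mul_le_mul_of_nonneg_left (hM x hx) hε.le
  · rintro ψ ⟨hψ1, hψ2, hψ3⟩
    have hts : tsupport (fun x => ε⁻¹ * ψ x) ⊆ tsupport ψ :=
      closure_mono fun x hx h0 => hx (by simp [h0])
    have htest : IsTestFunction {0}ᶜ (fun x => ε⁻¹ * ψ x) :=
      ⟨contDiff_const.mul hψ1, hψ2.of_isClosed_subset (isClosed_tsupport _) hts,
        hts.trans (hψ3.trans hΩ0)⟩
    have hgr : ∀ x, gradient (fun x => ε⁻¹ * ψ x) x = ε⁻¹ • gradient ψ x := fun x => by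
      refine HasGradientAt.gradient ?_
      have := (hψ1.differentiable (by simp) x).hasFDerivAt.const_mul ε⁻¹
      rw [hasGradientAt_iff_hasFDerivAt, map_smul, toDual_gradient]
      exact this
    have key := setLIntegral_radialGradient_le hn hp hα hβ hβp hQ htest
    have hset : {x | ε⁻¹ * ψ x ≠ 0} = {x | ψ x ≠ 0} := by
      ext x; simp [hε.ne']
    simp only [hgr] at key
    rw [hset] at key
    have e1 : ∀ x, ‖ε • G x‖ₑ ^ p = ENNReal.ofReal ε ^ p * ‖G x‖ₑ ^ p := fun x => by
      rw [enorm_smul, ENNReal.mul_rpow_of_nonneg _ _ hp0.le, Real.enorm_of_nonneg hε.le]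
    have e2 : ∀ x, ‖ε • G x + gradient ψ x‖ₑ ^ p =
        ENNReal.ofReal ε ^ p * ‖G x + ε⁻¹ • gradient ψ x‖ₑ ^ p := fun x => by
      rw [← Real.enorm_of_nonneg hε.le, ← ENNReal.mul_rpow_of_nonneg _ _ hp0.le, ← enorm_smul,
        smul_add, smul_inv_smul₀ hε.ne']
    simp only [e1, e2]
    rw [lintegral_const_mul' _ _ (by finiteness), lintegral_const_mul' _ _ (by finiteness),
      mul_left_comm]
    exact mul_le_mul_right key _

/-! ### Bounded limits of test functions -/

lemma tendsto_eLpNorm_of_norm_le {n : ℕ} {E : Type*} [NormedAddCommGroup E] {p M : ℝ} (hp : 0 < p)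
    {Ω : Set (EuclideanSpace ℝ (Fin n))} (hΩm : MeasurableSet Ω) (hΩ : volume Ω ≠ ⊤)
    {f : ℕ → EuclideanSpace ℝ (Fin n) → E} {g : EuclideanSpace ℝ (Fin n) → E}
    (hf : ∀ k, AEStronglyMeasurable (f k) (volume.restrict Ω))
    (hg : AEStronglyMeasurable g (volume.restrict Ω))
    (hfM : ∀ k, ∀ x ∈ Ω, ‖f k x‖ ≤ M) (hgM : ∀ x ∈ Ω, ‖g x‖ ≤ M)
    (hlim : ∀ x ∈ Ω, Tendsto (fun k => f k x) atTop (𝓝 (g x))) :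
    Tendsto (fun k => eLpNorm (fun x => g x - f k x) (ENNReal.ofReal p) (volume.restrict Ω))
      atTop (𝓝 0) := by
  have hpne : ENNReal.ofReal p ≠ 0 := by simpa using hp
  have hpr : (ENNReal.ofReal p).toReal = p := ENNReal.toReal_ofReal hp.le
  have h1 : Tendsto (fun k => ∫⁻ x in Ω, ‖g x - f k x‖ₑ ^ p) atTop
      (𝓝 (∫⁻ _ in Ω, 0)) := by
    refine tendsto_lintegral_of_dominated_convergence' (fun _ => ENNReal.ofReal (M + M) ^ p)
      (fun k => ((hg.sub (hf k)).enorm.pow_const p)) (fun k => ?_) ?_ ?_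
    · filter_upwards [ae_restrict_mem hΩm] with x hx
      refine ENNReal.rpow_le_rpow (enorm_le_ofReal ?_) hp.le
      exact (norm_sub_le _ _).trans (add_le_add (hgM x hx) (hfM k x hx))
    · rw [setLIntegral_const]
      exact ENNReal.mul_ne_top (by finiteness) hΩ
    · filter_upwards [ae_restrict_mem hΩm] with x hx
      have h2 : Tendsto (fun k => g x - f k x) atTop (𝓝 0) := by
        simpa using (hlim x hx).const_sub (g x)
      have h3 := (ENNReal.continuous_rpow_const (y := p)).tendsto _ |>.comp h2.enorm
      simpa [Function.comp_def, ENNReal.zero_rpow_of_pos hp] using h3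
  rw [lintegral_zero] at h1
  have h4 := (ENNReal.continuous_rpow_const (y := 1 / p)).tendsto 0 |>.comp h1
  rw [ENNReal.zero_rpow_of_pos (by positivity)] at h4
  refine h4.congr fun k => ?_
  rw [eLpNorm_eq_lintegral_rpow_enorm_toReal hpne ENNReal.ofReal_ne_top, hpr]
  rfl

/-- Pointwise limits of test functions in a set of finite measure, with uniform bounds for the
functions and their gradients, belong to `W^{1,p}_0(Ω)`. -/
lemma memSobolevZero_of_tendsto {n : ℕ} {p M : ℝ} (hp : 1 < p)
    {Ω : Set (EuclideanSpace ℝ (Fin n))} (hΩo : IsOpen Ω) (hΩ : volume Ω ≠ ⊤)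
    {ψ : ℕ → EuclideanSpace ℝ (Fin n) → ℝ} {u : EuclideanSpace ℝ (Fin n) → ℝ}
    {g : EuclideanSpace ℝ (Fin n) → EuclideanSpace ℝ (Fin n)}
    (hψ : ∀ k, IsTestFunction Ω (ψ k)) (hψM : ∀ k, ∀ x ∈ Ω, ‖ψ k x‖ ≤ M)
    (hψM' : ∀ k, ∀ x ∈ Ω, ‖gradient (ψ k) x‖ ≤ M)
    (hu : ∀ x ∈ Ω, Tendsto (fun k => ψ k x) atTop (𝓝 (u x)))
    (hg : ∀ x ∈ Ω, Tendsto (fun k => gradient (ψ k) x) atTop (𝓝 (g x))) :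
    MemSobolevZero p Ω u g := by
  have hp0 : 0 < p := by linarith
  have hΩm := hΩo.measurableSet
  have : IsFiniteMeasure ((volume : Measure (EuclideanSpace ℝ (Fin n))).restrict Ω) :=
    ⟨by rw [Measure.restrict_apply_univ]; exact hΩ.lt_top⟩
  have hψm : ∀ k, AEStronglyMeasurable (ψ k) (volume.restrict Ω) := fun k =>
    (hψ k).1.continuous.aestronglyMeasurable
  have hψm' : ∀ k, AEStronglyMeasurable (gradient (ψ k)) (volume.restrict Ω) := fun k =>
    (continuous_gradient (hψ k).1).aestronglyMeasurable
  have hum : AEStronglyMeasurable u (volume.restrict Ω) :=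
    aestronglyMeasurable_of_tendsto_ae atTop hψm ((ae_restrict_mem hΩm).mono hu)
  have hgm : AEStronglyMeasurable g (volume.restrict Ω) :=
    aestronglyMeasurable_of_tendsto_ae atTop hψm' ((ae_restrict_mem hΩm).mono hg)
  have huM : ∀ x ∈ Ω, ‖u x‖ ≤ M := fun x hx =>
    le_of_tendsto (hu x hx).norm (Eventually.of_forall fun k => hψM k x hx)
  have hgM : ∀ x ∈ Ω, ‖g x‖ ≤ M := fun x hx =>
    le_of_tendsto (hg x hx).norm (Eventually.of_forall fun k => hψM' k x hx)
  have hupL : ∀ q, MemLp u q (volume.restrict Ω) := fun q =>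
    MemLp.of_bound hum M ((ae_restrict_mem hΩm).mono huM)
  have hgpL : ∀ q, MemLp g q (volume.restrict Ω) := fun q =>
    MemLp.of_bound hgm M ((ae_restrict_mem hΩm).mono hgM)
  refine ⟨⟨IntegrableOn.locallyIntegrableOn (memLp_one_iff_integrable.1 (hupL 1)),
    IntegrableOn.locallyIntegrableOn (memLp_one_iff_integrable.1 (hgpL 1)), ?_⟩,
    hupL _, hgpL _, ψ, hψ, tendsto_eLpNorm_of_norm_le hp0 hΩm hΩ hψm hum hψM huM hu,
    tendsto_eLpNorm_of_norm_le hp0 hΩm hΩ hψm' hgm hψM' hgM hg⟩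
  rintro φ ⟨hφs, hφc, hφΩ⟩
  have hgφc : Continuous (gradient φ) := continuous_gradient hφs
  have hφi : Integrable φ := hφs.continuous.integrable_of_hasCompactSupport hφc
  have hgφi : Integrable (gradient φ) := by
    refine hgφc.integrable_of_hasCompactSupport (hφc.of_isClosed_subset (isClosed_tsupport _) ?_)
    refine closure_minimal (fun x hx => ?_) (isClosed_tsupport φ)
    by_contra h
    refine hx ?_
    have h1 : φ =ᶠ[𝓝 x] fun _ => 0 := notMem_tsupport_iff_eventuallyEq.1 h
    rw [h1.gradient_eq, gradient_fun_const]
  have e : ∀ k, ∫ x in Ω, ψ k x • gradient φ x = -∫ x in Ω, φ x • gradient (ψ k) x := fun k =>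
    (hasWeakGradient_of_hasGradientAt hΩo
      (fun x _ => ((hψ k).1.differentiable (by simp) x).hasGradientAt)
      (continuous_gradient (hψ k).1).continuousOn).2.2 φ ⟨hφs, hφc, hφΩ⟩
  have l1 : Tendsto (fun k => ∫ x in Ω, ψ k x • gradient φ x) atTop
      (𝓝 (∫ x in Ω, u x • gradient φ x)) := by
    refine tendsto_integral_of_dominated_convergence (fun x => M * ‖gradient φ x‖)
      (fun k => (hψm k).smul hgφc.aestronglyMeasurable) (hgφi.norm.const_mul M).integrableOn
      (fun k => ?_) ?_
    · filter_upwards [ae_restrict_mem hΩm] with x hx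
      rw [norm_smul]
      exact mul_le_mul_of_nonneg_right (hψM k x hx) (norm_nonneg _)
    · filter_upwards [ae_restrict_mem hΩm] with x hx using (hu x hx).smul_const _
  have l2 : Tendsto (fun k => ∫ x in Ω, φ x • gradient (ψ k) x) atTop
      (𝓝 (∫ x in Ω, φ x • g x)) := by
    refine tendsto_integral_of_dominated_convergence (fun x => M * ‖φ x‖)
      (fun k => hφs.continuous.aestronglyMeasurable.smul (hψm' k))
      (hφi.norm.const_mul M).integrableOn (fun k => ?_) ?_
    · filter_upwards [ae_restrict_mem hΩm] with x hx
      rw [norm_smul, mul_comm]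
      exact mul_le_mul_of_nonneg_right (hψM' k x hx) (norm_nonneg _)
    · filter_upwards [ae_restrict_mem hΩm] with x hx using (hg x hx).const_smul _
  exact tendsto_nhds_unique l1 (l2.neg.congr fun k => (e k).symm)

/-! ### Radial functions in the Sobolev space -/

/-- If `|w| ≤ M` and `w` vanishes on `[b, ∞)`, then the gradient of the radial primitive of `w` is
bounded in terms of `M` and `b`, since it vanishes near the origin. -/
lemma norm_radialGradient_le {n : ℕ} {β M b : ℝ} (hβ : 0 < β) (hb : 0 < b) {w : ℝ → ℝ}
    (hw : Function.support w ⊆ Iio b) (hwM : ∀ t, |w t| ≤ M) (x : EuclideanSpace ℝ (Fin n)) :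
    ‖radialGradient β w x‖ ≤ β * M * (b ^ (-β⁻¹)) ^ (-β - 1) := by
  have hM : 0 ≤ M := (abs_nonneg _).trans (hwM 0)
  by_cases hx : x = 0
  · rw [hx, radialGradient_zero, norm_zero]; positivity
  have hx0 : 0 < ‖x‖ := norm_pos_iff.2 hx
  by_cases hwx : w (‖x‖ ^ (-β)) = 0
  · simp only [radialGradient, hwx, mul_zero, zero_mul, neg_zero, zero_smul, norm_zero]
    positivity
  have h1 : b ^ (-β⁻¹) ≤ ‖x‖ := by
    rw [← norm_rpow_le_iff hx hβ (by positivity), rpow_neg_inv_rpow_neg hβ.ne' hb]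
    exact (hw hwx).le
  have h2 : ‖x‖ ^ (-β - 2) * ‖x‖ = ‖x‖ ^ (-β - 1) := by
    rw [← Real.rpow_add_one hx0.ne']; congr 1; ring
  have h3 : ‖x‖ ^ (-β - 1) ≤ (b ^ (-β⁻¹)) ^ (-β - 1) :=
    Real.rpow_le_rpow_of_nonpos (by positivity) h1 (by linarith)
  rw [radialGradient, norm_smul, norm_neg, norm_mul, norm_mul, Real.norm_of_nonneg hβ.le,
    Real.norm_of_nonneg (Real.rpow_nonneg hx0.le _), mul_assoc, h2]
  exact mul_le_mul (mul_le_mul_of_nonneg_left (hwM _) hβ.le) h3 (by positivity) (by positivity)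

lemma memSobolevZero_radialPrimitive {n : ℕ} {p β M b : ℝ} (hp : 1 < p) (hβ : 0 < β) (hb : 0 < b)
    {Ω : Set (EuclideanSpace ℝ (Fin n))} (hΩo : IsOpen Ω) (hΩ : volume Ω ≠ ⊤)
    {v : ℕ → ℝ → ℝ} {w : ℝ → ℝ} (hv : ∀ k, ContDiff ℝ ∞ (v k))
    (hvb : ∀ k, Function.support (v k) ⊆ Ioo 0 b) (hvM : ∀ k t, |v k t| ≤ M)
    (hlim : ∀ t, Tendsto (fun k => v k t) atTop (𝓝 (w t)))
    (hψ : ∀ k, IsTestFunction Ω (radialPrimitive β (v k))) {u : EuclideanSpace ℝ (Fin n) → ℝ}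
    (hu : ∀ x ∈ Ω, u x = radialPrimitive β w x) : MemSobolevZero p Ω u (radialGradient β w) := by
  have hgr : ∀ k x, gradient (radialPrimitive β (v k) : EuclideanSpace ℝ (Fin n) → ℝ) x =
      radialGradient β (v k) x := fun k x =>
    (hasGradientAt_radialPrimitive hβ (hv k).continuous (hvb k) le_rfl x).gradient
  set F : ℝ → ℝ := (Ioo 0 b).indicator fun _ => M with hF
  have hFi : Integrable F := by
    rw [hF, integrable_indicator_iff measurableSet_Ioo]
    exact integrableOn_const (by simp)
  have hvF : ∀ k t, ‖v k t‖ ≤ F t := fun k t => by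
    by_cases ht : t ∈ Ioo 0 b
    · rw [hF, indicator_of_mem ht]; exact hvM k t
    · rw [hF, indicator_of_notMem ht, Function.notMem_support.1 fun h => ht (hvb k h), norm_zero]
  have hFint : ∫ t, F t = M * b := by
    rw [hF, integral_indicator measurableSet_Ioo]
    simp [measureReal_def, hb.le, mul_comm]
  have hbd : ∀ k (x : EuclideanSpace ℝ (Fin n)), ‖radialPrimitive β (v k) x‖ ≤ M * b := by
    intro k x
    rw [← hFint]
    have hF0 : ∀ t, 0 ≤ F t := fun t => (norm_nonneg _).trans (hvF k t)
    by_cases hx : x = 0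
    · rw [hx, radialPrimitive_zero]
      exact norm_integral_le_of_norm_le hFi (Eventually.of_forall (hvF k))
    · rw [radialPrimitive_of_ne hx,
        intervalIntegral.integral_of_le (Real.rpow_nonneg (norm_nonneg x) _)]
      exact (norm_integral_le_of_norm_le hFi.integrableOn (Eventually.of_forall (hvF k))).trans
        (setIntegral_le_integral hFi (Eventually.of_forall hF0))
  refine memSobolevZero_of_tendsto (M := max (M * b) (β * M * (b ^ (-β⁻¹)) ^ (-β - 1))) hp hΩo hΩ
    hψ (fun k x _ => (hbd k x).trans (le_max_left _ _)) (fun k x _ => ?_) (fun x hxΩ => ?_)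
    (fun x _ => ?_)
  · rw [hgr]
    exact (norm_radialGradient_le hβ hb ((hvb k).trans fun t ht => ht.2) (hvM k) x).trans
      (le_max_right _ _)
  · rw [hu x hxΩ]
    by_cases hx : x = 0
    · simp only [hx, radialPrimitive_zero]
      exact tendsto_integral_of_dominated_convergence F
        (fun k => (hv k).continuous.aestronglyMeasurable) hFi
        (fun k => Eventually.of_forall (hvF k)) (Eventually.of_forall hlim)
    · simp only [radialPrimitive_of_ne hx]
      exact intervalIntegral.tendsto_integral_filter_of_dominated_convergence F
        (Eventually.of_forall fun k => (hv k).continuous.aestronglyMeasurable)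
        (Eventually.of_forall fun k => Eventually.of_forall fun t _ => hvF k t)
        hFi.intervalIntegrable (Eventually.of_forall fun t _ => hlim t)
  · simp only [hgr, radialGradient]
    exact ((((hlim _).const_mul β).mul_const _).neg).smul_const x

/-- Smooth approximations of the indicator function of an interval from inside. -/
lemma exists_tendsto_indicator {a b : ℝ} (hab : a < b) : ∃ f : ℕ → ℝ → ℝ,
    (∀ k, ContDiff ℝ ∞ (f k)) ∧ (∀ k t, 0 ≤ f k t) ∧ (∀ k t, f k t ≤ 1) ∧
    (∀ k, ∃ a', a < a' ∧ Function.support (f k) ⊆ Ioo a' b) ∧ (∀ k, 0 < ∫ t, f k t) ∧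
    (∀ t, Tendsto (fun k => f k t) atTop (𝓝 ((Ioo a b).indicator 1 t))) := by
  set c := (a + b) / 2 with hc
  set l := (b - a) / 2 with hl
  have hl0 : 0 < l := by rw [hl]; linarith
  have hk : ∀ k : ℕ, (0 : ℝ) < (k : ℝ) + 3 := fun k => by positivity
  let f : ∀ _ : ℕ, ContDiffBump c := fun k =>
    ⟨l * ((k + 1) / (k + 3)), l * ((k + 2) / (k + 3)), by positivity, by
      refine mul_lt_mul_of_pos_left ?_ hl0
      rw [div_lt_div_iff_of_pos_right (hk k)]; linarith⟩
  have hout : ∀ k : ℕ, l * ((k + 2) / (k + 3)) < l := fun k => by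
    refine mul_lt_of_lt_one_right hl0 ?_
    rw [div_lt_one (hk k)]; linarith
  have hsupp : ∀ k, Function.support (f k) ⊆ Ioo (c - l * ((k + 2) / (k + 3))) b := fun k => by
    rw [(f k).support_eq, Real.ball_eq_Ioo]
    refine Ioo_subset_Ioo_right ?_
    have : b = c + l := by rw [hc, hl]; ring
    rw [this]
    exact add_le_add_right (hout k).le _
  refine ⟨fun k => f k, fun k => (f k).contDiff, fun k t => (f k).nonneg' t,
    fun k t => (f k).le_one, fun k => ⟨_, ?_, hsupp k⟩, fun k => (f k).integral_pos, fun t => ?_⟩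
  · have : a = c - l := by rw [hc, hl]; ring
    rw [this]
    exact sub_lt_sub_left (hout k) _
  · by_cases ht : t ∈ Ioo a b
    · rw [indicator_of_mem ht]
      have h1 : dist t c < l := by
        rw [Real.dist_eq, abs_lt, hc, hl]
        constructor <;> linarith [ht.1, ht.2]
      have h2 : Tendsto (fun k : ℕ => l * (((k : ℝ) + 1) / (k + 3))) atTop (𝓝 l) := by
        have h3 : Tendsto (fun k : ℕ => (k : ℝ) + 3) atTop atTop :=
          tendsto_atTop_add_const_right _ _ tendsto_natCast_atTop_atTop
        have h4 : Tendsto (fun k : ℕ => 1 - 2 * ((k : ℝ) + 3)⁻¹) atTop (𝓝 (1 - 2 * 0)) :=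
          (h3.inv_tendsto_atTop.const_mul 2).const_sub 1
        have h5 : Tendsto (fun k : ℕ => l * (1 - 2 * ((k : ℝ) + 3)⁻¹)) atTop (𝓝 l) := by
          simpa using h4.const_mul l
        refine h5.congr fun k => ?_
        have := (hk k).ne'
        field_simp
        ring
      refine tendsto_const_nhds.congr' ?_
      filter_upwards [h2.eventually_const_lt h1] with k hk'
      exact ((f k).one_of_mem_closedBall (mem_closedBall.2 hk'.le)).symm
    · rw [indicator_of_notMem ht]
      refine tendsto_const_nhds.congr fun k => ?_
      refine (Function.notMem_support.1 fun h => ht ?_).symm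
      refine Ioo_subset_Ioo_left ?_ (hsupp k h)
      have : a = c - l := by rw [hc, hl]; ring
      rw [this]
      exact (sub_lt_sub_left (hout k) _).le

lemma contDiff_mul_of_support_subset {f w : ℝ → ℝ} {a b : ℝ} (ha : 0 < a) (hf : ContDiff ℝ ∞ f)
    (hfs : Function.support f ⊆ Ioo a b) (hw : ContDiffOn ℝ ∞ w (Ioi 0)) :
    ContDiff ℝ ∞ fun t => f t * w t := by
  rw [contDiff_iff_contDiffAt]
  intro t
  rcases lt_or_ge t a with ht | ht
  · refine (contDiffAt_const (c := (0 : ℝ))).congr_of_eventuallyEq ?_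
    filter_upwards [Iio_mem_nhds ht] with τ hτ
    rw [Function.notMem_support.1 fun h => (hfs h).1.not_gt hτ, zero_mul]
  · exact hf.contDiffAt.mul (hw.contDiffAt (Ioi_mem_nhds (ha.trans_le ht)))

/-- The radial primitive of a function on `(a, b)`, `1 ≤ a`, that is smooth up to the end points,
belongs to `W^{1,p}_0(B(0, 1))`: its derivative is cut off smoothly near `a` and `b`. -/
lemma memSobolevZero_ball {n : ℕ} {p β M a b : ℝ} (hp : 1 < p) (hβ : 0 < β) (ha : 1 ≤ a)
    (hab : a < b) {w : ℝ → ℝ} (hw : ContDiffOn ℝ ∞ w (Ioi 0)) (hwM : ∀ t ∈ Ioo a b, |w t| ≤ M)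
    {u : EuclideanSpace ℝ (Fin n) → ℝ}
    (hu : ∀ x ∈ ball 0 1, u x = radialPrimitive β ((Ioo a b).indicator w) x) :
    MemSobolevZero p (ball 0 1) u (radialGradient β ((Ioo a b).indicator w)) := by
  obtain ⟨f, hf, hf0, hf1, hfs, -, hflim⟩ := exists_tendsto_indicator hab
  have hM : 0 ≤ M := (abs_nonneg _).trans (hwM ((a + b) / 2)
    ⟨left_lt_add_div_two.2 hab, add_div_two_lt_right.2 hab⟩)
  have hsupp : ∀ k, Function.support (fun t => f k t * w t) ⊆ Function.support (f k) :=
    fun k t ht h => ht (by simp [h])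
  choose a' haa' hfa' using hfs
  have hfab : ∀ k, Function.support (f k) ⊆ Ioo a b := fun k =>
    (hfa' k).trans (Ioo_subset_Ioo_left (haa' k).le)
  have hsm : ∀ k, ContDiff ℝ ∞ fun t => f k t * w t := fun k =>
    contDiff_mul_of_support_subset (by linarith [haa' k]) (hf k) (hfa' k) hw
  refine memSobolevZero_radialPrimitive (b := b) (M := M) (v := fun k t => f k t * w t) hp hβ
    (by linarith) isOpen_ball measure_ball_lt_top.ne hsm ?_ ?_ ?_ ?_ hu
  · exact fun k => (hsupp k).trans ((hfab k).trans (Ioo_subset_Ioo_left (by linarith)))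
  · intro k t
    by_cases ht : t ∈ Ioo a b
    · rw [abs_mul, abs_of_nonneg (hf0 k t)]
      exact (mul_le_of_le_one_left (abs_nonneg _) (hf1 k t)).trans (hwM t ht)
    · rw [Function.notMem_support.1 fun h => ht (hfab k h), zero_mul, abs_zero]
      exact hM
  · intro t
    refine ((hflim t).mul_const (w t)).congr' (Eventually.of_forall fun _ => rfl) |>.trans_eq ?_
    by_cases ht : t ∈ Ioo a b <;> simp [ht]
  · refine fun k => isTestFunction_radialPrimitive hβ (hsm k) one_pos ?_
      ((hsupp k).trans (hfa' k))
    rw [Real.one_rpow]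
    exact ha.trans_lt (haa' k)

/-- If the integral of the derivative vanishes, the radial primitive belongs to `W^{1,p}_0` of the
punctured ball. The smooth approximations are corrected by constants so that their integrals vanish;
their primitives then vanish near the origin. -/
lemma memSobolevZero_punctured_ball {n : ℕ} {p β M a b m : ℝ} (hp : 1 < p) (hβ : 0 < β)
    (ha : 1 ≤ a) (hab : a < b) {w : ℝ → ℝ} (hw : ContDiffOn ℝ ∞ w (Ioi 0))
    (hwM : ∀ t ∈ Ioo a b, |w t| ≤ M) (hm : m * (b - a) = ∫ t in Ioo a b, w t) :
    MemSobolevZero p (ball (0 : EuclideanSpace ℝ (Fin n)) 1 \ {0})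
      (radialPrimitive β ((Ioo a b).indicator fun t => m - w t))
      (radialGradient β ((Ioo a b).indicator fun t => m - w t)) := by
  obtain ⟨f, hf, hf0, hf1, hfs, hfpos, hflim⟩ := exists_tendsto_indicator hab
  have hM : 0 ≤ M := (abs_nonneg _).trans (hwM ((a + b) / 2)
    ⟨left_lt_add_div_two.2 hab, add_div_two_lt_right.2 hab⟩)
  choose a' haa' hfa' using hfs
  have hfab : ∀ k, Function.support (f k) ⊆ Ioo a b := fun k =>
    (hfa' k).trans (Ioo_subset_Ioo_left (haa' k).le)
  have hf00 : ∀ k t, t ∉ Ioo a b → f k t = 0 := fun k t ht =>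
    Function.notMem_support.1 fun h => ht (hfab k h)
  have hsmw : ∀ k, ContDiff ℝ ∞ fun t => f k t * w t := fun k =>
    contDiff_mul_of_support_subset (by linarith [haa' k]) (hf k) (hfa' k) hw
  have hIi : ∀ c : ℝ, Integrable ((Ioo a b).indicator fun _ => c) := fun c => by
    rw [integrable_indicator_iff measurableSet_Ioo]
    exact integrableOn_const (by simp)
  have hfle : ∀ k t, ‖f k t‖ ≤ (Ioo a b).indicator (fun _ => (1 : ℝ)) t := fun k t => by
    by_cases ht : t ∈ Ioo a b
    · rw [indicator_of_mem ht, Real.norm_of_nonneg (hf0 k t)]; exact hf1 k t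
    · rw [indicator_of_notMem ht, hf00 k t ht, norm_zero]
  have hfwle : ∀ k t, ‖f k t * w t‖ ≤ f k t * M := fun k t => by
    by_cases ht : t ∈ Ioo a b
    · rw [norm_mul, Real.norm_of_nonneg (hf0 k t)]
      exact mul_le_mul_of_nonneg_left (hwM t ht) (hf0 k t)
    · rw [hf00 k t ht]; simp
  have hfi : ∀ k, Integrable (f k) := fun k =>
    (hIi 1).mono' (hf k).continuous.aestronglyMeasurable (Eventually.of_forall (hfle k))
  have hfwi : ∀ k, Integrable fun t => f k t * w t := fun k =>
    ((hfi k).mul_const M).mono' (hsmw k).continuous.aestronglyMeasurable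
      (Eventually.of_forall (hfwle k))
  set μ : ℕ → ℝ := fun k => (∫ t, f k t * w t) / ∫ t, f k t with hμ
  have hμM : ∀ k, |μ k| ≤ M := fun k => by
    rw [hμ, abs_div, abs_of_pos (hfpos k), div_le_iff₀ (hfpos k), mul_comm, ← integral_mul_const]
    exact norm_integral_le_of_norm_le ((hfi k).mul_const M) (Eventually.of_forall (hfwle k))
  have hflim' : Tendsto (fun k => ∫ t, f k t) atTop (𝓝 (b - a)) := by
    have h1 := tendsto_integral_of_dominated_convergence _
      (fun k => (hf k).continuous.aestronglyMeasurable) (hIi 1)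
      (fun k => Eventually.of_forall (hfle k)) (Eventually.of_forall hflim)
    rw [integral_indicator_one measurableSet_Ioo] at h1
    simpa [measureReal_def, hab.le] using h1
  have hfwlim : Tendsto (fun k => ∫ t, f k t * w t) atTop (𝓝 (m * (b - a))) := by
    rw [hm, ← integral_indicator measurableSet_Ioo]
    refine tendsto_integral_of_dominated_convergence
      (fun t => (Ioo a b).indicator (fun _ => (1 : ℝ)) t * M)
      (fun k => (hsmw k).continuous.aestronglyMeasurable) ((hIi 1).mul_const M)
      (fun k => Eventually.of_forall fun t => (hfwle k t).trans ?_)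
      (Eventually.of_forall fun t => ?_)
    · exact mul_le_mul_of_nonneg_right ((le_abs_self _).trans (hfle k t)) hM
    · refine ((hflim t).mul_const (w t)).trans_eq ?_
      by_cases ht : t ∈ Ioo a b <;> simp [ht]
  have hba : b - a ≠ 0 := (sub_pos.2 hab).ne'
  have hμlim : Tendsto μ atTop (𝓝 m) := by
    have := hfwlim.div hflim' hba
    rwa [mul_div_cancel_right₀ _ hba] at this
  have hsupp : ∀ k, Function.support (fun t => f k t * (μ k - w t)) ⊆ Function.support (f k) :=
    fun k t ht h => ht (by simp [h])
  have hsm : ∀ k, ContDiff ℝ ∞ fun t => f k t * (μ k - w t) := fun k =>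
    contDiff_mul_of_support_subset (by linarith [haa' k]) (hf k) (hfa' k) (contDiffOn_const.sub hw)
  refine memSobolevZero_radialPrimitive (b := b) (M := M + M)
    (v := fun k t => f k t * (μ k - w t)) hp hβ (by linarith)
    (isOpen_ball.sdiff isClosed_singleton)
    ((measure_mono sdiff_subset).trans_lt measure_ball_lt_top).ne hsm ?_ ?_ ?_ ?_
    fun _ _ => rfl
  · exact fun k => (hsupp k).trans ((hfab k).trans (Ioo_subset_Ioo_left (by linarith)))
  · intro k t
    by_cases ht : t ∈ Ioo a b
    · rw [abs_mul, abs_of_nonneg (hf0 k t)]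
      exact (mul_le_of_le_one_left (abs_nonneg _) (hf1 k t)).trans
        ((abs_sub _ _).trans (add_le_add (hμM k) (hwM t ht)))
    · rw [hf00 k t ht, zero_mul, abs_zero]
      positivity
  · intro t
    refine ((hflim t).mul (hμlim.sub_const (w t))).trans_eq ?_
    by_cases ht : t ∈ Ioo a b <;> simp [ht]
  · refine fun k => isTestFunction_radialPrimitive_punctured hβ (hsm k) one_pos ?_
      ((hsupp k).trans (hfa' k)) ?_
    · rw [Real.one_rpow]
      exact ha.trans_lt (haa' k)
    · have e : ∀ t, f k t * (μ k - w t) = f k t * μ k - f k t * w t := fun t => mul_sub _ _ _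
      simp only [e]
      rw [integral_sub ((hfi k).mul_const _) (hfwi k), integral_mul_const, hμ,
        mul_div_cancel₀ _ (hfpos k).ne', sub_self]

/-! ### The best constant -/

lemma integrableOn_smul_of_isTestFunction {n : ℕ} {Ω : Set (EuclideanSpace ℝ (Fin n))}
    {g : EuclideanSpace ℝ (Fin n) → EuclideanSpace ℝ (Fin n)} (hg : LocallyIntegrableOn g Ω)
    {φ : EuclideanSpace ℝ (Fin n) → ℝ} (hφ : IsTestFunction Ω φ) :
    IntegrableOn (fun x => φ x • g x) Ω := by
  have h1 : IntegrableOn (fun x => φ x • g x) (tsupport φ) :=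
    (hg.integrableOn_compact_subset hφ.2.2 hφ.2.1).continuousOn_smul
      hφ.1.continuous.continuousOn hφ.2.1
  rw [integrableOn_iff_integrable_of_support_subset] at h1
  · exact h1.integrableOn
  · exact fun x hx => subset_tsupport φ fun h => hx (by simp [h])

/-- The distributional gradient is unique, by the lemma of du Bois-Reymond. -/
lemma HasWeakGradient.ae_eq {n : ℕ} {Ω : Set (EuclideanSpace ℝ (Fin n))} (hΩ : IsOpen Ω)
    {u : EuclideanSpace ℝ (Fin n) → ℝ}
    {g g' : EuclideanSpace ℝ (Fin n) → EuclideanSpace ℝ (Fin n)} (h : HasWeakGradient Ω u g)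
    (h' : HasWeakGradient Ω u g') : ∀ᵐ x, x ∈ Ω → g x = g' x := by
  have key : ∀ᵐ x, x ∈ Ω → (g - g') x = 0 := by
    refine hΩ.ae_eq_zero_of_integral_contDiff_smul_eq_zero (h.2.1.sub h'.2.1)
      fun φ hφs hφc hφΩ => ?_
    have hφ : IsTestFunction Ω φ := ⟨hφs, hφc, hφΩ⟩
    have e := (h.2.2 φ hφ).symm.trans (h'.2.2 φ hφ)
    rw [← setIntegral_eq_integral_of_forall_compl_eq_zero (s := Ω) fun x hx => by
      rw [image_eq_zero_of_notMem_tsupport fun h => hx (hφΩ h), zero_smul]]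
    simp only [Pi.sub_apply, smul_sub]
    rw [integral_sub (integrableOn_smul_of_isTestFunction h.2.1 hφ)
      (integrableOn_smul_of_isTestFunction h'.2.1 hφ), neg_inj.1 e, sub_self]
  filter_upwards [key] with x hx hxΩ
  exact sub_eq_zero.1 (hx hxΩ)

lemma setIntegral_rpow_deriv {α s t : ℝ} (hα : 0 < α) (hst : s ≤ t) :
    ∫ x in Ioo s t, α * x ^ (α - 1) = t ^ α - s ^ α := by
  rw [← integral_Ioc_eq_integral_Ioo, ← intervalIntegral.integral_of_le hst,
    intervalIntegral.integral_const_mul, integral_rpow (Or.inl (by linarith)), sub_add_cancel]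
  field_simp

/-- The set where the competitor differs from the power is an annulus: the chord of `t ^ α` lies
above its graph. -/
lemma radialPrimitive_sub_ne_zero_iff {n : ℕ} {α β m s t : ℝ} (hα : 1 < α) (hs : 0 < s)
    (hst : s < t) (hm : m * (t - s) = t ^ α - s ^ α) {x : EuclideanSpace ℝ (Fin n)} (hx : x ≠ 0) :
    radialPrimitive β ((Ioo s t).indicator fun τ => m - α * τ ^ (α - 1)) x ≠ 0 ↔
      ‖x‖ ^ (-β) ∈ Ioo s t := by
  have hα0 : 0 < α := by linarith
  set τ := ‖x‖ ^ (-β) with hτ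
  have hτ0 : 0 ≤ τ := Real.rpow_nonneg (norm_nonneg x) _
  have hint : ∀ b, IntegrableOn (fun x : ℝ => α * x ^ (α - 1)) (Ioo s b) := fun b =>
    (((Real.continuous_rpow_const (by linarith)).const_mul α).continuousOn.integrableOn_Icc
      (a := s) (b := b)).mono_set Ioo_subset_Icc_self
  have hcalc : ∀ b, s ≤ b → ∫ x in Ioo s b, (m - α * x ^ (α - 1)) =
      m * (b - s) - (b ^ α - s ^ α) := fun b hb => by
    have hc : IntegrableOn (fun _ : ℝ => m) (Ioo s b) := integrableOn_const (by simp)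
    rw [integral_sub hc (hint b), setIntegral_rpow_deriv hα0 hb,
      setIntegral_const]
    simp [measureReal_def, hb, mul_comm]
  rw [radialPrimitive_of_ne hx, ← hτ, intervalIntegral.integral_of_le hτ0,
    setIntegral_indicator measurableSet_Ioo]
  constructor
  · intro h
    by_contra hmem
    refine h ?_
    rw [mem_Ioo, not_and_or, not_lt, not_lt] at hmem
    rcases hmem with hle | hle
    · rw [show Ioc 0 τ ∩ Ioo s t = ∅ by
        ext y; simp only [mem_inter_iff, mem_Ioc, mem_Ioo, mem_empty_iff_false, iff_false]
        rintro ⟨⟨-, h1⟩, h2, -⟩; linarith]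
      simp
    · rw [show Ioc 0 τ ∩ Ioo s t = Ioo s t from inter_eq_right.2 fun y hy =>
        ⟨hs.trans hy.1, (hy.2.trans_le hle).le⟩, hcalc t hst.le, hm, sub_self]
  · rintro ⟨h1, h2⟩
    rw [show Ioc 0 τ ∩ Ioo s t = Ioc s τ by
      ext y; simp only [mem_inter_iff, mem_Ioc, mem_Ioo]
      constructor
      · rintro ⟨⟨-, h3⟩, h4, -⟩; exact ⟨h4, h3⟩
      · rintro ⟨h3, h4⟩; exact ⟨⟨hs.trans h3, h4⟩, h3, h4.trans_lt h2⟩,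
      integral_Ioc_eq_integral_Ioo, hcalc τ h1.le]
    have h3 := (strictConvexOn_rpow hα).secant_strict_mono (a := s) (x := τ) (y := t) hs.le hτ0
      (hs.trans hst).le h1.ne' hst.ne' h2
    rw [← hm, mul_div_assoc, div_self (sub_pos.2 hst).ne', mul_one,
      div_lt_iff₀ (sub_pos.2 h1)] at h3
    exact (sub_pos.2 h3).ne'

/-- Energy of a radial field over an annulus. -/
lemma setLIntegral_annulus {n : ℕ} (hn : 0 < n) {p β : ℝ} (hp : 0 < p) (hβ : 0 < β)
    (hβp : n + β = (β + 1) * p) {w : ℝ → ℝ} (hw : Measurable w) {s t : ℝ} (hs : 0 < s) :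
    ∫⁻ x in {x : EuclideanSpace ℝ (Fin n) | ‖x‖ ^ (-β) ∈ Ioo s t}, ‖radialGradient β w x‖ₑ ^ p =
      ENNReal.ofReal (n * (volume (ball (0 : EuclideanSpace ℝ (Fin n)) 1)).toReal * β ^ (p - 1)) *
        ∫⁻ τ in Ioo s t, ‖w τ‖ₑ ^ p := by
  have hm : MeasurableSet {x : EuclideanSpace ℝ (Fin n) | ‖x‖ ^ (-β) ∈ Ioo s t} :=
    (measurable_norm.pow_const (-β)) measurableSet_Ioo
  have h1 := lintegral_enorm_radialGradient hn hp hβ hβp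
    (hw.indicator (measurableSet_Ioo (a := s) (b := t)))
  rw [← lintegral_indicator hm]
  have e1 : ∀ x, {x : EuclideanSpace ℝ (Fin n) | ‖x‖ ^ (-β) ∈ Ioo s t}.indicator
      (fun x => ‖radialGradient β w x‖ₑ ^ p) x =
        ‖radialGradient β ((Ioo s t).indicator w) x‖ₑ ^ p := fun x => by
    by_cases hx : ‖x‖ ^ (-β) ∈ Ioo s t
    · rw [indicator_of_mem (by exact hx), radialGradient, radialGradient, indicator_of_mem hx]
    · rw [indicator_of_notMem (by exact hx), radialGradient, indicator_of_notMem hx]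
      simp [ENNReal.zero_rpow_of_pos hp]
  have e2 : ∀ τ, ‖(Ioo s t).indicator w τ‖ₑ ^ p =
      (Ioo s t).indicator (fun τ => ‖w τ‖ₑ ^ p) τ := fun τ => by
    by_cases hτ : τ ∈ Ioo s t <;> simp [hτ, ENNReal.zero_rpow_of_pos hp]
  simp only [e1]
  rw [h1]
  simp only [e2]
  rw [lintegral_indicator measurableSet_Ioo, Measure.restrict_restrict measurableSet_Ioo,
    inter_eq_left.2 (show Ioo s t ⊆ Ioi 0 from fun τ hτ => hs.trans hτ.1)]

/-- The power is compared with the function that is affine in `|x| ^ (-β)` on the annulus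
`2 < |x| ^ (-β) < t` and agrees with it elsewhere; its energy is the least possible one. As
`t → ∞`, the ratio of the energies tends to `Q`. -/
lemma le_of_isQuasiminimizer {n : ℕ} (hn : 0 < n) {p α β γ Q Q' : ℝ} (hp : 1 < p)
    (hα : 1 < α) (hβ : 0 < β) (hβp : n + β = (β + 1) * p) (hγ : γ = α * β)
    (hQ : Q = α ^ p / (1 + p * (α - 1)))
    (H : IsQuasiminimizer p Q' (ball (0 : EuclideanSpace ℝ (Fin n)) 1 \ {0})
      (fun x => ‖x‖ ^ (-γ))) : Q ≤ Q' := by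
  have hp0 : 0 < p := by linarith
  have hα0 : 0 < α := by linarith
  obtain ⟨g, hg, H⟩ := H
  set Ω := ball (0 : EuclideanSpace ℝ (Fin n)) 1 \ {0} with hΩ
  have hΩo : IsOpen Ω := isOpen_ball.sdiff isClosed_singleton
  set w : ℝ → ℝ := fun t => α * t ^ (α - 1) with hw
  have hwm : Measurable w := by fun_prop
  have hgG : ∀ᵐ x, x ∈ Ω → g x = radialGradient β w x :=
    hg.1.ae_eq hΩo (hasWeakGradient_of_hasGradientAt hΩo (fun x hx => hasGradientAt_power hγ hx.2)
      ((continuousOn_radialGradient (continuousOn_rpow_deriv α)).mono fun x hx => hx.2))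
  refine le_of_forall_rpow_sub_mul_le hp hα.le zero_lt_two fun t ht => ?_
  have hts : 0 < t - 2 := by linarith
  set m := (t ^ α - 2 ^ α) / (t - 2) with hm
  have hmt : m * (t - 2) = t ^ α - 2 ^ α := div_mul_cancel₀ _ hts.ne'
  have hA : 0 < t ^ α - 2 ^ α := sub_pos.2 (Real.rpow_lt_rpow (by norm_num) ht hα0)
  have hm0 : 0 < m := div_pos hA hts
  have hws : ContDiffOn ℝ ∞ w (Ioi 0) :=
    contDiffOn_const.mul (contDiffOn_id.rpow_const_of_ne fun x hx => ne_of_gt hx)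
  have hφ := memSobolevZero_punctured_ball (n := n) (M := α * t ^ (α - 1)) (m := m) hp hβ
    one_le_two ht hws (fun τ hτ => by
      have : 0 < τ := two_pos.trans hτ.1
      rw [hw, abs_of_nonneg (by positivity)]
      exact mul_le_mul_of_nonneg_left (Real.rpow_le_rpow this.le hτ.2.le (by linarith)) hα0.le)
    (by rw [hmt, hw, setIntegral_rpow_deriv hα0 ht.le])
  have key := H _ _ hφ
  set S : Set (EuclideanSpace ℝ (Fin n)) := {x | ‖x‖ ^ (-β) ∈ Ioo 2 t} with hS
  have hSm : MeasurableSet S := (measurable_norm.pow_const (-β)) measurableSet_Ioo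
  have h0S : (0 : EuclideanSpace ℝ (Fin n)) ∉ S := fun h => by
    have : (2 : ℝ) < ‖(0 : EuclideanSpace ℝ (Fin n))‖ ^ (-β) := h.1
    rw [norm_zero, Real.zero_rpow (by linarith)] at this
    norm_num at this
  have hSΩ : S ⊆ Ω := fun x hx => by
    have hx0 : x ≠ 0 := fun h => h0S (h ▸ hx)
    refine ⟨?_, hx0⟩
    rw [mem_ball_zero_iff]
    by_contra h
    have := Real.rpow_le_one_of_one_le_of_nonpos (not_lt.1 h) (show -β ≤ 0 by linarith)
    linarith [hx.1]
  have hset : {x | x ∈ Ω ∧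
      radialPrimitive β ((Ioo 2 t).indicator fun τ => m - w τ) x ≠ 0} = S := by
    ext x
    constructor
    · rintro ⟨hx, h⟩
      exact (radialPrimitive_sub_ne_zero_iff hα two_pos ht hmt hx.2).1 h
    · intro hx
      exact ⟨hSΩ hx, (radialPrimitive_sub_ne_zero_iff hα two_pos ht hmt (hSΩ hx).2).2 hx⟩
  rw [hset] at key
  have e1 : ∫⁻ x in S, ‖g x‖ₑ ^ p = ∫⁻ x in S, ‖radialGradient β w x‖ₑ ^ p := by
    refine setLIntegral_congr_fun_ae hSm ?_
    filter_upwards [hgG] with x hx hxS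
    rw [hx (hSΩ hxS)]
  have e2 : ∫⁻ x in S, ‖g x + radialGradient β ((Ioo 2 t).indicator fun τ => m - w τ) x‖ₑ ^ p =
      ∫⁻ x in S, ‖radialGradient β (fun _ => m) x‖ₑ ^ p := by
    refine setLIntegral_congr_fun_ae hSm ?_
    filter_upwards [hgG] with x hx hxS
    rw [hx (hSΩ hxS), radialGradient, radialGradient, radialGradient, ← add_smul,
      indicator_of_mem (show ‖x‖ ^ (-β) ∈ Ioo 2 t from hxS)]
    congr 4
    ring
  rw [e1, e2, setLIntegral_annulus hn hp0 hβ hβp hwm two_pos,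
    setLIntegral_annulus hn hp0 hβ hβp measurable_const two_pos,
    mul_left_comm] at key
  have hv : 0 < (volume (ball (0 : EuclideanSpace ℝ (Fin n)) 1)).toReal :=
    ENNReal.toReal_pos (measure_ball_pos _ _ one_pos).ne' measure_ball_lt_top.ne
  have hc : 0 < n * (volume (ball (0 : EuclideanSpace ℝ (Fin n)) 1)).toReal * β ^ (p - 1) := by
    positivity
  rw [ENNReal.mul_le_mul_iff_right (by simpa using hc) ENNReal.ofReal_ne_top,
    setLIntegral_rpow_deriv hp hα.le two_pos ht, ← hQ, setLIntegral_const, Real.volume_Ioo,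
    Real.enorm_of_nonneg hm0.le, ENNReal.ofReal_rpow_of_pos hm0,
    ← ENNReal.ofReal_mul (by positivity), ← ENNReal.ofReal_mul' (by positivity),
    ENNReal.ofReal_le_ofReal_iff'] at key
  have hB : 0 < t ^ (p * (α - 1) + 1) - 2 ^ (p * (α - 1) + 1) :=
    sub_pos.2 (Real.rpow_lt_rpow (by norm_num) ht (by nlinarith))
  have hQ0 : 0 < Q := by
    rw [hQ]
    have : 0 < 1 + p * (α - 1) := by nlinarith
    positivity
  have key' := key.resolve_right (by push Not; positivity)
  have e3 : m ^ p * (t - 2) * (t - 2) ^ (p - 1) = (t ^ α - 2 ^ α) ^ p := by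
    rw [mul_assoc, ← Real.rpow_one_add' hts.le (by linarith), ← hmt,
      Real.mul_rpow hm0.le hts.le]
    congr 2; ring
  calc Q * ((t ^ (p * (α - 1) + 1) - 2 ^ (p * (α - 1) + 1)) * (t - 2) ^ (p - 1))
      = Q * (t ^ (p * (α - 1) + 1) - 2 ^ (p * (α - 1) + 1)) * (t - 2) ^ (p - 1) := by ring
    _ ≤ Q' * (m ^ p * (t - 2)) * (t - 2) ^ (p - 1) :=
      mul_le_mul_of_nonneg_right key' (by positivity)
    _ = Q' * (t ^ α - 2 ^ α) ^ p := by rw [← e3]; ring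

/-! ### The potentials of small balls -/

section truncPower

variable {n : ℕ} {γ ε : ℝ}

lemma truncRadius_pos (hε : 0 < ε) : 0 < truncRadius γ ε := by
  unfold truncRadius; positivity

lemma truncRadius_lt_one (hγ : 0 < γ) (hε : 0 < ε) : truncRadius γ ε < 1 :=
  Real.rpow_lt_one (by positivity) ((div_lt_one (by positivity)).2 (by linarith)) (by positivity)

lemma truncRadius_rpow_neg (hγ : 0 < γ) (hε : 0 < ε) : truncRadius γ ε ^ (-γ) = 1 + ε⁻¹ := by
  rw [truncRadius, ← Real.rpow_mul (by positivity), show 1 / γ * -γ = -1 by field_simp,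
    Real.rpow_neg_one]
  field_simp
  ring

lemma truncPower_zero : truncPower γ ε (0 : EuclideanSpace ℝ (Fin n)) = 1 := by simp [truncPower]

lemma truncPower_of_ne {x : EuclideanSpace ℝ (Fin n)} (hx : x ≠ 0) :
    truncPower γ ε x = min (ε * (‖x‖ ^ (-γ) - 1)) 1 := by simp [truncPower, hx]

lemma one_le_mul_sub_one_iff (hε : 0 < ε) {s : ℝ} : 1 ≤ ε * (s - 1) ↔ 1 + ε⁻¹ ≤ s := by
  rw [← div_le_iff₀' hε, one_div]
  constructor <;> intro h <;> linarith

lemma truncPower_eq_one (hγ : 0 < γ) (hε : 0 < ε) {x : EuclideanSpace ℝ (Fin n)}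
    (hx : ‖x‖ ≤ truncRadius γ ε) : truncPower γ ε x = 1 := by
  by_cases h0 : x = 0
  · rw [h0, truncPower_zero]
  rw [truncPower_of_ne h0, min_eq_right]
  rw [one_le_mul_sub_one_iff hε, ← truncRadius_rpow_neg hγ hε]
  exact Real.rpow_le_rpow_of_nonpos (norm_pos_iff.2 h0) hx (by linarith)

lemma truncPower_of_le (hγ : 0 < γ) (hε : 0 < ε) {x : EuclideanSpace ℝ (Fin n)}
    (hx : truncRadius γ ε ≤ ‖x‖) : truncPower γ ε x = ε * (‖x‖ ^ (-γ) - 1) := by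
  have h0 : x ≠ 0 := norm_pos_iff.1 ((truncRadius_pos hε).trans_le hx)
  rw [truncPower_of_ne h0, min_eq_left]
  have h1 : ‖x‖ ^ (-γ) ≤ 1 + ε⁻¹ := by
    rw [← truncRadius_rpow_neg hγ hε]
    exact Real.rpow_le_rpow_of_nonpos (truncRadius_pos hε) hx (by linarith)
  rw [← le_div_iff₀' hε, one_div]
  linarith

lemma continuous_truncPower (hγ : 0 < γ) (hε : 0 < ε) :
    Continuous (truncPower γ ε : EuclideanSpace ℝ (Fin n) → ℝ) := by
  rw [continuous_iff_continuousAt]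
  intro x
  by_cases hx : x = 0
  · refine (continuousAt_const (y := (1 : ℝ))).congr_of_eventuallyEq ?_
    rw [hx]
    filter_upwards [closedBall_mem_nhds 0 (truncRadius_pos (γ := γ) hε)] with y hy
    exact truncPower_eq_one hγ hε (mem_closedBall_zero_iff.1 hy)
  · have h1 : ContinuousAt (fun y : EuclideanSpace ℝ (Fin n) =>
        min (ε * (‖y‖ ^ (-γ) - 1)) 1) x :=
      ((continuousAt_const.mul ((continuous_norm.continuousAt.rpow_const
        (Or.inl (norm_ne_zero_iff.2 hx))).sub continuousAt_const))).min continuousAt_const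
    refine h1.congr_of_eventuallyEq ?_
    filter_upwards [isOpen_ne.mem_nhds hx] with y hy
    exact truncPower_of_ne hy

/-- The infimum over the open ball is not attained in general: it is the value on the boundary
sphere, approached from inside. -/
lemma isGLB_truncPower (hn : 0 < n) (hγ : 0 < γ) (hε : 0 < ε) {ρ : ℝ}
    (hρ : truncRadius γ ε ≤ ρ) :
    IsGLB (truncPower γ ε '' ball (0 : EuclideanSpace ℝ (Fin n)) ρ) (ε * (ρ ^ (-γ) - 1)) := by
  have hρ0 : 0 < ρ := (truncRadius_pos hε).trans_le hρ
  have hmem : ∀ x : EuclideanSpace ℝ (Fin n), ‖x‖ = ρ →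
      truncPower γ ε x = ε * (ρ ^ (-γ) - 1) := fun x hx => by
    rw [truncPower_of_le hγ hε (hx ▸ hρ), hx]
  constructor
  · rintro _ ⟨x, hx, rfl⟩
    rw [mem_ball_zero_iff] at hx
    rcases le_total ‖x‖ (truncRadius γ ε) with h | h
    · rw [truncPower_eq_one hγ hε h, ← not_lt]
      intro h1
      have h2 := (one_le_mul_sub_one_iff hε).1 h1.le
      rw [← truncRadius_rpow_neg hγ hε] at h2
      have h3 : ρ ≤ truncRadius γ ε :=
        (Real.rpow_le_rpow_iff_of_neg (truncRadius_pos hε) hρ0 (by linarith)).1 h2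
      rw [hρ.antisymm h3 |>.symm, truncRadius_rpow_neg hγ hε] at h1
      rw [add_sub_cancel_left, mul_inv_cancel₀ hε.ne'] at h1
      exact lt_irrefl _ h1
    · rw [truncPower_of_le hγ hε h]
      have h0 : 0 < ‖x‖ := (truncRadius_pos hε).trans_le h
      have := Real.rpow_le_rpow_of_nonpos h0 hx.le (show -γ ≤ 0 by linarith)
      gcongr
  · intro b hb
    have : Nonempty (Fin n) := ⟨⟨0, hn⟩⟩
    obtain ⟨x, hx⟩ := exists_norm_eq (EuclideanSpace ℝ (Fin n)) hρ0.le
    rw [← hmem x hx]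
    have hcl : x ∈ closure (ball (0 : EuclideanSpace ℝ (Fin n)) ρ) := by
      rw [closure_ball _ hρ0.ne', mem_closedBall_zero_iff, hx]
    exact closure_minimal (fun y hy => hb (mem_image_of_mem _ hy))
      (isClosed_le continuous_const (continuous_truncPower hγ hε)) hcl

end truncPower

/-- On the unit ball `u_ε` is the radial primitive of `ε α t ^ (α - 1)`, restricted to the interval
with the end points `1` and `ρ_ε ^ (-β)`. -/
lemma memSobolevZero_truncPower {n : ℕ} {p α β γ ε : ℝ} (hp : 1 < p) (hα : 1 ≤ α) (hβ : 0 < β)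
    (hγ : γ = α * β) (hε : 0 < ε) : ∃ g, MemSobolevZero p (ball (0 : EuclideanSpace ℝ (Fin n)) 1)
      (truncPower γ ε) g := by
  have hα0 : 0 < α := by linarith
  have hγ0 : 0 < γ := by rw [hγ]; positivity
  set ρ := truncRadius γ ε with hρ
  have hρ0 : 0 < ρ := truncRadius_pos hε
  set b := ρ ^ (-β) with hb
  have hb1 : 1 < b := Real.one_lt_rpow_of_pos_of_lt_one_of_neg hρ0 (truncRadius_lt_one hγ0 hε)
    (by linarith)
  have hbα : b ^ α = 1 + ε⁻¹ := by
    rw [← truncRadius_rpow_neg hγ0 hε, hb, ← Real.rpow_mul hρ0.le, ← hρ]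
    congr 1; rw [hγ]; ring
  set w : ℝ → ℝ := fun t => ε * (α * t ^ (α - 1)) with hw
  have hws : ContDiffOn ℝ ∞ w (Ioi 0) :=
    contDiffOn_const.mul (contDiffOn_const.mul
      (contDiffOn_id.rpow_const_of_ne fun x hx => ne_of_gt hx))
  have hint : ∀ c, 1 ≤ c → ∫ t in Ioo 1 c, w t = ε * (c ^ α - 1) := fun c hc => by
    rw [hw, integral_const_mul, setIntegral_rpow_deriv hα0 hc, Real.one_rpow]
  have hone : ∫ t, (Ioo 1 b).indicator w t = 1 := by
    rw [integral_indicator measurableSet_Ioo, hint b hb1.le, hbα, add_sub_cancel_left,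
      mul_inv_cancel₀ hε.ne']
  refine ⟨_, memSobolevZero_ball (M := ε * (α * b ^ (α - 1))) hp hβ le_rfl hb1 hws
    (fun t ht => ?_) fun x hx => ?_⟩
  · have : 0 < t := one_pos.trans ht.1
    rw [hw, abs_of_nonneg (by positivity)]
    exact mul_le_mul_of_nonneg_left (mul_le_mul_of_nonneg_left
      (Real.rpow_le_rpow this.le ht.2.le (by linarith)) hα0.le) hε.le
  · rcases le_total ‖x‖ ρ with h | h
    · rw [truncPower_eq_one hγ0 hε h, radialPrimitive_eq_integral (a := 1) (b := b)
        support_indicator_subset zero_le_one, hone]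
      exact fun hx0 => Real.rpow_le_rpow_of_nonpos (norm_pos_iff.2 hx0) h (by linarith)
    · have hx0 : 0 < ‖x‖ := hρ0.trans_le h
      have h1 : 1 ≤ ‖x‖ ^ (-β) := Real.one_le_rpow_of_pos_of_le_one_of_nonpos hx0
        (mem_ball_zero_iff.1 hx).le (by linarith)
      have h2 : ‖x‖ ^ (-β) ≤ b := Real.rpow_le_rpow_of_nonpos hρ0 h (by linarith)
      rw [truncPower_of_le hγ0 hε h, radialPrimitive_of_ne (norm_pos_iff.1 hx0),
        intervalIntegral.integral_of_le (by linarith), integral_Ioc_eq_integral_Ioo,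
        setIntegral_indicator measurableSet_Ioo, Ioo_inter_Ioo, max_eq_right zero_le_one,
        min_eq_left h2, hint _ h1, norm_rpow_rpow hγ]

lemma isQuasiminimizer_truncPower {n : ℕ} (hn : 0 < n) {p α β γ ε Q : ℝ} (hp : 1 < p)
    (hα : 1 ≤ α) (hβ : 0 < β) (hβp : n + β = (β + 1) * p) (hγ : γ = α * β)
    (hQ : Q = α ^ p / (1 + p * (α - 1))) (hε : 0 < ε) :
    IsQuasiminimizer p Q (ball (0 : EuclideanSpace ℝ (Fin n)) 1 \ closedBall 0 (truncRadius γ ε))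
      (truncPower γ ε) := by
  have hγ0 : 0 < γ := by rw [hγ]; positivity
  have hsub : ball (0 : EuclideanSpace ℝ (Fin n)) 1 \ closedBall 0 (truncRadius γ ε) ⊆
      ball 0 1 \ {0} := by
    refine sdiff_subset_sdiff_right (singleton_subset_iff.2 ?_)
    exact mem_closedBall_self (truncRadius_pos hε).le
  refine isQuasiminimizer_of_hasGradientAt hn hp hα hβ hβp hQ hsub
    (isOpen_ball.sdiff isClosed_closedBall) hε fun x hx => ?_
  have h1 := hasGradientAt_power hγ (hsub hx).2
  rw [hasGradientAt_iff_hasFDerivAt] at h1 ⊢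
  have h2 := (h1.sub_const 1).const_mul ε
  rw [← map_smul] at h2
  refine h2.congr_of_eventuallyEq ?_
  filter_upwards [isClosed_closedBall.isOpen_compl.mem_nhds hx.2] with y hy
  rw [mem_compl_iff, mem_closedBall_zero_iff, not_le] at hy
  exact truncPower_of_le hγ0 hε hy.le

lemma sobolevCap_empty {n : ℕ} {p : ℝ} (hp : 0 < p) :
    sobolevCap p (∅ : Set (EuclideanSpace ℝ (Fin n))) = 0 := by
  refine le_antisymm (iInf₂_le_of_le ∅ ⟨isOpen_empty, subset_rfl⟩ (iSup₂_le fun K hK => ?_)) zero_le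
  rw [subset_empty_iff.1 hK.2]
  refine iInf₂_le_of_le (fun _ => 0) ⟨⟨contDiff_const, HasCompactSupport.zero, subset_univ _⟩,
    by simp⟩ ?_
  simp [gradient_fun_const, ENNReal.zero_rpow_of_pos hp]

/-- Null sets do not affect the lower limit of a continuous function. -/
lemma coe_eq_liminf_of_continuousAt {n : ℕ} {u : EuclideanSpace ℝ (Fin n) → ℝ}
    {x : EuclideanSpace ℝ (Fin n)} (hu : ContinuousAt u x) :
    ((u x : ℝ) : EReal) = liminf (fun y => ((u y : ℝ) : EReal)) (𝓝 x ⊓ ae volume) := by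
  have : NeBot (𝓝 x ⊓ ae (volume : Measure (EuclideanSpace ℝ (Fin n)))) := by
    rw [inf_neBot_iff]
    intro s hs t ht
    by_contra h
    rw [not_nonempty_iff_eq_empty, ← disjoint_iff_inter_eq_empty] at h
    exact (Measure.measure_pos_of_mem_nhds volume hs).ne'
      (measure_mono_null h.subset_compl_right (mem_ae_iff.1 ht))
  have h1 : Tendsto (fun y => ((u y : ℝ) : EReal)) (𝓝 x) (𝓝 (u x : EReal)) :=
    (continuous_coe_real_ereal.tendsto _).comp hu
  exact (h1.mono_left inf_le_left).liminf_eq.symm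

lemma isQuasiminPotential_truncPower {n : ℕ} (hn : 0 < n) {p α β γ ε Q : ℝ} (hp : 1 < p)
    (hα : 1 ≤ α) (hβ : 0 < β) (hβp : n + β = (β + 1) * p) (hγ : γ = α * β)
    (hQ : Q = α ^ p / (1 + p * (α - 1))) (hε : 0 < ε) :
    IsQuasiminPotential p Q (ball (0 : EuclideanSpace ℝ (Fin n)) 1)
      (closedBall 0 (truncRadius γ ε)) (truncPower γ ε) := by
  have hγ0 : 0 < γ := by rw [hγ]; positivity
  have hcont := continuous_truncPower (n := n) hγ0 hε
  refine ⟨⟨_, isClosed_closedBall, (inter_eq_left.2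
    (closedBall_subset_ball (truncRadius_lt_one hγ0 hε))).symm⟩,
    memSobolevZero_truncPower hp hα hβ hγ hε, isQuasiminimizer_truncPower hn hp hα hβ hβp hγ hQ hε,
    ?_, fun η hη => ⟨∅, isOpen_empty, ?_, hcont.continuousOn⟩,
    fun x _ => coe_eq_liminf_of_continuousAt hcont.continuousAt⟩
  · rw [show {x : EuclideanSpace ℝ (Fin n) | x ∈ closedBall 0 (truncRadius γ ε) ∧
        truncPower γ ε x ≠ 1} = ∅ from eq_empty_iff_forall_notMem.2 fun x hx =>
      hx.2 (truncPower_eq_one hγ0 hε (mem_closedBall_zero_iff.1 hx.1)),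
      sobolevCap_empty (by linarith)]
  · rwa [sobolevCap_empty (by linarith)]

/-! ### Comparison of capacities and of the sums of capacities -/

/-- `cap_p (B̄(0, ρ), B(0, r)) ≃ ρ ^ (n - p)` as long as `2 ρ ≤ r`. -/
lemma exists_varCap_comparison {n : ℕ} (hn : 0 < n) {p β : ℝ} (hp : 1 < p) (hβ : 0 < β)
    (hβp : n + β = (β + 1) * p) : ∃ a b : ℝ, 0 < a ∧ 0 < b ∧ ∀ ρ r : ℝ, 0 < ρ → 2 * ρ ≤ r →
      varCap p (closedBall (0 : EuclideanSpace ℝ (Fin n)) ρ) (ball 0 r) ≠ ⊤ ∧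
      a * ρ ^ (n - p) ≤
        (varCap p (closedBall (0 : EuclideanSpace ℝ (Fin n)) ρ) (ball 0 r)).toReal ∧
      (varCap p (closedBall (0 : EuclideanSpace ℝ (Fin n)) ρ) (ball 0 r)).toReal ≤
        b * ρ ^ (n - p) := by
  have hv : 0 < (volume (ball (0 : EuclideanSpace ℝ (Fin n)) 1)).toReal :=
    ENNReal.toReal_pos (measure_ball_pos _ _ one_pos).ne' measure_ball_lt_top.ne
  set κ := n * (volume (ball (0 : EuclideanSpace ℝ (Fin n)) 1)).toReal * β ^ (p - 1) with hκ
  have hκ0 : 0 < κ := by positivity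
  have h2 : (2 : ℝ) ^ (-β) < 1 := Real.rpow_lt_one_of_one_lt_of_neg one_lt_two (by linarith)
  have h2' : 0 < 1 - (2 : ℝ) ^ (-β) := by linarith
  refine ⟨κ, κ * (1 - 2 ^ (-β)) ^ (1 - p), hκ0, by positivity, fun ρ r hρ hr => ?_⟩
  have hρr : ρ < r := by linarith
  rw [varCap_closedBall_ball hn hp hβ hβp hρ hρr]
  have hρβ : 0 < ρ ^ (-β) := Real.rpow_pos_of_pos hρ _
  have hrβ : 0 < r ^ (-β) := Real.rpow_pos_of_pos (hρ.trans hρr) _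
  have hlt : r ^ (-β) < ρ ^ (-β) := Real.rpow_lt_rpow_of_neg hρ hρr (by linarith)
  have hle : r ^ (-β) ≤ 2 ^ (-β) * ρ ^ (-β) := by
    rw [← Real.mul_rpow two_pos.le hρ.le]
    exact Real.rpow_le_rpow_of_nonpos (by linarith) hr (by linarith)
  have e : (ρ ^ (-β)) ^ (1 - p) = ρ ^ (n - p) := by
    rw [← Real.rpow_mul hρ.le]; congr 1; linarith
  have hd : 0 < ρ ^ (-β) - r ^ (-β) := by linarith
  refine ⟨ENNReal.ofReal_ne_top, ?_, ?_⟩ <;> rw [ENNReal.toReal_ofReal (by positivity)]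
  · rw [← e]
    exact mul_le_mul_of_nonneg_left
      (Real.rpow_le_rpow_of_nonpos hd (by linarith) (by linarith)) hκ0.le
  · rw [← e, mul_assoc κ, ← Real.mul_rpow h2'.le hρβ.le]
    exact mul_le_mul_of_nonneg_left
      (Real.rpow_le_rpow_of_nonpos (by positivity) (by linarith) (by linarith)) hκ0.le

lemma truncRadius_le {γ ε : ℝ} (hγ : 0 < γ) (hε : 0 < ε) : truncRadius γ ε ≤ ε ^ (1 / γ) :=
  Real.rpow_le_rpow (by positivity) (div_le_self hε.le (by linarith)) (by positivity)

lemma le_truncRadius {γ ε : ℝ} (hγ : 0 < γ) (hε : 0 < ε) (hε1 : ε ≤ 1) :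
    (1 / 2) ^ (1 / γ) * ε ^ (1 / γ) ≤ truncRadius γ ε := by
  rw [← Real.mul_rpow (by norm_num) hε.le]
  refine Real.rpow_le_rpow (by positivity) ?_ (by positivity)
  rw [le_div_iff₀ (by positivity)]
  nlinarith

lemma rpow_one_div_rpow {γ ε a : ℝ} (hε : 0 ≤ ε) : (ε ^ (1 / γ)) ^ a = ε ^ (a / γ) := by
  rw [← Real.rpow_mul hε]; congr 1; ring

lemma truncRadius_rpow_le {γ ε a : ℝ} (hγ : 0 < γ) (hε : 0 < ε) (ha : 0 ≤ a) :
    truncRadius γ ε ^ a ≤ ε ^ (a / γ) := by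
  rw [← rpow_one_div_rpow hε.le]
  exact Real.rpow_le_rpow (truncRadius_pos hε).le (truncRadius_le hγ hε) ha

lemma le_truncRadius_rpow {γ ε a : ℝ} (hγ : 0 < γ) (hε : 0 < ε) (hε1 : ε ≤ 1) (ha : 0 ≤ a) :
    (1 / 2) ^ (a / γ) * ε ^ (a / γ) ≤ truncRadius γ ε ^ a := by
  rw [← rpow_one_div_rpow hε.le, ← rpow_one_div_rpow (by norm_num : (0 : ℝ) ≤ 1 / 2),
    ← Real.mul_rpow (by positivity) (by positivity)]
  exact Real.rpow_le_rpow (by positivity) (le_truncRadius hγ hε hε1) ha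

lemma exists_varCap_truncRadius_comparison {n : ℕ} (hn : 0 < n) {p β γ : ℝ} (hp : 1 < p)
    (hpn : p < n) (hβ : 0 < β) (hβp : n + β = (β + 1) * p) (hγ : 0 < γ) :
    ∃ C : ℝ, 0 < C ∧ ∀ ε : ℝ, 0 < ε → ε ≤ 1 →
      (∀ r : ℝ, 2 * truncRadius γ ε ≤ r →
        ENNReal.ofReal (C⁻¹ * truncRadius γ ε ^ (n - p)) ≤
          varCap p (closedBall (0 : EuclideanSpace ℝ (Fin n)) (truncRadius γ ε)) (ball 0 r) ∧
        varCap p (closedBall (0 : EuclideanSpace ℝ (Fin n)) (truncRadius γ ε)) (ball 0 r) ≤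
          ENNReal.ofReal (C * truncRadius γ ε ^ (n - p))) ∧
      C⁻¹ * ε ^ ((n - p) / γ) ≤ truncRadius γ ε ^ (n - p) ∧
      truncRadius γ ε ^ (n - p) ≤ C * ε ^ ((n - p) / γ) := by
  obtain ⟨a, b, ha, hb, h⟩ := exists_varCap_comparison hn hp hβ hβp
  have hnp : 0 ≤ n - p := by linarith
  have hd : (0 : ℝ) < (1 / 2) ^ ((n - p) / γ) := by positivity
  have hC : 0 < 1 + a⁻¹ + b + ((1 / 2) ^ ((n - p) / γ))⁻¹ := by positivity
  refine ⟨1 + a⁻¹ + b + ((1 / 2) ^ ((n - p) / γ))⁻¹, hC, fun ε hε hε1 => ?_⟩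
  have hρ := truncRadius_pos (γ := γ) hε
  refine ⟨fun r hr => ?_, ?_, ?_⟩
  · obtain ⟨h1, h2, h3⟩ := h _ r hρ hr
    rw [← ENNReal.ofReal_toReal h1]
    refine ⟨ENNReal.ofReal_le_ofReal (le_trans ?_ h2),
      ENNReal.ofReal_le_ofReal (h3.trans ?_)⟩
    · refine mul_le_mul_of_nonneg_right (inv_le_of_inv_le₀ ha ?_) (by positivity)
      linarith [inv_pos.2 hd]
    · refine mul_le_mul_of_nonneg_right ?_ (by positivity)
      linarith [inv_pos.2 hd, inv_pos.2 ha]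
  · refine le_trans ?_ (le_truncRadius_rpow hγ hε hε1 hnp)
    refine mul_le_mul_of_nonneg_right (inv_le_of_inv_le₀ hd ?_) (by positivity)
    linarith [inv_pos.2 ha]
  · refine (truncRadius_rpow_le hγ hε hnp).trans (le_mul_of_one_le_left (by positivity) ?_)
    linarith [inv_pos.2 hd, inv_pos.2 ha]

/-- Since `B̄(0, ρ_ε)` lies in all the balls that occur, the term with `j = k` dominates the sum. -/
lemma exists_wienerSum_comparison {n : ℕ} (hn : 0 < n) {p β γ : ℝ} (hp : 1 < p)
    (hpn : p < n) (hβ : 0 < β) (hβp : n + β = (β + 1) * p) (hγ : 0 < γ) {δ r : ℝ} (k : ℕ)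
    (hδ : 0 < δ) (hr : 0 < r) (hr1 : r ≤ 1) :
    ∃ C : ℝ, 0 < C ∧ ∀ ε : ℝ, 0 < ε → ε ^ (1 / γ) ≤ r / 3 ^ (k + 1) →
      C⁻¹ * (ε ^ (1 / γ) / (r / 3 ^ k)) ^ ((n - p) / δ) ≤
        wienerSum p δ (0 : EuclideanSpace ℝ (Fin n)) r k (closedBall 0 (truncRadius γ ε)) ∧
      wienerSum p δ (0 : EuclideanSpace ℝ (Fin n)) r k (closedBall 0 (truncRadius γ ε)) ≤
        C * (ε ^ (1 / γ) / (r / 3 ^ k)) ^ ((n - p) / δ) := by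
  obtain ⟨a, b, ha, hb, h⟩ := exists_varCap_comparison hn hp hβ hβp
  have hnp : 0 ≤ n - p := by linarith
  set d : ℝ := (1 / 2) ^ ((n - p) / γ) with hd
  refine ⟨((a * d) ^ (1 / δ))⁻¹ + (k + 1) * b ^ (1 / δ), by positivity, fun ε hε hεr => ?_⟩
  have hρ := truncRadius_pos (γ := γ) hε
  have hrk : ∀ j : ℕ, 0 < r / 3 ^ j := fun j => by positivity
  have hε1 : ε ≤ 1 := by
    by_contra hlt
    have h1 : 1 < ε ^ (1 / γ) := Real.one_lt_rpow (not_le.1 hlt) (by positivity)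
    have h2 : r / 3 ^ (k + 1) ≤ r := div_le_self hr.le (one_le_pow₀ (by norm_num))
    linarith
  have hmono : ∀ i j : ℕ, i ≤ j → r / 3 ^ j ≤ r / 3 ^ i := fun i j hij =>
    div_le_div_of_nonneg_left hr.le (by positivity) (pow_le_pow_right₀ (by norm_num) hij)
  have hX : ∀ j, ((ε ^ (1 / γ) / (r / 3 ^ j)) ^ (n - p)) ^ (1 / δ) =
      (ε ^ (1 / γ) / (r / 3 ^ j)) ^ ((n - p) / δ) := fun j => by
    rw [← Real.rpow_mul (by positivity), mul_one_div]
  have hK : ∀ j ≤ k, closedBall (0 : EuclideanSpace ℝ (Fin n)) (truncRadius γ ε) ∩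
      closedBall 0 (r / 3 ^ (j + 1)) = closedBall 0 (truncRadius γ ε) := fun j hj =>
    inter_eq_left.2 (closedBall_subset_closedBall
      ((truncRadius_le hγ hε).trans (hεr.trans (hmono _ _ (by lia)))))
  have hcap : ∀ j ≤ k, a * d * (ε ^ (1 / γ) / (r / 3 ^ j)) ^ (n - p) ≤
      (varCap p (closedBall (0 : EuclideanSpace ℝ (Fin n)) (truncRadius γ ε) ∩
        closedBall 0 (r / 3 ^ (j + 1))) (ball 0 (r / 3 ^ j))).toReal / (r / 3 ^ j) ^ (n - p) ∧
      (varCap p (closedBall (0 : EuclideanSpace ℝ (Fin n)) (truncRadius γ ε) ∩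
        closedBall 0 (r / 3 ^ (j + 1))) (ball 0 (r / 3 ^ j))).toReal / (r / 3 ^ j) ^ (n - p) ≤
      b * (ε ^ (1 / γ) / (r / 3 ^ j)) ^ (n - p) := fun j hj => by
    have h2 : 2 * truncRadius γ ε ≤ r / 3 ^ j := by
      have h3 := (truncRadius_le hγ hε).trans (hεr.trans (hmono (j + 1) (k + 1) (by lia)))
      rw [pow_succ, ← div_div, le_div_iff₀ (by norm_num)] at h3
      linarith
    obtain ⟨-, h4, h5⟩ := h _ _ hρ h2
    rw [hK j hj, Real.div_rpow (by positivity) (hrk j).le, rpow_one_div_rpow hε.le, ← mul_div_assoc,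
      ← mul_div_assoc]
    refine ⟨div_le_div_of_nonneg_right ((le_trans ?_ h4)) (by positivity),
      div_le_div_of_nonneg_right (h5.trans ?_) (by positivity)⟩
    · rw [mul_assoc]
      exact mul_le_mul_of_nonneg_left (le_truncRadius_rpow hγ hε hε1 hnp) ha.le
    · exact mul_le_mul_of_nonneg_left (truncRadius_rpow_le hγ hε hnp) hb.le
  have hXk : 0 ≤ (ε ^ (1 / γ) / (r / 3 ^ k)) ^ ((n - p) / δ) := by positivity
  constructor
  · calc _ ≤ (a * d) ^ (1 / δ) * (ε ^ (1 / γ) / (r / 3 ^ k)) ^ ((n - p) / δ) := by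
          refine mul_le_mul_of_nonneg_right (inv_le_of_inv_le₀ (by positivity) ?_) hXk
          exact le_add_of_nonneg_right (by positivity)
      _ = (a * d * (ε ^ (1 / γ) / (r / 3 ^ k)) ^ (n - p)) ^ (1 / δ) := by
          rw [← hX, ← Real.mul_rpow (by positivity) (by positivity)]
      _ ≤ _ := Real.rpow_le_rpow (by positivity) (hcap k le_rfl).1 (by positivity)
      _ ≤ _ := Finset.single_le_sum (f := fun j => ((varCap p
          (closedBall (0 : EuclideanSpace ℝ (Fin n)) (truncRadius γ ε) ∩
            closedBall 0 (r / 3 ^ (j + 1))) (ball 0 (r / 3 ^ j))).toReal /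
          (r / 3 ^ j) ^ ((n : ℝ) - p)) ^ (1 / δ)) (fun j _ => by positivity)
          (Finset.mem_range.2 (Nat.lt_succ_self k))
  · calc _ ≤ ∑ _j ∈ Finset.range (k + 1),
          b ^ (1 / δ) * (ε ^ (1 / γ) / (r / 3 ^ k)) ^ ((n - p) / δ) := by
          refine Finset.sum_le_sum fun j hj => ?_
          have hjk : j ≤ k := Nat.lt_succ_iff.1 (Finset.mem_range.1 hj)
          calc _ ≤ (b * (ε ^ (1 / γ) / (r / 3 ^ j)) ^ (n - p)) ^ (1 / δ) :=
                Real.rpow_le_rpow (by positivity) (hcap j hjk).2 (by positivity)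
            _ = b ^ (1 / δ) * (ε ^ (1 / γ) / (r / 3 ^ j)) ^ ((n - p) / δ) := by
                rw [Real.mul_rpow (by positivity) (by positivity), hX]
            _ ≤ _ := by
                refine mul_le_mul_of_nonneg_left (Real.rpow_le_rpow (by positivity) ?_
                  (by positivity)) (by positivity)
                exact div_le_div_of_nonneg_left (by positivity) (hrk k) (hmono j k hjk)
      _ = (k + 1) * b ^ (1 / δ) * (ε ^ (1 / γ) / (r / 3 ^ k)) ^ ((n - p) / δ) := by
          rw [Finset.sum_const, Finset.card_range, nsmul_eq_mul]; push_cast; ring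
      _ ≤ _ := mul_le_mul_of_nonneg_right (le_add_of_nonneg_left (by positivity)) hXk

/-! ### Sharpness of the exponent -/

lemma one_le_of_eventually_mul_rpow_le {a c C : ℝ} (hc : 0 < c)
    (h : ∀ᶠ ε in 𝓝[>] (0 : ℝ), c * ε ^ a ≤ C * ε) : 1 ≤ a := by
  by_contra! ha
  have h1 : Tendsto (fun ε : ℝ => C * ε ^ (1 - a)) (𝓝[>] 0) (𝓝 0) := by
    have h2 := ((Real.continuous_rpow_const (q := 1 - a) (by linarith)).const_mul C).tendsto 0
    simp only [Real.zero_rpow (by linarith : 1 - a ≠ 0), mul_zero] at h2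
    exact h2.mono_left nhdsWithin_le_nhds
  refine hc.not_ge (ge_of_tendsto h1 ?_)
  filter_upwards [h, self_mem_nhdsWithin] with ε hε hε0
  have hε0' : 0 < ε := hε0
  rw [Real.rpow_sub hε0', Real.rpow_one, ← mul_div_assoc, le_div_iff₀ (by positivity)]
  exact hε

lemma eventually_rpow_one_div_le {γ b : ℝ} (hγ : 0 < γ) (hb : 0 < b) :
    ∀ᶠ ε in 𝓝[>] (0 : ℝ), ε ^ (1 / γ) ≤ b := by
  have h2 := (Real.continuous_rpow_const (q := 1 / γ) (by positivity)).tendsto 0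
  rw [Real.zero_rpow (by positivity)] at h2
  exact (h2.mono_left nhdsWithin_le_nhds).eventually_le_const hb

lemma truncPower_le {n : ℕ} {γ ε : ℝ} {x : EuclideanSpace ℝ (Fin n)} (hx : x ≠ 0) :
    truncPower γ ε x ≤ (‖x‖ ^ (-γ) - 1) * ε := by
  rw [truncPower_of_ne hx, mul_comm]
  exact min_le_left _ _

lemma le_div_of_one_le_div {δ γ a : ℝ} (hδ : 0 < δ) (h : 1 ≤ a / γ / δ) : δ ≤ a / γ := by
  rwa [le_div_iff₀ hδ, one_mul] at h

/-- At a fixed point `u_ε` is of order `ε`, while the capacity of `B̄(0, ρ_ε)` is of order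
`ε ^ ((n - p) / γ)`. -/
lemma le_of_martioBound {n : ℕ} (hn : 0 < n) {p β γ : ℝ} (hp : 1 < p) (hpn : p < n) (hβ : 0 < β)
    (hβp : n + β = (β + 1) * p) (hγ : 0 < γ) {δ c ε₀ : ℝ} (hδ : 0 < δ) (hc : 0 < c)
    (hε₀ : 0 < ε₀) (H : ∀ ε : ℝ, 0 < ε → ε < ε₀ →
      MartioBound p δ c (0 : EuclideanSpace ℝ (Fin n)) (1 / 3)
        (closedBall 0 (truncRadius γ ε)) (truncPower γ ε)) : δ ≤ (n - p) / γ := by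
  obtain ⟨a, b, ha, hb, h⟩ := exists_varCap_comparison hn hp hβ hβp
  have hnp : 0 ≤ n - p := by linarith
  set d : ℝ := (1 / 2) ^ ((n - p) / γ) with hd
  have : Nonempty (Fin n) := ⟨⟨0, hn⟩⟩
  obtain ⟨x, hx⟩ := exists_norm_eq (EuclideanSpace ℝ (Fin n)) (show (0 : ℝ) ≤ 1 / 2 by norm_num)
  have hx0 : x ≠ 0 := norm_pos_iff.1 (by rw [hx]; norm_num)
  have hxb : x ∈ ball (0 : EuclideanSpace ℝ (Fin n)) (2 * (1 / 3)) := by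
    rw [mem_ball_zero_iff, hx]; norm_num
  have hz : (0 : ℝ) < (1 / 3 : ℝ) ^ (n - p) := by positivity
  refine le_div_of_one_le_div hδ (one_le_of_eventually_mul_rpow_le
    (c := c * (a * d / (1 / 3) ^ (n - p)) ^ (1 / δ)) (C := ‖x‖ ^ (-γ) - 1) (by positivity) ?_)
  filter_upwards [Ioo_mem_nhdsGT hε₀, Ioo_mem_nhdsGT one_pos,
    eventually_rpow_one_div_le hγ (show (0 : ℝ) < 1 / 2 by norm_num)] with ε hε hε1 hεγ
  obtain ⟨-, h4, -⟩ := h (truncRadius γ ε) (3 * (1 / 3)) (truncRadius_pos hε.1) (by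
    have := truncRadius_le hγ hε.1
    linarith)
  refine le_trans ?_ ((H ε hε.1 hε.2 x hxb).trans (truncPower_le hx0))
  have hε0 := hε.1
  rw [mul_assoc]
  refine mul_le_mul_of_nonneg_left ?_ hc.le
  calc (a * d / (1 / 3) ^ (n - p)) ^ (1 / δ) * ε ^ ((n - p) / γ / δ)
      = (a * (d * ε ^ ((n - p) / γ)) / (1 / 3) ^ (n - p)) ^ (1 / δ) := by
        rw [div_eq_mul_one_div ((n - p) / γ) δ, Real.rpow_mul hε0.le,
          ← Real.mul_rpow (by positivity) (by positivity)]
        congr 1; ring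
    _ ≤ _ := by
        refine Real.rpow_le_rpow (by positivity) (div_le_div_of_nonneg_right ?_ hz.le)
          (by positivity)
        exact (mul_le_mul_of_nonneg_left (le_truncRadius_rpow hγ hε0 hε1.2.le hnp) ha.le).trans h4

/-- As for Martio's estimate; for small `y` the function `1 - exp (-y)` is of order `y`. -/
lemma le_of_iteratedBound {n : ℕ} (hn : 0 < n) {p β γ : ℝ} (hp : 1 < p) (hpn : p < n) (hβ : 0 < β)
    (hβp : n + β = (β + 1) * p) (hγ : 0 < γ) {δ c ε₀ : ℝ} (k : ℕ) (hδ : 0 < δ) (hc : 0 < c)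
    (hε₀ : 0 < ε₀) (H : ∀ ε : ℝ, 0 < ε → ε < ε₀ →
      IteratedBound p δ c (0 : EuclideanSpace ℝ (Fin n)) 1 k
        (closedBall 0 (truncRadius γ ε)) (truncPower γ ε)) : δ ≤ (n - p) / γ := by
  obtain ⟨C, hC, h⟩ := exists_wienerSum_comparison hn hp hpn hβ hβp hγ k hδ one_pos le_rfl
  have : Nonempty (Fin n) := ⟨⟨0, hn⟩⟩
  have hk : (0 : ℝ) < 1 / 3 ^ (k + 1) := by positivity
  obtain ⟨x, hx⟩ := exists_norm_eq (EuclideanSpace ℝ (Fin n)) (half_pos hk).le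
  have hx0 : x ≠ 0 := norm_pos_iff.1 (by rw [hx]; exact half_pos hk)
  have hxb : x ∈ ball (0 : EuclideanSpace ℝ (Fin n)) (1 / 3 ^ (k + 1)) := by
    rw [mem_ball_zero_iff, hx]; exact half_lt_self hk
  have hcC : 0 < c * C⁻¹ := by positivity
  refine le_div_of_one_le_div hδ (one_le_of_eventually_mul_rpow_le
    (c := c * C⁻¹ / (1 + c * C⁻¹)) (C := ‖x‖ ^ (-γ) - 1) (by positivity) ?_)
  filter_upwards [Ioo_mem_nhdsGT hε₀, Ioo_mem_nhdsGT one_pos,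
    eventually_rpow_one_div_le hγ hk] with ε hε hε1 hεγ
  have hε0 := hε.1
  refine le_trans ?_ ((H ε hε.1 hε.2 x hxb).trans (truncPower_le hx0))
  set X := ε ^ ((n - p) / γ / δ) with hX
  have hX1 : X ≤ 1 := Real.rpow_le_one hε0.le hε1.2.le (by positivity)
  have hW : C⁻¹ * X ≤ wienerSum p δ (0 : EuclideanSpace ℝ (Fin n)) 1 k
      (closedBall 0 (truncRadius γ ε)) := by
    refine le_trans (mul_le_mul_of_nonneg_left ?_ (inv_pos.2 hC).le) (h ε hε0 hεγ).1
    rw [hX, show (n - p) / γ / δ = (n - p) / δ / γ by ring, ← rpow_one_div_rpow hε0.le]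
    refine Real.rpow_le_rpow (by positivity) ?_ (by positivity)
    rw [le_div_iff₀ (by positivity)]
    refine mul_le_of_le_one_right (by positivity) ?_
    exact div_le_self zero_le_one (one_le_pow₀ (by norm_num))
  set y := c * C⁻¹ * X with hy
  have hy0 : 0 < y := by positivity
  have hyW : y ≤ c * wienerSum p δ (0 : EuclideanSpace ℝ (Fin n)) 1 k
      (closedBall 0 (truncRadius γ ε)) := by
    rw [hy, mul_assoc]; exact mul_le_mul_of_nonneg_left hW hc.le
  have hy1 : y ≤ c * C⁻¹ := mul_le_of_le_one_right hcC.le hX1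
  have hexp : Real.exp (-y) ≤ 1 / (1 + y) := by
    rw [Real.exp_neg, ← one_div]
    exact one_div_le_one_div_of_le (by positivity) (by linarith [Real.add_one_le_exp y])
  calc c * C⁻¹ / (1 + c * C⁻¹) * X = y / (1 + c * C⁻¹) := by rw [hy]; ring
    _ ≤ y / (1 + y) := div_le_div_of_nonneg_left hy0.le (by positivity) (by linarith)
    _ = 1 - 1 / (1 + y) := by field_simp; ring
    _ ≤ 1 - Real.exp (-y) := by linarith
    _ ≤ _ := by
      have := Real.exp_le_exp.2 (neg_le_neg hyW)
      linarith

lemma truncRadius_le_one_third {γ ε : ℝ} (hγ : 0 < γ) (hε : 0 < ε) (h : ε < (1 / 3) ^ γ) :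
    truncRadius γ ε ≤ 1 / 3 := by
  refine (truncRadius_le hγ hε).trans ?_
  have := Real.rpow_le_rpow hε.le h.le (show 0 ≤ 1 / γ by positivity)
  rwa [← Real.rpow_mul (by norm_num), mul_one_div_cancel hγ.ne', Real.rpow_one] at this

/-- The estimate is applied to `u_ε` in `B(0, 1)`, that is with `r = 1 / 3`. -/
lemma le_of_martioEstimate {n : ℕ} (hn : 0 < n) {p α β γ Q δ : ℝ} (hp : 1 < p) (hpn : p < n)
    (hα : 1 ≤ α) (hβ : 0 < β) (hβp : n + β = (β + 1) * p) (hγ : γ = α * β)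
    (hQ : Q = α ^ p / (1 + p * (α - 1))) (hδ : 0 < δ) (H : MartioEstimate n p Q δ) :
    δ ≤ (n - p) / γ := by
  have hγ0 : 0 < γ := by rw [hγ]; positivity
  obtain ⟨c, hc, H⟩ := H
  refine le_of_martioBound hn hp hpn hβ hβp hγ0 hδ hc (ε₀ := (1 / 3) ^ γ) (by positivity)
    fun ε hε hε₀ => H 0 (1 / 3) (by norm_num) _ (isCompact_closedBall _ _)
      (closedBall_subset_closedBall (truncRadius_le_one_third hγ0 hε hε₀)) _ ?_
  rw [show (3 : ℝ) * (1 / 3) = 1 by norm_num]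
  exact isQuasiminPotential_truncPower hn hp hα hβ hβp hγ hQ hε

lemma le_of_iteratedEstimateAt {n : ℕ} (hn : 0 < n) {p α β γ Q δ : ℝ} {k : ℕ} (hp : 1 < p)
    (hpn : p < n) (hα : 1 ≤ α) (hβ : 0 < β) (hβp : n + β = (β + 1) * p) (hγ : γ = α * β)
    (hQ : Q = α ^ p / (1 + p * (α - 1))) (hδ : 0 < δ) (H : IteratedEstimateAt n p Q δ k) :
    δ ≤ (n - p) / γ := by
  have hγ0 : 0 < γ := by rw [hγ]; positivity
  obtain ⟨c, hc, H⟩ := H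
  exact le_of_iteratedBound hn hp hpn hβ hβp hγ0 k hδ hc (ε₀ := (1 / 3) ^ γ) (by positivity)
    fun ε hε hε₀ => H 0 1 one_pos _ (isCompact_closedBall _ _)
      (closedBall_subset_closedBall (truncRadius_le_one_third hγ0 hε hε₀)) _
      (isQuasiminPotential_truncPower hn hp hα hβ hβp hγ hQ hε)

end QuasiMin

theorem mainTheorem6 (n : ℕ) (p Q : ℝ) (hp : 1 < p) (hpn : p < n) (hQ : 1 < Q) :
    ∃ α p₁ γ : ℝ,
      -- the exponents
      (QuasiMin.IsAlphaBar p Q α ∧ ∀ a, QuasiMin.IsAlphaBar p Q a → a = α) ∧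
      (QuasiMin.IsPOne (p / (p - 1)) (Q ^ (1 / p)) p₁ ∧
        ∀ x, QuasiMin.IsPOne (p / (p - 1)) (Q ^ (1 / p)) x → x = p₁) ∧
      γ = α * (n - p) / (p - 1) ∧
      n / p - 1 < γ ∧
      (n - p) / γ = (p - 1) / α ∧
      p - p₁ / (p₁ - 1) = (p - 1) / α ∧
      -- the power is a quasiminimizer in the punctured ball, with best constant Q
      IsLeast {Q' : ℝ | QuasiMin.IsQuasiminimizer p Q'
        (Metric.ball (0 : EuclideanSpace ℝ (Fin n)) 1 \ {0}) (fun x => ‖x‖ ^ (-γ))} Q ∧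
      -- the truncated power is a quasiminimizing potential of a small ball
      (∀ ε : ℝ, 0 < ε →
        QuasiMin.IsQuasiminPotential p Q (Metric.ball (0 : EuclideanSpace ℝ (Fin n)) 1)
          (Metric.closedBall 0 (QuasiMin.truncRadius γ ε)) (QuasiMin.truncPower γ ε)) ∧
      -- its infimum over concentric balls
      (∀ ε ρ : ℝ, 0 < ε → QuasiMin.truncRadius γ ε ≤ ρ → ρ ≤ 1 →
        IsGLB (QuasiMin.truncPower γ ε '' Metric.ball (0 : EuclideanSpace ℝ (Fin n)) ρ)
          (ε * (ρ ^ (-γ) - 1))) ∧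
      -- the capacity of concentric balls
      (∀ ρ r : ℝ, 0 < ρ → ρ < r →
        QuasiMin.varCap p (Metric.closedBall (0 : EuclideanSpace ℝ (Fin n)) ρ)
            (Metric.ball 0 r) =
          ENNReal.ofReal
            (n * (MeasureTheory.volume (Metric.ball (0 : EuclideanSpace ℝ (Fin n)) 1)).toReal *
              ((n - p) / (p - 1)) ^ (p - 1) *
              (ρ ^ (-((n - p) / (p - 1))) - r ^ (-((n - p) / (p - 1)))) ^ (1 - p))) ∧
      (∃ C : ℝ, 0 < C ∧ ∀ ε : ℝ, 0 < ε → ε ≤ 1 →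
        (∀ r : ℝ, 2 * QuasiMin.truncRadius γ ε ≤ r →
          ENNReal.ofReal (C⁻¹ * QuasiMin.truncRadius γ ε ^ (n - p)) ≤
            QuasiMin.varCap p
              (Metric.closedBall (0 : EuclideanSpace ℝ (Fin n)) (QuasiMin.truncRadius γ ε))
              (Metric.ball 0 r) ∧
          QuasiMin.varCap p
              (Metric.closedBall (0 : EuclideanSpace ℝ (Fin n)) (QuasiMin.truncRadius γ ε))
              (Metric.ball 0 r) ≤
            ENNReal.ofReal (C * QuasiMin.truncRadius γ ε ^ (n - p))) ∧
        C⁻¹ * ε ^ ((n - p) / γ) ≤ QuasiMin.truncRadius γ ε ^ (n - p) ∧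
        QuasiMin.truncRadius γ ε ^ (n - p) ≤ C * ε ^ ((n - p) / γ)) ∧
      -- the sum in the iterated estimate
      (∀ (δ r : ℝ) (k : ℕ), 0 < δ → 0 < r → r ≤ 1 →
        ∃ C : ℝ, 0 < C ∧ ∀ ε : ℝ, 0 < ε → ε ^ (1 / γ) ≤ r / 3 ^ (k + 1) →
          C⁻¹ * (ε ^ (1 / γ) / (r / 3 ^ k)) ^ ((n - p) / δ) ≤
            QuasiMin.wienerSum p δ (0 : EuclideanSpace ℝ (Fin n)) r k
              (Metric.closedBall 0 (QuasiMin.truncRadius γ ε)) ∧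
          QuasiMin.wienerSum p δ (0 : EuclideanSpace ℝ (Fin n)) r k
              (Metric.closedBall 0 (QuasiMin.truncRadius γ ε)) ≤
            C * (ε ^ (1 / γ) / (r / 3 ^ k)) ^ ((n - p) / δ)) ∧
      -- the bounds for the potentials of the small balls force δ ≤ (n - p) / γ
      (∀ δ c ε₀ : ℝ, 0 < δ → 0 < c → 0 < ε₀ →
        (∀ ε : ℝ, 0 < ε → ε < ε₀ →
          QuasiMin.MartioBound p δ c (0 : EuclideanSpace ℝ (Fin n)) (1 / 3)
            (Metric.closedBall 0 (QuasiMin.truncRadius γ ε)) (QuasiMin.truncPower γ ε)) →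
        δ ≤ (n - p) / γ) ∧
      (∀ (δ c ε₀ : ℝ) (k : ℕ), 0 < δ → 0 < c → 0 < ε₀ →
        (∀ ε : ℝ, 0 < ε → ε < ε₀ →
          QuasiMin.IteratedBound p δ c (0 : EuclideanSpace ℝ (Fin n)) 1 k
            (Metric.closedBall 0 (QuasiMin.truncRadius γ ε)) (QuasiMin.truncPower γ ε)) →
        δ ≤ (n - p) / γ) ∧
      -- hence the general estimates can only hold for exponents 1 / δ ≥ α / (p - 1)
      (∀ δ : ℝ, 0 < δ → QuasiMin.MartioEstimate n p Q δ → α / (p - 1) ≤ 1 / δ) ∧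
      (∀ (δ : ℝ) (k : ℕ), 0 < δ → QuasiMin.IteratedEstimateAt n p Q δ k →
        α / (p - 1) ≤ 1 / δ) ∧
      -- that is, only for s ≤ p₁ when δ = p - s / (s - 1)
      (∀ s : ℝ, p / (p - 1) < s →
        QuasiMin.MartioEstimate n p Q (p - s / (s - 1)) → s ≤ p₁) ∧
      (∀ (s : ℝ) (k : ℕ), p / (p - 1) < s →
        QuasiMin.IteratedEstimateAt n p Q (p - s / (s - 1)) k → s ≤ p₁) := by
  obtain ⟨α, hα, hαQ, hαu⟩ := QuasiMin.exists_isAlphaBar hp hQ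
  obtain ⟨p₁, hp₁, hp₁u, hPp₁, hp₁α⟩ := QuasiMin.exists_isPOne hp hQ hα hαQ hαu
  have hp0 : 0 < p := by linarith
  have hp1 : 0 < p - 1 := by linarith
  have hnp : 0 < n - p := by linarith
  have hα0 : 0 < α := by linarith
  have hn : 0 < n := by exact_mod_cast hp0.trans hpn
  set β := (n - p) / (p - 1) with hβ
  have hβ0 : 0 < β := by positivity
  have hβp1 : β * (p - 1) = n - p := div_mul_cancel₀ _ hp1.ne'
  have hβp : n + β = (β + 1) * p := by linarith
  set γ := α * β with hγ
  have hγ0 : 0 < γ := by positivity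
  have hnγ : (n - p) / γ = (p - 1) / α := by
    rw [← hβp1, hγ]; field_simp
  have hQα := hαQ.2
  have hP1 : 1 < p / (p - 1) := by rw [lt_div_iff₀ hp1]; linarith
  -- the exponent `δ = p - s / (s - 1)` is positive and increasing in `s`
  have hs : ∀ s, p / (p - 1) < s →
      0 < p - s / (s - 1) ∧ (p - s / (s - 1) ≤ (n - p) / γ → s ≤ p₁) := fun s hs => by
    have hs1 : 0 < s - 1 := by linarith
    have hp₁1 : 0 < p₁ - 1 := by linarith
    refine ⟨?_, fun h => ?_⟩
    · rw [div_lt_iff₀ hp1] at hs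
      rw [sub_pos, div_lt_iff₀ hs1]
      linarith
    · rw [hnγ, ← hp₁α, sub_le_sub_iff_left, div_le_div_iff₀ hp₁1 hs1] at h
      linarith
  have hδ : ∀ δ, 0 < δ → δ ≤ (n - p) / γ → α / (p - 1) ≤ 1 / δ := fun δ hδ h => by
    rw [hnγ] at h
    simpa using one_div_le_one_div_of_le hδ h
  refine ⟨α, p₁, γ, ⟨hαQ, hαu⟩, ⟨hp₁, hp₁u⟩, by rw [hγ, hβ, mul_div_assoc], ?_, hnγ, hp₁α,
    ⟨?_, fun Q' hQ' => QuasiMin.le_of_isQuasiminimizer hn hp hα hβ0 hβp hγ hQα hQ'⟩,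
    fun ε hε => QuasiMin.isQuasiminPotential_truncPower hn hp hα.le hβ0 hβp hγ hQα hε,
    fun ε ρ hε hρ _ => QuasiMin.isGLB_truncPower hn hγ0 hε hρ,
    fun ρ r hρ hρr => QuasiMin.varCap_closedBall_ball hn hp hβ0 hβp hρ hρr,
    QuasiMin.exists_varCap_truncRadius_comparison hn hp hpn hβ0 hβp hγ0,
    fun δ r k hδ hr hr1 =>
      QuasiMin.exists_wienerSum_comparison hn hp hpn hβ0 hβp hγ0 k hδ hr hr1,
    fun δ c ε₀ hδ hc hε₀ H => QuasiMin.le_of_martioBound hn hp hpn hβ0 hβp hγ0 hδ hc hε₀ H,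
    fun δ c ε₀ k hδ hc hε₀ H => QuasiMin.le_of_iteratedBound hn hp hpn hβ0 hβp hγ0 k hδ hc hε₀ H,
    fun δ hδ0 H => hδ δ hδ0
      (QuasiMin.le_of_martioEstimate hn hp hpn hα.le hβ0 hβp hγ hQα hδ0 H),
    fun δ k hδ0 H => hδ δ hδ0
      (QuasiMin.le_of_iteratedEstimateAt hn hp hpn hα.le hβ0 hβp hγ hQα hδ0 H),
    fun s hsP H => (hs s hsP).2
      (QuasiMin.le_of_martioEstimate hn hp hpn hα.le hβ0 hβp hγ hQα (hs s hsP).1 H),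
    fun s k hsP H => (hs s hsP).2
      (QuasiMin.le_of_iteratedEstimateAt hn hp hpn hα.le hβ0 hβp hγ hQα (hs s hsP).1 H)⟩
  · have h1 : n / p - 1 < β := by
      rw [hβ, div_sub_one hp0.ne']
      exact div_lt_div_of_pos_left hnp hp1 (by linarith)
    exact h1.trans_le (le_mul_of_one_le_left hβ0.le hα.le)
  · refine QuasiMin.isQuasiminimizer_of_hasGradientAt hn hp hα.le hβ0 hβp hQα subset_rfl
      (isOpen_ball.sdiff isClosed_singleton) one_pos fun x hx => ?_
    rw [one_smul]
    exact QuasiMin.hasGradientAt_power hγ hx.2
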